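/- \textbf{Setting.} Finitely many agents communicate over an undirected graph; $\mathcal N_i$ is the set of neighbors of agent $i$. The agents are split into legitimate agents $\mathcal L$ and malicious agents $\mathcal M$, and the subgraph induced by $\mathcal L$ is connected (so $\mathcal L\neq\emptyset$). For $i\in\mathcal L$, $j\in\mathcal N_i$, $t\ge 0$ there are trust observations $\alpha_{ij}(t)$, random variables with values in $[0,1]$, all mutually independent and, for fixed $(i,j)$, identically distributed in $t$. There are scalars $E_{\mathcal L}>0>E_{\mathcal M}$ with $\mathbb E[\alpha_{ij}(t)]-\frac12=E_{\mathcal L}$ if $j\in\mathcal L$ and $=E_{\mathcal M}$ if $j\in\mathcal M$. The set $\mathcal X\subset\mathbb R^d$ is compact and convex with $\|x\|\le\eta$ on $\mathcal X$ for some $\eta>0$. For $i\in\mathcal L$, $f_i:\mathbb R^d\to\mathbb R$ is differentiable, $\mu$-strongly convex ($\mu>0$), $\nabla f_i$ is $L$-Lipschitz ($L\ge 0$), and $\|\nabla f_i\|\le G$ on $\mathcal X$. Let $x^\star_{\mathcal L}$ be the minimizer over $\mathcal X$ of $\frac1{|\mathcal L|}\sum_{i\in\mathcal L}f_i$. \textbf{Algorithm.}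 Let $T_0\in\mathbb Z_{\ge0}$, stepsizes $\gamma(t)\ge0$, and $x_i(0)\in\mathcal X$ for $i\in\mathcal L$. Put $\beta_{ij}(t)=\sum_{k=0}^{t-1}(\alpha_{ij}(k)-\frac12)$, $\mathcal N_i(t)=\{j\in\mathcal N_i:\beta_{ij}(t)\ge 0\}$, $d_i(t)=|\mathcal N_i(t)|+1$. At time $t$ every legitimate agent $j$ sends $(x_j(t),d_j(t))$ to its neighbors; a malicious agent sends an arbitrary random point of $\mathcal X$ and an arbitrary random number, possibly different ones to different neighbors. For $i\in\mathcal L$, $j\in\mathcal N_i$ let $w_{ij}(t)=\frac{\mathbf 1\{t\ge T_0\}\mathbf 1\{j\in\mathcal N_i(t)\}}{2\max\{d_i(t),d_j(t)\}}$, $w_{ii}(t)=1-\sum_{m\in\mathcal N_i}w_{im}(t)$, and, with $x_j(t),d_j(t)$ the values received from $j$, $$c_i(t)=w_{ii}(t)x_i(t)+\sum_{j\in\mathcal N_i}w_{ij}(t)x_j(t),\qquad x_i(t+1)=\Pi_{\mathcal X}\big(c_i(t)-\gamma(t-T_0)\nabla f_i(c_i(t))\big),$$ where $\gamma(s)=0$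 for $s<0$ and $\Pi_{\mathcal X}$ is the Euclidean projection onto $\mathcal X$. \textbf{Constants.} Let $d_{i,\mathcal L}=|\mathcal N_i\cap\mathcal L|+1$, and let $\overline W$ be the $\mathcal L\times\mathcal L$ matrix with $\overline W_{ij}=\frac1{2\max\{d_{i,\mathcal L},d_{j,\mathcal L}\}}$ if $j\in\mathcal N_i$, $\overline W_{ij}=0$ if $j\notin\mathcal N_i\cup\{i\}$, and rows summing to $1$. Let $\rho=\max_{k\ge1}\sigma_2(\overline W^k)$, with $\sigma_2$ the second largest singular value ($0$ for a $1\times1$ matrix), $D_{\mathcal L}=\sum_{i\in\mathcal L}|\mathcal N_i\cap\mathcal L|$, $D_{\mathcal M}=\sum_{i\in\mathcal L}|\mathcal N_i\cap\mathcal M|$, and $$\overline h(T)=\tfrac{G^2T}{\mu}+\tfrac{2G^2T}{\mu(1-\rho)}+\tfrac{8(\mu+L)G^2}{\mu^2(1-\rho)^2}\ln\tfrac{T+2}{2}+\tfrac{2\eta G}{1-\rho}+\tfrac{2(\mu+L)(\mu\eta+2G)^2}{\mu^2(1-\rho)^2}+\tfrac{2G^2+4G\eta(\mu+L)}{\mu(1-\rho)^3}+\tfrac{G^2(\mu+L)}{\mu^2(1-\rho)^4},$$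 $$\widetilde C_1(T_0,E,D)=\tfrac{16\eta e^{-T_0E^2}\sqrt D}{1-\rho}\Big[\tfrac{G}{(1-e^{-E^2})^2}+\tfrac{G+(\eta+\frac4\mu)(\mu+L)}{(1-\rho)^2}+\tfrac{(\mu+L)(G+2\mu\sqrt De^{-T_0E^2})}{\mu(1-\rho)^3}\Big],$$ $$\widetilde C_2(T_0,E,D)=\tfrac{4\eta(L+1)De^{-2T_0E^2}}{1-e^{-2E^2}}\Big[\tfrac{4\eta e^{-2E^2}}{(1-e^{-2E^2})^2}+\tfrac{(6\eta+\frac G\mu)e^{-2E^2}}{1-e^{-2E^2}}+4\eta+\tfrac{4\eta L}{\mu^2}+\tfrac G\mu\Big],$$ $$C_{\mathcal M}(T_0)=2\big[\widetilde C_1(T_0,E_{\mathcal L},D_{\mathcal L})+\widetilde C_1(T_0,E_{\mathcal M},D_{\mathcal M})\big]+\mu\big[\widetilde C_2(T_0,E_{\mathcal L},D_{\mathcal L})+\widetilde C_2(T_0,E_{\mathcal M},D_{\mathcal M})\big].$$ \textbf{Theorem.} (a) For every $T_0\ge0$, all $x_i(0)\in\mathcal X$ and every behavior of the malicious agents, if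 $\gamma(t)\ge 0$, $\sum_t\gamma(t)=\infty$ and $\sum_t\gamma(t)^2<\infty$, then $\|x_i(t)-x^\star_{\mathcal L}\|^2$ is integrable for all $t$ and $\lim_{t\to\infty}\mathbb E\|x_i(t)-x^\star_{\mathcal L}\|^2=0$ for every $i\in\mathcal L$. (b) Let $\gamma(t)=\frac{2}{\mu(t+2)}$. For every $T_0\ge0$, all $x_i(0)\in\mathcal X$, every behavior of the malicious agents, and all $T\ge T_0$, $$\frac1{|\mathcal L|}\sum_{i\in\mathcal L}\mathbb E\|x_i(T)-x^\star_{\mathcal L}\|^2\le\min\Big\{4\eta^2,\frac{4\overline h(T-T_0)+C_{\mathcal M}(T_0)}{\mu(T-T_0)(T-T_0+1)}\Big\},$$ where for $T=T_0$ the second term is read as $+\infty$. For each fixed $T_0$ the left side is $O(1/T)$ as $T\to\infty$. (c) $C_{\mathcal M}$ does not depend on $T$; it is nonnegative and nonincreasing in $T_0$, and there are $K,c>0$ with $C_{\mathcal M}(T_0)\le Ke^{-cT_0}$ for all $T_0\ge0$. -/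

import Mathlib

open MeasureTheory ProbabilityTheory Filter Topology Asymptotics

noncomputable section

namespace ResilientOpt

/-- The decision space `ℝ^d` with the Euclidean norm. -/
abbrev Vec (d : ℕ) := EuclideanSpace ℝ (Fin d)

/-- The projection of `y` onto `X`: a point of `X` nearest to `y`
(it exists and is unique when `X` is non-empty, closed and convex). -/
def proj {d : ℕ} (X : Set (Vec d)) (y : Vec d) : Vec d :=
  Classical.epsilon fun p => p ∈ X ∧ ∀ z ∈ X, ‖p - y‖ ≤ ‖z - y‖

section Algorithm

variable {V : Type*} [Fintype V] [DecidableEq V] {Ω : Type*} {d : ℕ}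

/-- `β_ij(t) = ∑_{k < t} (α_ij(k) - 1/2)`, the accumulated trust of agent `i` in agent `j`. -/
def trustSum (α : V → V → ℕ → Ω → ℝ) (i j : V) (t : ℕ) (ω : Ω) : ℝ :=
  ∑ k ∈ Finset.range t, (α i j k ω - 1 / 2)

/-- `N_i(t)`: the neighbors that agent `i` trusts at time `t`. -/
def trustedNbrs (G : SimpleGraph V) [DecidableRel G.Adj] (α : V → V → ℕ → Ω → ℝ)
    (i : V) (t : ℕ) (ω : Ω) : Finset V :=
  (G.neighborFinset i).filter fun j => 0 ≤ trustSum α i j t ω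

/-- `d_i(t) = |N_i(t)| + 1`. -/
def trustDegree (G : SimpleGraph V) [DecidableRel G.Adj] (α : V → V → ℕ → Ω → ℝ)
    (i : V) (t : ℕ) (ω : Ω) : ℝ :=
  ((trustedNbrs G α i t ω).card : ℝ) + 1

/-- The number `d_j(t)` which agent `i` receives from agent `j`: a legitimate agent `j`
(`j ∈ Leg`) sends its true value, a malicious one an arbitrary number `b i j t`. -/
def receivedDegree (G : SimpleGraph V) [DecidableRel G.Adj] (Leg : Finset V)
    (α b : V → V → ℕ → Ω → ℝ) (i j : V) (t : ℕ) (ω : Ω) : ℝ :=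
  if j ∈ Leg then trustDegree G α j t ω else b i j t ω

/-- The weight `w_ij(t)` which agent `i` gives to its neighbor `j`; it vanishes before time `T₀`. -/
def weight (G : SimpleGraph V) [DecidableRel G.Adj] (Leg : Finset V)
    (α b : V → V → ℕ → Ω → ℝ) (T₀ : ℕ) (i j : V) (t : ℕ) (ω : Ω) : ℝ :=
  if T₀ ≤ t ∧ j ∈ trustedNbrs G α i t ω then
    1 / (2 * max (trustDegree G α i t ω) (receivedDegree G Leg α b i j t ω))
  else 0

/-- The self-weight `w_ii(t)`. -/
def selfWeight (G : SimpleGraph V) [DecidableRel G.Adj] (Leg : Finset V)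
    (α b : V → V → ℕ → Ω → ℝ) (T₀ : ℕ) (i : V) (t : ℕ) (ω : Ω) : ℝ :=
  1 - ∑ m ∈ G.neighborFinset i, weight G Leg α b T₀ i m t ω

/-- The iterates `x_i(t)` of the algorithm, started at `x₀`, with trust observations `α`,
step sizes `γ`, and delay `T₀`. A malicious neighbor `j` sends agent `i` at time `t` the point
`u i j t` and the number `b i j t`. Only the components with `i ∈ Leg` are meaningful; the other
components are never used in computing them. The step size at time `t` is
`γ(t - T₀)`, and zero when `t < T₀`. -/
def iterate (G : SimpleGraph V) [DecidableRel G.Adj] (Leg : Finset V)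
    (X : Set (Vec d)) (f : V → Vec d → ℝ) (α b : V → V → ℕ → Ω → ℝ)
    (u : V → V → ℕ → Ω → Vec d) (γ : ℕ → ℝ) (T₀ : ℕ) (x₀ : V → Vec d) :
    ℕ → Ω → V → Vec d
  | 0, _, i => x₀ i
  | t + 1, ω, i =>
    let x := iterate G Leg X f α b u γ T₀ x₀ t ω
    let c := selfWeight G Leg α b T₀ i t ω • x i +
      ∑ j ∈ G.neighborFinset i,
        weight G Leg α b T₀ i j t ω • (if j ∈ Leg then x j else u i j t ω)
    let step : ℝ := if T₀ ≤ t then γ (t - T₀) else 0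
    proj X (c - step • gradient (f i) c)

/-- `f_L = (1/|L|) ∑_{i ∈ L} f_i`. -/
def legObjective (Leg : Finset V) (f : V → Vec d → ℝ) (x : Vec d) : ℝ :=
  (1 / (Leg.card : ℝ)) * ∑ i ∈ Leg, f i x

end Algorithm

section Constants

variable {V : Type*} [Fintype V] [DecidableEq V]

/-- `D_L`: the number of pairs `(i, j)` with `i` legitimate and `j` a legitimate neighbor. -/
def numLeg (G : SimpleGraph V) [DecidableRel G.Adj] (Leg : Finset V) : ℝ :=
  ∑ i ∈ Leg, ((G.neighborFinset i ∩ Leg).card : ℝ)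

/-- `D_M`: the number of pairs `(i, j)` with `i` legitimate and `j` a malicious neighbor. -/
def numMal (G : SimpleGraph V) [DecidableRel G.Adj] (Leg : Finset V) : ℝ :=
  ∑ i ∈ Leg, ((G.neighborFinset i \ Leg).card : ℝ)

/-- `d_{i,L} = |N_i ∩ L| + 1`. -/
def legDegree (G : SimpleGraph V) [DecidableRel G.Adj] (Leg : Finset V) (i : V) : ℝ :=
  ((G.neighborFinset i ∩ Leg).card : ℝ) + 1

/-- The off-diagonal nominal weights. -/
def nominalWeight (G : SimpleGraph V) [DecidableRel G.Adj] (Leg : Finset V) (i j : V) : ℝ :=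
  if G.Adj i j then 1 / (2 * max (legDegree G Leg i) (legDegree G Leg j)) else 0

/-- The nominal weight matrix of the legitimate agents. -/
def nominalMatrix (G : SimpleGraph V) [DecidableRel G.Adj] (Leg : Finset V) :
    Matrix Leg Leg ℝ :=
  Matrix.of fun i j =>
    if i = j then 1 - ∑ m ∈ G.neighborFinset i ∩ Leg, nominalWeight G Leg i m
    else nominalWeight G Leg i j

/-- The second largest singular value of a square matrix (`0` for a `1 × 1` matrix). Mathlib's
singular values are listed in descending order, with multiplicity, and numbered from `0`. -/
def sigmaTwo {n : Type*} [Fintype n] [DecidableEq n] (A : Matrix n n ℝ) : ℝ :=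
  (Matrix.toEuclideanLin A).singularValues 1

/-- `ρ_L`, the maximum over `k ≥ 1` of the second largest singular value of the `k`-th power of
the nominal weight matrix. -/
def rhoLeg (G : SimpleGraph V) [DecidableRel G.Adj] (Leg : Finset V) : ℝ :=
  ⨆ k : ℕ, sigmaTwo (nominalMatrix G Leg ^ (k + 1))

/-- The function `h̄(T)`, with `g` the bound on the gradients. -/
def hBar (μ L η g ρ T : ℝ) : ℝ :=
  g ^ 2 * T / μ + 2 * g ^ 2 * T / (μ * (1 - ρ))
    + 8 * (μ + L) * g ^ 2 / (μ ^ 2 * (1 - ρ) ^ 2) * Real.log ((T + 2) / 2)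
    + 2 * η * g / (1 - ρ)
    + 2 * (μ + L) * (μ * η + 2 * g) ^ 2 / (μ ^ 2 * (1 - ρ) ^ 2)
    + (2 * g ^ 2 + 4 * g * η * (μ + L)) / (μ * (1 - ρ) ^ 3)
    + g ^ 2 * (μ + L) / (μ ^ 2 * (1 - ρ) ^ 4)

/-- The constant `C̃₁(T₀, E, D)`. -/
def cOne (μ L η g ρ E D : ℝ) (T₀ : ℕ) : ℝ :=
  16 * η * Real.exp (-(T₀ * E ^ 2)) * √D / (1 - ρ) *
    (g / (1 - Real.exp (-E ^ 2)) ^ 2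
      + (g + (η + 4 / μ) * (μ + L)) / (1 - ρ) ^ 2
      + (μ + L) * (g + 2 * μ * √D * Real.exp (-(T₀ * E ^ 2))) / (μ * (1 - ρ) ^ 3))

/-- The constant `C̃₂(T₀, E, D)`. -/
def cTwo (μ L η g E D : ℝ) (T₀ : ℕ) : ℝ :=
  4 * η * (L + 1) * D * Real.exp (-(2 * T₀ * E ^ 2)) / (1 - Real.exp (-(2 * E ^ 2))) *
    (4 * η * Real.exp (-(2 * E ^ 2)) / (1 - Real.exp (-(2 * E ^ 2))) ^ 2
      + (6 * η + g / μ) * Real.exp (-(2 * E ^ 2)) / (1 - Real.exp (-(2 * E ^ 2)))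
      + 4 * η + 4 * η * L / μ ^ 2 + g / μ)

/-- The constant `C_M(T₀)`, the contribution of classification errors to the rate. -/
def cMal (μ L η g ρ EL EM DL DM : ℝ) (T₀ : ℕ) : ℝ :=
  2 * (cOne μ L η g ρ EL DL T₀ + cOne μ L η g ρ EM DM T₀)
    + μ * (cTwo μ L η g EL DL T₀ + cTwo μ L η g EM DM T₀)

end Constants

end ResilientOpt

end

/-! The argument is pathwise: for each outcome the dynamics after the delay is reduced to two scalar
recursions, driven by the number `m` of misclassified pairs (legitimate agent, neighbor). No
property of the malicious messages beyond membership in `X` and measurability matters, because a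
malicious neighbor gets weight only when it is misclassified.

The nominal matrix is symmetric and stochastic with positive diagonal and connected support, so its
second singular value is below one, and it is the largest among those of its powers
(`IsMixing.sigmaTwo_lt_one`, `IsMixing.iSup_sigmaTwo_pow`). The actual weights differ from the
nominal ones by at most `2m` in total (`sum_abs_weight_sub_le`). Mixing therefore raises the total
squared distance to the minimizer by at most `8η²m`, and it contracts the deviation from consensus
by `ρ` up to an error `3η√m`. A projected gradient step of size `γ` then contracts the squared
distance by `1 - γμ`, at a cost of order `γ²g²` plus `γg` times the deviation
(`sum_norm_sq_step_le`). `IsProblem.exists_recursion` collects these facts.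

For the rate, multiplying the distance recursion by `(τ+1)(τ+2)` makes it telescope, and summing the
deviation recursion bounds the remaining weighted sums. The resulting bound is linear in `m` and
`√m`, so expectations can be taken termwise: Hoeffding's inequality gives `E m` exponential decay,
Jensen's inequality gives `E √m` half the exponent, and geometric sums fit inside the stated,
generous constants.

For general step sizes, `m` is almost surely summable, since its expectations are. The squared
deviations are then summable, a deterministic Robbins–Siegmund argument (`tendsto_zero_of_step_le`)
gives almost sure convergence, and boundedness of `X` turns it into mean square convergence. -/

namespace ResilientOpt

/-! ### Variational bounds for the second singular value -/

section SingularValues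

open Module

variable {E : Type*} [NormedAddCommGroup E] [InnerProductSpace ℝ E] [FiniteDimensional ℝ E]

theorem norm_sq_apply_eq_sum_eigenvalues (T : E →ₗ[ℝ] E) {n : ℕ} (hn : finrank ℝ E = n) (x : E) :
    ‖T x‖ ^ 2 = ∑ k : Fin n, T.isSymmetric_adjoint_comp_self.eigenvalues hn k *
      (inner ℝ (T.isSymmetric_adjoint_comp_self.eigenvectorBasis hn k) x) ^ 2 := by
  set hS := T.isSymmetric_adjoint_comp_self
  set b := hS.eigenvectorBasis hn
  have h1 : ‖T x‖ ^ 2 = inner ℝ x ((T.adjoint ∘ₗ T) x) := by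
    rw [LinearMap.comp_apply, LinearMap.adjoint_inner_right, real_inner_self_eq_norm_sq]
  rw [h1, ← b.sum_inner_mul_inner]
  refine Finset.sum_congr rfl fun k _ => ?_
  rw [← hS (b k) x, hS.apply_eigenvectorBasis hn k, real_inner_comm]
  simp only [RCLike.ofReal_real_eq_id, id, inner_smul_left, conj_trivial]
  ring

/-- A map bounded by `c` on a hyperplane has second singular value at most `c`. -/
theorem singularValues_one_le (T : E →ₗ[ℝ] E) (v : E) {c : ℝ} (hc : 0 ≤ c)
    (h : ∀ x, inner ℝ v x = 0 → ‖T x‖ ≤ c * ‖x‖) : T.singularValues 1 ≤ c := by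
  rcases le_or_gt (finrank ℝ E) 1 with hn | hn
  · rw [T.singularValues_of_finrank_le hn]; exact hc
  set hS := T.isSymmetric_adjoint_comp_self
  set b := hS.eigenvectorBasis rfl
  let i0 : Fin (finrank ℝ E) := ⟨0, by omega⟩
  let i1 : Fin (finrank ℝ E) := ⟨1, hn⟩
  have h01 : i0 ≠ i1 := by simp [i0, i1]
  -- Courant–Fischer: the plane of the two leading eigenvectors of `T* T` meets the hyperplane
  -- orthogonal to `v` in a nonzero vector, and on that plane `‖T y‖²` is at least the second
  -- eigenvalue times `‖y‖²`.
  obtain ⟨p, q, hpq, hperp⟩ : ∃ p q : ℝ, p ^ 2 + q ^ 2 ≠ 0 ∧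
      p * inner ℝ v (b i0) + q * inner ℝ v (b i1) = 0 := by
    by_cases h0 : inner ℝ v (b i0) = 0
    · exact ⟨1, 0, by norm_num, by simp [h0]⟩
    · refine ⟨inner ℝ v (b i1), -inner ℝ v (b i0), ne_of_gt ?_, by ring⟩
      have := sq_pos_of_ne_zero h0
      nlinarith [sq_nonneg (inner ℝ v (b i1))]
  set y := p • b i0 + q • b i1 with hy
  have hcoef : ∀ k, inner ℝ (b k) y = if k = i0 then p else if k = i1 then q else 0 := by
    intro k
    rw [hy, inner_add_right, inner_smul_right, inner_smul_right, b.inner_eq_ite, b.inner_eq_ite]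
    split_ifs with h2 h3 <;> simp_all
  have hnorm : ‖y‖ ^ 2 = p ^ 2 + q ^ 2 := by
    rw [← b.sum_sq_inner_right y]
    simp_rw [hcoef]
    rw [Finset.sum_eq_add i0 i1 h01 (by intro k _ hk; simp [hk.1, hk.2]) (by simp) (by simp)]
    simp [h01.symm]
  have hT : ‖T y‖ ^ 2 = hS.eigenvalues rfl i0 * p ^ 2 + hS.eigenvalues rfl i1 * q ^ 2 := by
    rw [norm_sq_apply_eq_sum_eigenvalues T rfl]
    change ∑ k, hS.eigenvalues rfl k * (inner ℝ (b k) y) ^ 2 = _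
    simp_rw [hcoef]
    rw [Finset.sum_eq_add i0 i1 h01 (by intro k _ hk; simp [hk.1, hk.2]) (by simp) (by simp)]
    simp [h01.symm]
  have hle : hS.eigenvalues rfl i1 ≤ hS.eigenvalues rfl i0 :=
    hS.eigenvalues_antitone rfl (by simp [i0, i1, Fin.le_def])
  have hb := h y (by rw [hy, inner_add_right, inner_smul_right, inner_smul_right]; exact hperp)
  have hb2 : ‖T y‖ ^ 2 ≤ c ^ 2 * ‖y‖ ^ 2 := by
    rw [← mul_pow]; exact pow_le_pow_left₀ (norm_nonneg _) hb 2
  have hpos : 0 < p ^ 2 + q ^ 2 := lt_of_le_of_ne (by positivity) hpq.symm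
  rw [hT, hnorm] at hb2
  have hl : T.singularValues 1 ^ 2 ≤ c ^ 2 := by
    rw [T.sq_singularValues_of_lt rfl hn]
    change hS.eigenvalues rfl i1 ≤ _
    by_contra hcon
    push Not at hcon
    nlinarith [mul_le_mul_of_nonneg_right hle (sq_nonneg p), mul_lt_mul_of_pos_right hcon hpos]
  exact le_of_sq_le_sq hl hc

/-- A contraction `T` with `T* T v = v` is bounded by its second singular value on the orthogonal
complement of `v`. -/
theorem norm_apply_le_singularValues_one (T : E →ₗ[ℝ] E) (v : E)
    (hT : ∀ x, ‖T x‖ ≤ ‖x‖) (hv : T.adjoint (T v) = v) (x : E) (hx : inner ℝ v x = 0)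
    (hv0 : v ≠ 0) : ‖T x‖ ≤ T.singularValues 1 * ‖x‖ := by
  rcases le_or_gt 1 (T.singularValues 1) with h1 | h1
  · exact (hT x).trans (le_mul_of_one_le_left (norm_nonneg _) h1)
  set hS := T.isSymmetric_adjoint_comp_self
  set b := hS.eigenvectorBasis rfl
  have hk : ∀ k : Fin (finrank ℝ E), 1 ≤ k.1 →
      hS.eigenvalues rfl k ≤ T.singularValues 1 ^ 2 := by
    intro k hk
    rw [← T.sq_singularValues_fin rfl k]
    exact pow_le_pow_left₀ (T.singularValues_nonneg _) (T.singularValues_antitone hk) 2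
  have hlt : T.singularValues 1 ^ 2 < 1 := by
    have := T.singularValues_nonneg 1; nlinarith
  -- All eigenvalues of index at least one are below 1, while `v` is an eigenvector for the
  -- eigenvalue 1.
  have hvk : ∀ k : Fin (finrank ℝ E), 1 ≤ k.1 → inner ℝ (b k) v = 0 := by
    intro k hk1
    have h2 : inner ℝ (b k) ((T.adjoint ∘ₗ T) v) = hS.eigenvalues rfl k * inner ℝ (b k) v := by
      rw [← hS (b k) v, hS.apply_eigenvectorBasis rfl k]
      simp [inner_smul_left, b]
    rw [LinearMap.comp_apply, hv] at h2
    have := hk k hk1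
    have h3 : (1 - hS.eigenvalues rfl k) * inner ℝ (b k) v = 0 := by linarith
    rcases mul_eq_zero.1 h3 with h | h
    · linarith
    · exact h
  have hterm : ∀ k : Fin (finrank ℝ E), hS.eigenvalues rfl k * (inner ℝ (b k) x) ^ 2 ≤
      T.singularValues 1 ^ 2 * (inner ℝ (b k) x) ^ 2 := by
    intro k
    rcases Nat.eq_zero_or_pos k.1 with h0 | h0
    -- By `hvk`, `v` is a nonzero multiple of the leading eigenvector, so orthogonality to `v`
    -- removes the one coefficient whose eigenvalue is not controlled.
    · have hx0 : inner ℝ (b k) x = 0 := by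
        rw [← b.sum_inner_mul_inner, Finset.sum_eq_single k] at hx
        · rcases mul_eq_zero.1 hx with h | h
          · exfalso
            apply hv0
            rw [← norm_eq_zero, ← sq_eq_zero_iff, ← b.sum_sq_inner_right v]
            refine Finset.sum_eq_zero fun j _ => ?_
            rw [sq_eq_zero_iff]
            by_cases hj : j = k
            · rw [hj, real_inner_comm]; exact h
            · apply hvk
              rcases Nat.eq_zero_or_pos j.1 with h' | h'
              · exact absurd (Fin.ext (h'.trans h0.symm)) hj
              · exact h'
          · exact h
        · intro j _ hj
          rw [real_inner_comm, hvk j, zero_mul]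
          rcases Nat.eq_zero_or_pos j.1 with h' | h'
          · exact absurd (Fin.ext (h'.trans h0.symm)) hj
          · exact h'
        · simp
      simp [hx0]
    · exact mul_le_mul_of_nonneg_right (hk k h0) (sq_nonneg _)
  have hsq : ‖T x‖ ^ 2 ≤ (T.singularValues 1 * ‖x‖) ^ 2 := by
    rw [norm_sq_apply_eq_sum_eigenvalues T rfl, mul_pow, ← b.sum_sq_inner_right x, Finset.mul_sum]
    exact Finset.sum_le_sum fun k _ => hterm k
  exact le_of_sq_le_sq hsq (mul_nonneg (T.singularValues_nonneg 1) (norm_nonneg _))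

/-- Otherwise `T` would preserve the norms of the two leading eigenvectors, so both would lie on the
line of `v`, which cannot hold two orthonormal vectors. -/
theorem singularValues_one_lt_one (T : E →ₗ[ℝ] E) (v : E)
    (hT : ∀ x, ‖T x‖ ≤ ‖x‖) (hv : ∀ x, ‖T x‖ = ‖x‖ → ∃ r : ℝ, x = r • v) :
    T.singularValues 1 < 1 := by
  by_contra! h1
  rcases le_or_gt (finrank ℝ E) 1 with hn | hn
  · rw [T.singularValues_of_finrank_le hn] at h1; linarith
  set hS := T.isSymmetric_adjoint_comp_self
  set b := hS.eigenvectorBasis rfl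
  let i0 : Fin (finrank ℝ E) := ⟨0, by omega⟩
  let i1 : Fin (finrank ℝ E) := ⟨1, hn⟩
  have h01 : i0 ≠ i1 := by simp [i0, i1]
  have key : ∀ k : Fin (finrank ℝ E), k.1 ≤ 1 → ∃ r : ℝ, b k = r • v := by
    intro k hk
    apply hv
    have h2 : ‖T (b k)‖ ^ 2 = T.singularValues k ^ 2 := by
      rw [norm_sq_apply_eq_sum_eigenvalues T rfl, T.sq_singularValues_fin rfl k]
      change ∑ j, hS.eigenvalues rfl j * (inner ℝ (b j) (b k)) ^ 2 = _
      simp_rw [b.inner_eq_ite]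
      simp
    have h3 : T.singularValues 1 ≤ T.singularValues k := T.singularValues_antitone hk
    have h4 := hT (b k)
    rw [b.norm_eq_one] at h4 ⊢
    have h5 := norm_nonneg (T (b k))
    have : ‖T (b k)‖ = T.singularValues k :=
      (sq_eq_sq₀ h5 (T.singularValues_nonneg _)).1 h2
    linarith
  obtain ⟨r, hr⟩ := key i0 (by simp [i0])
  obtain ⟨s, hs⟩ := key i1 (by simp [i1])
  have e0 : inner ℝ (b i0) (b i1) = 0 := by rw [b.inner_eq_ite, if_neg h01]
  have e1 : inner ℝ (b i0) (b i0) = (1 : ℝ) := by rw [b.inner_eq_ite, if_pos rfl]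
  have e2 : inner ℝ (b i1) (b i1) = (1 : ℝ) := by rw [b.inner_eq_ite, if_pos rfl]
  rw [hr, hs, inner_smul_left, inner_smul_right] at e0
  rw [hr, inner_smul_left, inner_smul_right] at e1
  rw [hs, inner_smul_left, inner_smul_right] at e2
  simp only [conj_trivial] at e0 e1 e2
  -- The Gram determinant of two parallel vectors vanishes, but for an orthonormal pair it is 1.
  have : (r * (r * inner ℝ v v)) * (s * (s * inner ℝ v v)) =
      (r * (s * inner ℝ v v)) * (r * (s * inner ℝ v v)) := by ring
  rw [e0, e1, e2] at this
  norm_num at this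

end SingularValues

/-! ### Symmetric stochastic matrices and their spectral gap -/

section Stochastic

variable {ι : Type*} [Fintype ι]

/-- A symmetric stochastic matrix with positive diagonal whose positive entries connect all
indices. -/
structure IsMixing (A : Matrix ι ι ℝ) : Prop where
  symm : ∀ i j, A i j = A j i
  nonneg : ∀ i j, 0 ≤ A i j
  row_sum : ∀ i, ∑ j, A i j = 1
  diag_pos : ∀ i, 0 < A i i
  connected : ∀ y : ι → ℝ, (∀ i j, 0 < A i j → y i = y j) → ∀ i j, y i = y j

variable {A : Matrix ι ι ℝ}

/-- The all-ones vector. -/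
noncomputable def ones (ι : Type*) [Fintype ι] : EuclideanSpace ℝ ι := WithLp.toLp 2 fun _ => 1

theorem inner_ones (x : EuclideanSpace ℝ ι) : inner ℝ (ones ι) x = ∑ i, x i := by
  simp [ones, PiLp.inner_apply]

theorem IsMixing.sum_mul_symm (hA : IsMixing A) (y : ι → ℝ) :
    ∑ i, ∑ j, A i j * y j = ∑ j, y j := by
  rw [Finset.sum_comm]
  refine Finset.sum_congr rfl fun j _ => ?_
  rw [← Finset.sum_mul, Finset.sum_congr rfl fun i _ => hA.symm i j, hA.row_sum, one_mul]

variable [DecidableEq ι]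

theorem toEuclideanLin_apply_apply (A : Matrix ι ι ℝ) (x : EuclideanSpace ℝ ι) (i : ι) :
    Matrix.toEuclideanLin A x i = ∑ j, A i j * x j := by
  rw [Matrix.toLpLin_apply]; rfl

/-- Row `i` is a probability vector under which `x` has mean `(A x) i`. The right side sums the
variances, each a mean of squares minus a squared mean; unit column sums turn the means of squares
into `‖x‖²`. -/
theorem IsMixing.norm_sq_sub (hA : IsMixing A) (x : EuclideanSpace ℝ ι) :
    ‖x‖ ^ 2 - ‖Matrix.toEuclideanLin A x‖ ^ 2 =
      ∑ i, ∑ j, A i j * (x j - Matrix.toEuclideanLin A x i) ^ 2 := by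
  rw [EuclideanSpace.real_norm_sq_eq, EuclideanSpace.real_norm_sq_eq,
    ← hA.sum_mul_symm (fun j => x j ^ 2), ← Finset.sum_sub_distrib]
  refine Finset.sum_congr rfl fun i _ => ?_
  set z := Matrix.toEuclideanLin A x i with hz
  rw [toEuclideanLin_apply_apply] at hz
  have : ∀ j, A i j * (x j - z) ^ 2 = A i j * x j ^ 2 - 2 * z * (A i j * x j) + z ^ 2 * A i j :=
    fun j => by ring
  simp_rw [this]
  rw [Finset.sum_add_distrib, Finset.sum_sub_distrib, ← Finset.mul_sum, ← Finset.mul_sum, ← hz,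
    hA.row_sum]
  ring

theorem IsMixing.norm_apply_le (hA : IsMixing A) (x : EuclideanSpace ℝ ι) :
    ‖Matrix.toEuclideanLin A x‖ ≤ ‖x‖ := by
  have h : 0 ≤ ‖x‖ ^ 2 - ‖Matrix.toEuclideanLin A x‖ ^ 2 := by
    rw [hA.norm_sq_sub]
    exact Finset.sum_nonneg fun i _ => Finset.sum_nonneg fun j _ =>
      mul_nonneg (hA.nonneg i j) (sq_nonneg _)
  exact le_of_sq_le_sq (by linarith) (norm_nonneg _)

/-- All row variances vanish, so `x j = (A x) i` whenever `A i j > 0`. The positive diagonal allows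
`j = i`; hence `x` agrees across positive entries, and connectivity finishes. -/
theorem IsMixing.eq_of_norm_apply_eq (hA : IsMixing A) (x : EuclideanSpace ℝ ι)
    (h : ‖Matrix.toEuclideanLin A x‖ = ‖x‖) (i j : ι) : x i = x j := by
  have h0 := hA.norm_sq_sub x
  rw [h, sub_self] at h0
  have hn : ∀ i j, 0 ≤ A i j * (x j - Matrix.toEuclideanLin A x i) ^ 2 := fun i j =>
    mul_nonneg (hA.nonneg i j) (sq_nonneg _)
  have h1 : ∀ i j, A i j * (x j - Matrix.toEuclideanLin A x i) ^ 2 = 0 := by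
    intro i j
    have h2 := (Finset.sum_eq_zero_iff_of_nonneg
      (fun i _ => Finset.sum_nonneg fun j _ => hn i j)).1 h0.symm i (Finset.mem_univ i)
    exact (Finset.sum_eq_zero_iff_of_nonneg (fun j _ => hn i j)).1 h2 j (Finset.mem_univ j)
  have h2 : ∀ i j, 0 < A i j → x j = Matrix.toEuclideanLin A x i := by
    intro i j hij
    have := (mul_eq_zero.1 (h1 i j)).resolve_left hij.ne'
    rw [sq_eq_zero_iff] at this
    linarith
  exact hA.connected x (fun i j hij => (h2 i i (hA.diag_pos i)).trans (h2 i j hij).symm) i j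

theorem toEuclideanLin_pow (A : Matrix ι ι ℝ) (k : ℕ) :
    Matrix.toEuclideanLin (A ^ k) = Matrix.toEuclideanLin A ^ k := by
  induction k with
  | zero => ext x i; simp
  | succ k ih =>
    rw [pow_succ, pow_succ, ← ih]
    ext x i
    simp [Matrix.toLpLin_apply]

theorem IsMixing.apply_ones (hA : IsMixing A) : Matrix.toEuclideanLin A (ones ι) = ones ι := by
  ext i
  rw [toEuclideanLin_apply_apply]
  simp [ones, hA.row_sum]

theorem IsMixing.sum_apply (hA : IsMixing A) (x : EuclideanSpace ℝ ι) :
    ∑ i, Matrix.toEuclideanLin A x i = ∑ i, x i := by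
  simp_rw [toEuclideanLin_apply_apply]
  exact hA.sum_mul_symm x

theorem IsMixing.adjoint_eq (hA : IsMixing A) :
    (Matrix.toEuclideanLin A).adjoint = Matrix.toEuclideanLin A := by
  rw [← Matrix.toEuclideanLin_conjTranspose_eq_adjoint]
  congr 1
  ext i j
  simp [hA.symm i j]

theorem IsMixing.norm_apply_le_sigmaTwo [Nonempty ι] (hA : IsMixing A) (x : EuclideanSpace ℝ ι)
    (hx : ∑ i, x i = 0) : ‖Matrix.toEuclideanLin A x‖ ≤ sigmaTwo A * ‖x‖ := by
  refine norm_apply_le_singularValues_one _ (ones ι) hA.norm_apply_le ?_ x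
    (by rw [inner_ones, hx]) ?_
  · rw [hA.adjoint_eq, hA.apply_ones, hA.apply_ones]
  · intro h
    have := congrArg (fun z : EuclideanSpace ℝ ι => z (Classical.arbitrary ι)) h
    simp [ones] at this

theorem IsMixing.sigmaTwo_lt_one [Nonempty ι] (hA : IsMixing A) : sigmaTwo A < 1 := by
  refine singularValues_one_lt_one _ (ones ι) hA.norm_apply_le fun x hx => ?_
  refine ⟨x (Classical.arbitrary ι), ?_⟩
  ext i
  simp [ones, hA.eq_of_norm_apply_eq x hx i (Classical.arbitrary ι)]

theorem sigmaTwo_nonneg (A : Matrix ι ι ℝ) : 0 ≤ sigmaTwo A :=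
  LinearMap.singularValues_nonneg _ _

/-- `A ^ k` keeps sum-zero vectors sum-zero without lengthening them, and one more factor `A`
shrinks them by `sigmaTwo A`. A bound on one hyperplane suffices for the second singular value. -/
theorem IsMixing.sigmaTwo_pow_le [Nonempty ι] (hA : IsMixing A) (k : ℕ) :
    sigmaTwo (A ^ (k + 1)) ≤ sigmaTwo A := by
  refine singularValues_one_le _ (ones ι) (sigmaTwo_nonneg A) fun x hx => ?_
  rw [inner_ones] at hx
  have key : ‖Matrix.toEuclideanLin (A ^ k) x‖ ≤ ‖x‖ ∧
      ∑ i, Matrix.toEuclideanLin (A ^ k) x i = 0 := by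
    induction k with
    | zero => simpa using hx
    | succ k ih =>
      rw [toEuclideanLin_pow, pow_succ', ← toEuclideanLin_pow]
      exact ⟨(hA.norm_apply_le _).trans ih.1, (hA.sum_apply _).trans ih.2⟩
  rw [toEuclideanLin_pow, pow_succ', ← toEuclideanLin_pow]
  exact (hA.norm_apply_le_sigmaTwo _ key.2).trans
    (mul_le_mul_of_nonneg_left key.1 (sigmaTwo_nonneg A))

theorem IsMixing.iSup_sigmaTwo_pow [Nonempty ι] (hA : IsMixing A) :
    ⨆ k : ℕ, sigmaTwo (A ^ (k + 1)) = sigmaTwo A := by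
  refine le_antisymm (ciSup_le hA.sigmaTwo_pow_le) ?_
  have h : BddAbove (Set.range fun k : ℕ => sigmaTwo (A ^ (k + 1))) :=
    ⟨sigmaTwo A, by rintro _ ⟨k, rfl⟩; exact hA.sigmaTwo_pow_le k⟩
  simpa using le_ciSup h 0

end Stochastic

/-! ### Euclidean projection and strong convexity -/

section Convex

variable {d : ℕ}

theorem proj_spec {X : Set (Vec d)} (hc : IsClosed X) (hX : X.Nonempty) (y : Vec d) :
    proj X y ∈ X ∧ ∀ z ∈ X, ‖proj X y - y‖ ≤ ‖z - y‖ := by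
  have h : ∃ p, p ∈ X ∧ ∀ z ∈ X, ‖p - y‖ ≤ ‖z - y‖ := by
    obtain ⟨p, hp, hpd⟩ := hc.exists_infDist_eq_dist hX y
    refine ⟨p, hp, fun z hz => ?_⟩
    have := Metric.infDist_le_dist_of_mem (x := y) hz
    rw [hpd, dist_comm, dist_comm y z, dist_eq_norm, dist_eq_norm] at this
    exact this
  exact Classical.epsilon_spec h

theorem inner_sub_proj_le {X : Set (Vec d)} (hc : IsClosed X) (hconv : Convex ℝ X) (y : Vec d)
    {w : Vec d} (hw : w ∈ X) : inner ℝ (y - proj X y) (w - proj X y) ≤ 0 := by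
  obtain ⟨hp, hmin⟩ := proj_spec hc ⟨w, hw⟩ y
  refine (norm_eq_iInf_iff_real_inner_le_zero hconv hp).1 ?_ w hw
  have : Nonempty X := ⟨⟨w, hw⟩⟩
  refine le_antisymm (le_ciInf fun z => ?_) ?_
  · rw [norm_sub_rev, norm_sub_rev y]; exact hmin z z.2
  · exact ciInf_le ⟨0, by rintro _ ⟨z, rfl⟩; exact norm_nonneg _⟩ (⟨proj X y, hp⟩ : X)

/-- Adding the obtuse-angle inequalities at the two projections gives `‖p - q‖² ≤ ⟪y - z, p - q⟫`;
Cauchy–Schwarz does the rest. -/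
theorem norm_proj_sub_proj_le {X : Set (Vec d)} (hc : IsClosed X) (hconv : Convex ℝ X)
    (hX : X.Nonempty) (y z : Vec d) : ‖proj X y - proj X z‖ ≤ ‖y - z‖ := by
  have h1 := inner_sub_proj_le hc hconv y (proj_spec hc hX z).1
  have h2 := inner_sub_proj_le hc hconv z (proj_spec hc hX y).1
  set p := proj X y
  set q := proj X z
  have h3 : ‖p - q‖ ^ 2 ≤ inner ℝ (y - z) (p - q) := by
    rw [← real_inner_self_eq_norm_sq]
    simp only [inner_sub_left, inner_sub_right] at h1 h2 ⊢
    linarith [real_inner_comm p q]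
  have h4 := real_inner_le_norm (y - z) (p - q)
  by_contra! hlt
  have hpos : 0 < ‖p - q‖ := (norm_nonneg _).trans_lt hlt
  nlinarith [mul_lt_mul_of_pos_right hlt hpos]

theorem proj_of_mem {X : Set (Vec d)} (hc : IsClosed X) {y : Vec d} (hy : y ∈ X) :
    proj X y = y := by
  have h := (proj_spec hc ⟨y, hy⟩ y).2 y hy
  rw [sub_self, norm_zero] at h
  exact sub_eq_zero.1 (norm_eq_zero.1 (le_antisymm h (norm_nonneg _)))

theorem norm_proj_sub_le {X : Set (Vec d)} (hc : IsClosed X) (hconv : Convex ℝ X) {w : Vec d}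
    (hw : w ∈ X) (y : Vec d) : ‖proj X y - w‖ ≤ ‖y - w‖ := by
  have := norm_proj_sub_proj_le hc hconv ⟨w, hw⟩ y w
  rwa [proj_of_mem hc hw] at this

theorem continuous_proj {X : Set (Vec d)} (hc : IsClosed X) (hconv : Convex ℝ X)
    (hX : X.Nonempty) : Continuous (proj X) := by
  refine (LipschitzWith.of_dist_le_mul (K := 1) fun y z => ?_).continuous
  rw [dist_eq_norm, dist_eq_norm, NNReal.coe_one, one_mul]
  exact norm_proj_sub_proj_le hc hconv hX y z

/-- The strong convexity inequality on the segment from `x` to `y`, divided by the parameter `t`,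
bounds the difference quotient; the limit `t ↓ 0` gives the gradient and the full quadratic term. -/
theorem _root_.StrongConvexOn.add_inner_gradient_le {f : Vec d → ℝ} {μ : ℝ}
    (hf : StrongConvexOn Set.univ μ f) (hd : Differentiable ℝ f) (x y : Vec d) :
    f x + inner ℝ (gradient f x) (y - x) + μ / 2 * ‖y - x‖ ^ 2 ≤ f y := by
  have hder : HasDerivAt (fun t : ℝ => f (x + t • (y - x))) (inner ℝ (gradient f x) (y - x)) 0 := by
    have h1 : HasFDerivAt f (InnerProductSpace.toDual ℝ (Vec d) (gradient f x))
        (x + (0 : ℝ) • (y - x)) := by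
      simpa using (hd x).hasGradientAt.hasFDerivAt
    have h2 : HasDerivAt (fun t : ℝ => x + t • (y - x)) (y - x) 0 := by
      simpa using ((hasDerivAt_id (0 : ℝ)).smul_const (y - x)).const_add x
    have h3 := h1.comp_hasDerivAt (0 : ℝ) h2
    rw [InnerProductSpace.toDual_apply_apply] at h3
    exact h3
  have hslope := (hasDerivWithinAt_iff_tendsto_slope' (s := Set.Ioi (0 : ℝ)) (by simp)).1
    (hder.hasDerivWithinAt (s := Set.Ioi (0 : ℝ)))
  have hub : Tendsto (fun t : ℝ => f y - f x - (1 - t) * (μ / 2 * ‖y - x‖ ^ 2)) (𝓝[>] 0)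
      (𝓝 (f y - f x - (1 - 0) * (μ / 2 * ‖y - x‖ ^ 2))) :=
    ((Continuous.tendsto (by fun_prop) 0).mono_left nhdsWithin_le_nhds)
  have hev : ∀ᶠ t in 𝓝[>] (0 : ℝ), slope (fun t : ℝ => f (x + t • (y - x))) 0 t ≤
      f y - f x - (1 - t) * (μ / 2 * ‖y - x‖ ^ 2) := by
    filter_upwards [Ioo_mem_nhdsGT (zero_lt_one' ℝ)] with t ht
    have h1 := hf.2 (Set.mem_univ x) (Set.mem_univ y) (by linarith [ht.2] : 0 ≤ 1 - t) ht.1.le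
      (by ring)
    have h2 : (1 - t) • x + t • y = x + t • (y - x) := by module
    rw [h2, norm_sub_rev x y] at h1
    simp only [smul_eq_mul] at h1
    rw [slope_def_field, sub_zero, zero_smul, add_zero, div_le_iff₀ ht.1]
    linarith
  have := le_of_tendsto_of_tendsto hslope hub hev
  linarith

end Convex

/-! ### Deviation from consensus -/

section Deviation

variable {ι : Type*} [Fintype ι] {d : ℕ}

/-- The average of a family of vectors. -/
noncomputable def avg (y : ι → Vec d) : Vec d := (Fintype.card ι : ℝ)⁻¹ • ∑ i, y i

/-- The Euclidean distance of a family of vectors from the constant family of its average. -/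
noncomputable def dev (y : ι → Vec d) : ℝ := √(∑ i, ‖y i - avg y‖ ^ 2)

theorem dev_nonneg (y : ι → Vec d) : 0 ≤ dev y := Real.sqrt_nonneg _

theorem dev_sq (y : ι → Vec d) : dev y ^ 2 = ∑ i, ‖y i - avg y‖ ^ 2 :=
  Real.sq_sqrt (Finset.sum_nonneg fun _ _ => sq_nonneg _)

theorem avg_add (y z : ι → Vec d) : avg (fun i => y i + z i) = avg y + avg z := by
  simp [avg, Finset.sum_add_distrib]

theorem sqrt_sum_norm_sq_add_le (y z : ι → Vec d) :
    √(∑ i, ‖y i + z i‖ ^ 2) ≤ √(∑ i, ‖y i‖ ^ 2) + √(∑ i, ‖z i‖ ^ 2) := by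
  have := norm_add_le (WithLp.toLp 2 y : PiLp 2 fun _ : ι => Vec d) (WithLp.toLp 2 z)
  simpa [PiLp.norm_eq_of_L2] using this

/-- The parallel axis identity: the cross terms cancel because the deviations from the average sum
to zero. -/
theorem sum_norm_sq_sub_avg [Nonempty ι] (y : ι → Vec d) (v : Vec d) :
    ∑ i, ‖y i - v‖ ^ 2 = ∑ i, ‖y i - avg y‖ ^ 2 + Fintype.card ι * ‖avg y - v‖ ^ 2 := by
  have hn : (Fintype.card ι : ℝ) ≠ 0 := Nat.cast_ne_zero.2 Fintype.card_ne_zero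
  have h0 : ∑ i, (y i - avg y) = 0 := by
    rw [Finset.sum_sub_distrib, Finset.sum_const, Finset.card_univ, ← Nat.cast_smul_eq_nsmul ℝ,
      avg, smul_inv_smul₀ hn, sub_self]
  have h1 : ∀ i, ‖y i - v‖ ^ 2 = ‖y i - avg y‖ ^ 2 + 2 * inner ℝ (y i - avg y) (avg y - v) +
      ‖avg y - v‖ ^ 2 := by
    intro i
    rw [← norm_add_sq_real]; congr 2; abel
  simp_rw [h1]
  rw [Finset.sum_add_distrib, Finset.sum_add_distrib, ← Finset.mul_sum, ← sum_inner, h0,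
    inner_zero_left]
  simp

theorem dev_le [Nonempty ι] (y : ι → Vec d) : dev y ≤ √(∑ i, ‖y i‖ ^ 2) := by
  refine Real.sqrt_le_sqrt ?_
  have := sum_norm_sq_sub_avg y 0
  simp only [sub_zero] at this
  rw [this]
  exact le_add_of_nonneg_right (by positivity)

theorem dev_add_le [Nonempty ι] (y z : ι → Vec d) :
    dev (fun i => y i + z i) ≤ dev y + √(∑ i, ‖z i‖ ^ 2) := by
  refine le_trans ?_ (add_le_add_right (dev_le z) _)
  refine le_trans (le_of_eq ?_) (sqrt_sum_norm_sq_add_le _ _)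
  unfold dev
  rw [avg_add]
  congr 1
  refine Finset.sum_congr rfl fun i _ => ?_
  rw [add_sub_add_comm]

theorem dev_le_add [Nonempty ι] (y z : ι → Vec d) :
    dev y ≤ dev z + √(∑ i, ‖y i - z i‖ ^ 2) := by
  have := dev_add_le z fun i => y i - z i
  simpa using this

theorem sum_norm_sub_avg_le (y : ι → Vec d) :
    ∑ i, ‖y i - avg y‖ ≤ √(Fintype.card ι) * dev y := by
  rw [dev, ← Real.sqrt_mul (Nat.cast_nonneg _)]
  refine Real.le_sqrt_of_sq_le ?_
  have := sq_sum_le_card_mul_sum_sq (s := Finset.univ) (f := fun i => ‖y i - avg y‖)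
  simpa using this

theorem avg_mem {X : Set (Vec d)} [Nonempty ι] (hX : Convex ℝ X) {y : ι → Vec d}
    (hy : ∀ i, y i ∈ X) : avg y ∈ X := by
  have hn : (Fintype.card ι : ℝ) ≠ 0 := Nat.cast_ne_zero.2 Fintype.card_ne_zero
  rw [avg, Finset.smul_sum]
  refine hX.sum_mem (fun _ _ => by positivity) ?_ fun i _ => hy i
  simp [hn]

variable [DecidableEq ι] {A : Matrix ι ι ℝ}

theorem IsMixing.dev_apply_le [Nonempty ι] (hA : IsMixing A) (y : ι → Vec d) :
    dev (fun i => ∑ j, A i j • y j) ≤ sigmaTwo A * dev y := by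
  have havg : avg (fun i => ∑ j, A i j • y j) = avg y := by
    unfold avg
    congr 1
    rw [Finset.sum_comm]
    refine Finset.sum_congr rfl fun j _ => ?_
    rw [← Finset.sum_smul, Finset.sum_congr rfl fun i _ => hA.symm i j, hA.row_sum, one_smul]
  refine Real.sqrt_le_iff.2 ⟨mul_nonneg (sigmaTwo_nonneg A) (dev_nonneg y), ?_⟩
  rw [mul_pow, dev_sq, havg]
  simp_rw [EuclideanSpace.real_norm_sq_eq]
  rw [Finset.sum_comm, Finset.sum_comm (s := (Finset.univ : Finset ι)), Finset.mul_sum]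
  refine Finset.sum_le_sum fun k _ => ?_
  -- Each of the `d` coordinates of the centred family is a sum-zero vector indexed by the agents,
  -- so the scalar bound applies coordinate by coordinate.
  let x : EuclideanSpace ℝ ι := WithLp.toLp 2 fun i => (y i - avg y) k
  have hx : ∑ i, x i = 0 := by
    simp [x, avg]
  have h := pow_le_pow_left₀ (norm_nonneg _) (hA.norm_apply_le_sigmaTwo x hx) 2
  rw [mul_pow, EuclideanSpace.real_norm_sq_eq, EuclideanSpace.real_norm_sq_eq] at h
  refine le_trans (le_of_eq (Finset.sum_congr rfl fun i _ => ?_)) h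
  rw [toEuclideanLin_apply_apply]
  congr 1
  simp [x, mul_sub, Finset.sum_sub_distrib, ← Finset.sum_mul, hA.row_sum]

end Deviation

/-! ### One projected gradient step -/

section Step

variable {ι : Type*} [Fintype ι] [Nonempty ι] {d : ℕ}

/-- The progress of one projected gradient step from `c` towards the minimizer of the average
objective, up to the deviation of `c` from consensus. -/
theorem sum_norm_sq_step_le {X : Set (Vec d)} (hX : IsClosed X) (hconv : Convex ℝ X)
    {f : ι → Vec d → ℝ} {μ g : ℝ} (hμ : 0 ≤ μ) (hg0 : 0 ≤ g) (hf_diff : ∀ i, Differentiable ℝ (f i))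
    (hf_convex : ∀ i, StrongConvexOn Set.univ μ (f i))
    (hg : ∀ i, ∀ x ∈ X, ‖gradient (f i) x‖ ≤ g) {xs : Vec d} (hxs : xs ∈ X)
    (hmin : ∀ x ∈ X, ∑ i, f i xs ≤ ∑ i, f i x) {c : ι → Vec d} (hc : ∀ i, c i ∈ X)
    {s B : ℝ} (hs : 0 ≤ s) (hsμ : s * μ ≤ 1) (hB : ∑ i, ‖c i - xs‖ ^ 2 ≤ B) :
    ∑ i, ‖proj X (c i - s • gradient (f i) (c i)) - xs‖ ^ 2 ≤
      (1 - s * μ) * B + Fintype.card ι * (s * g) ^ 2 +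
        2 * (s * g) * (√(Fintype.card ι) * dev c) := by
  have hterm : ∀ i, ‖proj X (c i - s • gradient (f i) (c i)) - xs‖ ^ 2 ≤
      (1 - s * μ) * ‖c i - xs‖ ^ 2 + (s * g) ^ 2 - 2 * s * (f i (avg c) - f i xs) +
        2 * (s * g) * ‖c i - avg c‖ := by
    intro i
    have h1 : ‖proj X (c i - s • gradient (f i) (c i)) - xs‖ ^ 2 ≤
        ‖(c i - xs) - s • gradient (f i) (c i)‖ ^ 2 := by
      refine pow_le_pow_left₀ (norm_nonneg _) ?_ 2
      have := norm_proj_sub_le hX hconv hxs (c i - s • gradient (f i) (c i))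
      rwa [sub_right_comm] at this
    rw [norm_sub_sq_real (c i - xs), inner_smul_right, norm_smul, Real.norm_of_nonneg hs,
      real_inner_comm] at h1
    have h2 := (hf_convex i).add_inner_gradient_le (hf_diff i) (c i) xs
    rw [← neg_sub (c i) xs, inner_neg_right, norm_neg] at h2
    -- Function values are moved from `c i` to the common point `avg c`, at a cost of `g` times the
    -- deviation, so that after summation the minimality of `xs` for the sum of the objectives can
    -- be used.
    have h3 := (hf_convex i).add_inner_gradient_le (hf_diff i) (avg c) (c i)
    have h4 : -(g * ‖c i - avg c‖) ≤ inner ℝ (gradient (f i) (avg c)) (c i - avg c) := by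
      have h5 := abs_real_inner_le_norm (gradient (f i) (avg c)) (c i - avg c)
      have h6 := mul_le_mul_of_nonneg_right (hg i _ (avg_mem hconv hc)) (norm_nonneg (c i - avg c))
      linarith [neg_abs_le (inner ℝ (gradient (f i) (avg c)) (c i - avg c))]
    have h7 : (s * ‖gradient (f i) (c i)‖) ^ 2 ≤ (s * g) ^ 2 :=
      pow_le_pow_left₀ (by positivity) (mul_le_mul_of_nonneg_left (hg i _ (hc i)) hs) 2
    have h8 : f i (avg c) - f i xs - g * ‖c i - avg c‖ + μ / 2 * ‖c i - xs‖ ^ 2 ≤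
        inner ℝ (gradient (f i) (c i)) (c i - xs) := by
      have : 0 ≤ μ / 2 * ‖c i - avg c‖ ^ 2 := by positivity
      linarith
    have h9 := mul_le_mul_of_nonneg_left h8 hs
    linarith
  refine (Finset.sum_le_sum fun i _ => hterm i).trans ?_
  rw [Finset.sum_add_distrib, Finset.sum_sub_distrib, Finset.sum_add_distrib, ← Finset.mul_sum,
    ← Finset.mul_sum, ← Finset.mul_sum, Finset.sum_sub_distrib]
  have h1 := mul_le_mul_of_nonneg_left (hmin _ (avg_mem hconv hc)) hs
  have h2 := mul_le_mul_of_nonneg_left hB (sub_nonneg.2 hsμ)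
  have h3 := mul_le_mul_of_nonneg_left (sum_norm_sub_avg_le c) (mul_nonneg hs hg0)
  simp only [Finset.sum_const, Finset.card_univ, nsmul_eq_mul]
  linarith

/-- No agent moves by more than `s * g`, since projecting onto `X` cannot increase the distance to
`c i ∈ X`. -/
theorem dev_step_le {X : Set (Vec d)} (hX : IsClosed X) (hconv : Convex ℝ X)
    {f : ι → Vec d → ℝ} {g : ℝ} (hg0 : 0 ≤ g) (hg : ∀ i, ∀ x ∈ X, ‖gradient (f i) x‖ ≤ g)
    {c : ι → Vec d} (hc : ∀ i, c i ∈ X) {s : ℝ} (hs : 0 ≤ s) :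
    dev (fun i => proj X (c i - s • gradient (f i) (c i))) ≤
      dev c + √(Fintype.card ι) * (s * g) := by
  refine (dev_le_add _ c).trans (add_le_add_right ?_ _)
  rw [← Real.sqrt_sq (mul_nonneg hs hg0), ← Real.sqrt_mul (Nat.cast_nonneg _)]
  refine Real.sqrt_le_sqrt ?_
  have : ∀ i, ‖proj X (c i - s • gradient (f i) (c i)) - c i‖ ^ 2 ≤ (s * g) ^ 2 := by
    intro i
    refine pow_le_pow_left₀ (norm_nonneg _) ?_ 2
    refine (norm_proj_sub_le hX hconv (hc i) _).trans ?_
    rw [sub_sub_cancel_left, norm_neg, norm_smul, Real.norm_of_nonneg hs]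
    exact mul_le_mul_of_nonneg_left (hg i _ (hc i)) hs
  refine (Finset.sum_le_sum fun i _ => this i).trans ?_
  simp

end Step

/-! ### Convex combinations with a self-weight -/

section ConvexCombination

variable {V : Type*} {d : ℕ}

theorem selfCombination_mem {X : Set (Vec d)} (hX : Convex ℝ X) {s : Finset V} {w : V → ℝ}
    (hw : ∀ j ∈ s, 0 ≤ w j) (hw1 : ∑ j ∈ s, w j ≤ 1) {x : Vec d} {y : V → Vec d} (hx : x ∈ X)
    (hy : ∀ j ∈ s, y j ∈ X) : (1 - ∑ j ∈ s, w j) • x + ∑ j ∈ s, w j • y j ∈ X := by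
  -- The extra index `none` stands for the agent itself and carries the remaining weight.
  have := hX.sum_mem (t := Finset.insertNone s)
    (w := fun o => o.elim (1 - ∑ j ∈ s, w j) w) (z := fun o => o.elim x y)
    (by
      intro o ho
      cases o with
      | none => simpa using hw1
      | some j => exact hw j (by simpa using ho))
    (by simp [Finset.sum_insertNone])
    (by
      intro o ho
      cases o with
      | none => exact hx
      | some j => exact hy j (by simpa using ho))
  simpa [Finset.sum_insertNone] using this

/-- Jensen's inequality for the squared distance. Written with differences, it is linear in the
neighbor weights, so replacing them by nominal ones has an explicit cost. -/
theorem norm_sq_selfCombination_sub_le {s : Finset V} {w : V → ℝ}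
    (hw : ∀ j ∈ s, 0 ≤ w j) (hw1 : ∑ j ∈ s, w j ≤ 1) (x v : Vec d) (y : V → Vec d) :
    ‖(1 - ∑ j ∈ s, w j) • x + ∑ j ∈ s, w j • y j - v‖ ^ 2 ≤
      ‖x - v‖ ^ 2 + ∑ j ∈ s, w j * (‖y j - v‖ ^ 2 - ‖x - v‖ ^ 2) := by
  have hφ : ConvexOn ℝ Set.univ fun z : Vec d => ‖z - v‖ ^ 2 := by
    have h1 : ConvexOn ℝ Set.univ fun z : Vec d => ‖z - v‖ := by
      simpa [dist_eq_norm] using convexOn_univ_dist v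
    exact h1.pow (fun z _ => norm_nonneg _) 2
  have := hφ.map_sum_le (t := Finset.insertNone s)
    (w := fun o => o.elim (1 - ∑ j ∈ s, w j) w) (p := fun o => o.elim x y)
    (by
      intro o ho
      cases o with
      | none => simpa using hw1
      | some j => exact hw j (by simpa using ho))
    (by simp [Finset.sum_insertNone]) (by simp)
  simp only [Finset.sum_insertNone, Option.elim, smul_eq_mul] at this
  refine this.trans (le_of_eq ?_)
  simp_rw [mul_sub]
  rw [Finset.sum_sub_distrib, ← Finset.sum_mul]
  ring

end ConvexCombination

/-! ### The nominal weight matrix -/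

section Nominal

variable {V : Type*} [Fintype V] [DecidableEq V] (G : SimpleGraph V) [DecidableRel G.Adj]
  (Leg : Finset V)

theorem sum_ite_leg (i : V) (F : V → ℝ) :
    ∑ j ∈ G.neighborFinset i, (if j ∈ Leg then F j else 0) =
      ∑ j ∈ G.neighborFinset i ∩ Leg, F j := by
  rw [← Finset.sum_filter, Finset.filter_mem_eq_inter]

theorem sum_neighbor_inter_comm (F : V → V → ℝ) :
    ∑ i ∈ Leg, ∑ j ∈ G.neighborFinset i ∩ Leg, F i j =
      ∑ i ∈ Leg, ∑ j ∈ G.neighborFinset i ∩ Leg, F j i := by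
  refine Finset.sum_comm' fun i j => ?_
  simp only [Finset.mem_inter, SimpleGraph.mem_neighborFinset]
  rw [G.adj_comm]
  tauto

theorem one_le_legDegree (i : V) : 1 ≤ legDegree G Leg i := by
  unfold legDegree; linarith [Nat.cast_nonneg (α := ℝ) (G.neighborFinset i ∩ Leg).card]

theorem nominalWeight_nonneg (i j : V) : 0 ≤ nominalWeight G Leg i j := by
  unfold nominalWeight
  split_ifs
  · have := (one_le_legDegree G Leg i).trans (le_max_left _ (legDegree G Leg j))
    positivity
  · rfl

theorem nominalWeight_comm (i j : V) : nominalWeight G Leg i j = nominalWeight G Leg j i := by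
  simp only [nominalWeight, G.adj_comm i j, max_comm (legDegree G Leg i)]

theorem nominalWeight_le (i j : V) : nominalWeight G Leg i j ≤ 1 / (2 * legDegree G Leg i) := by
  have := one_le_legDegree G Leg i
  unfold nominalWeight
  split_ifs
  · gcongr
    exact le_max_left _ _
  · positivity

/-- The factor 2 in the weights leaves at least half of each row on the diagonal, which makes the
diagonal positive. -/
theorem sum_nominalWeight_le (i : V) :
    ∑ j ∈ G.neighborFinset i ∩ Leg, nominalWeight G Leg i j ≤ 1 / 2 := by
  have h := one_le_legDegree G Leg i
  refine (Finset.sum_le_sum fun j _ => nominalWeight_le G Leg i j).trans ?_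
  rw [Finset.sum_const, nsmul_eq_mul, mul_one_div, div_le_div_iff₀ (by positivity) (by norm_num)]
  unfold legDegree
  linarith

variable {G Leg}

theorem nominalMatrix_self (i : Leg) : nominalMatrix G Leg i i =
    1 - ∑ m ∈ G.neighborFinset i ∩ Leg, nominalWeight G Leg i m := by
  simp [nominalMatrix]

theorem nominalMatrix_of_ne {i j : Leg} (h : i ≠ j) :
    nominalMatrix G Leg i j = nominalWeight G Leg i j := by
  simp [nominalMatrix, h]

theorem sum_nominalWeight_smul {M : Type*} [AddCommGroup M] [Module ℝ M] (i : V) (F : V → M) :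
    ∑ j ∈ G.neighborFinset i ∩ Leg, nominalWeight G Leg i j • F j =
      ∑ j : Leg, nominalWeight G Leg i j • F j := by
  rw [Finset.sum_coe_sort Leg fun j => nominalWeight G Leg i j • F j]
  refine Finset.sum_subset Finset.inter_subset_right fun j hj hij => ?_
  have : ¬ G.Adj i j := fun h => hij (by simp [h, hj])
  simp [nominalWeight, this]

/-- This puts the nominal averaging into the form "own value plus weighted differences", in which it
is compared with the actual mixing; with `F = 1` it yields the row sums. -/
theorem sum_nominalMatrix_smul {M : Type*} [AddCommGroup M] [Module ℝ M] (i : Leg) (F : V → M) :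
    ∑ j : Leg, nominalMatrix G Leg i j • F j =
      F i + ∑ j ∈ G.neighborFinset i ∩ Leg, nominalWeight G Leg i j • (F j - F i) := by
  have h : ∀ j : Leg, nominalMatrix G Leg i j • F j = nominalWeight G Leg i j • F j +
      if i = j then (1 - ∑ m ∈ G.neighborFinset i ∩ Leg, nominalWeight G Leg i m) • F i else 0 := by
    intro j
    by_cases hij : i = j
    · subst hij
      rw [nominalMatrix_self, if_pos rfl]
      simp [nominalWeight]
    · rw [nominalMatrix_of_ne hij, if_neg hij, add_zero]
  simp_rw [h, smul_sub]
  rw [Finset.sum_add_distrib, Finset.sum_sub_distrib, ← Finset.sum_smul,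
    ← sum_nominalWeight_smul, Finset.sum_ite_eq, if_pos (Finset.mem_univ i)]
  module

theorem isMixing_nominalMatrix (hconn : (G.induce (Leg : Set V)).Connected) :
    IsMixing (nominalMatrix G Leg) where
  symm i j := by
    by_cases h : i = j
    · rw [h]
    · rw [nominalMatrix_of_ne h, nominalMatrix_of_ne (Ne.symm h), nominalWeight_comm]
  nonneg i j := by
    by_cases h : i = j
    · rw [h, nominalMatrix_self]; linarith [sum_nominalWeight_le G Leg (j : V)]
    · rw [nominalMatrix_of_ne h]; exact nominalWeight_nonneg G Leg _ _
  row_sum i := by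
    simpa using sum_nominalMatrix_smul (G := G) i fun _ => (1 : ℝ)
  diag_pos i := by
    rw [nominalMatrix_self]; linarith [sum_nominalWeight_le G Leg (i : V)]
  connected y hy i j := by
    have hadj : ∀ a b : (Leg : Set V), (G.induce (Leg : Set V)).Adj a b → y a = y b := by
      intro a b hab
      have hab' : G.Adj (a : V) b := hab
      apply hy
      have hne : (a : Leg) ≠ b := fun h => hab'.ne (congrArg Subtype.val h)
      rw [nominalMatrix_of_ne hne, nominalWeight, if_pos hab']
      have := (one_le_legDegree G Leg a).trans (le_max_left _ (legDegree G Leg b))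
      positivity
    obtain ⟨p⟩ := hconn.preconnected i j
    induction p with
    | nil => rfl
    | cons h _ ih => exact (hadj _ _ h).trans ih

end Nominal

/-! ### Effect of misclassified neighbors on the mixing step -/

section Misclassification

section

variable {V : Type*} [DecidableEq V] {Ω : Type*} (Leg : Finset V) (α : V → V → ℕ → Ω → ℝ)

/-- The indicator that agent `i` misclassifies agent `j` at time `t`. -/
noncomputable def misclass (i j : V) (t : ℕ) (ω : Ω) : ℝ :=
  if (j ∈ Leg ↔ 0 ≤ trustSum α i j t ω) then 0 else 1

theorem misclass_nonneg (i j : V) (t : ℕ) (ω : Ω) : 0 ≤ misclass Leg α i j t ω := by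
  unfold misclass; split_ifs <;> norm_num

theorem misclass_le_one (i j : V) (t : ℕ) (ω : Ω) : misclass Leg α i j t ω ≤ 1 := by
  unfold misclass; split_ifs <;> norm_num

end

section

variable {V : Type*} [Fintype V] {Ω : Type*} (G : SimpleGraph V) [DecidableRel G.Adj]
  (α : V → V → ℕ → Ω → ℝ)

theorem one_le_trustDegree (i : V) (t : ℕ) (ω : Ω) : 1 ≤ trustDegree G α i t ω := by
  unfold trustDegree; linarith [Nat.cast_nonneg (α := ℝ) (trustedNbrs G α i t ω).card]

end

variable {V : Type*} [Fintype V] [DecidableEq V] {Ω : Type*} {d : ℕ}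
  (G : SimpleGraph V) [DecidableRel G.Adj] (Leg : Finset V) (α b : V → V → ℕ → Ω → ℝ)

/-- The number of misclassified neighbors of legitimate agents. -/
noncomputable def numMisclass (t : ℕ) (ω : Ω) : ℝ :=
  ∑ i ∈ Leg, ∑ j ∈ G.neighborFinset i, misclass Leg α i j t ω

theorem numMisclass_nonneg (t : ℕ) (ω : Ω) : 0 ≤ numMisclass G Leg α t ω :=
  Finset.sum_nonneg fun _ _ => Finset.sum_nonneg fun _ _ => misclass_nonneg Leg α _ _ _ _

theorem abs_trustDegree_sub_legDegree_le (i : V) (t : ℕ) (ω : Ω) :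
    |trustDegree G α i t ω - legDegree G Leg i| ≤
      ∑ j ∈ G.neighborFinset i, misclass Leg α i j t ω := by
  have h1 : trustDegree G α i t ω - legDegree G Leg i =
      ∑ j ∈ G.neighborFinset i,
        ((if 0 ≤ trustSum α i j t ω then (1 : ℝ) else 0) - if j ∈ Leg then 1 else 0) := by
    rw [Finset.sum_sub_distrib, Finset.sum_boole, Finset.sum_boole, Finset.filter_mem_eq_inter]
    simp [trustDegree, legDegree, trustedNbrs]
  rw [h1]
  refine (Finset.abs_sum_le_sum_abs _ _).trans (Finset.sum_le_sum fun j _ => ?_)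
  unfold misclass
  by_cases ha : j ∈ Leg <;> by_cases hb : 0 ≤ trustSum α i j t ω <;> simp [ha, hb]

theorem weight_nonneg (T₀ : ℕ) (i j : V) (t : ℕ) (ω : Ω) : 0 ≤ weight G Leg α b T₀ i j t ω := by
  unfold weight
  split_ifs
  · have := (one_le_trustDegree G α i t ω).trans
      (le_max_left _ (receivedDegree G Leg α b i j t ω))
    positivity
  · rfl

theorem weight_le (T₀ : ℕ) (i j : V) (t : ℕ) (ω : Ω) : weight G Leg α b T₀ i j t ω ≤
    if j ∈ trustedNbrs G α i t ω then 1 / (2 * trustDegree G α i t ω) else 0 := by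
  have := one_le_trustDegree G α i t ω
  unfold weight
  by_cases h : j ∈ trustedNbrs G α i t ω
  · rw [if_pos h]
    split_ifs
    · gcongr
      exact le_max_left _ _
    · positivity
  · simp [h]

theorem sum_weight_le (T₀ : ℕ) (i : V) (t : ℕ) (ω : Ω) :
    ∑ j ∈ G.neighborFinset i, weight G Leg α b T₀ i j t ω ≤ 1 / 2 := by
  have h := one_le_trustDegree G α i t ω
  refine (Finset.sum_le_sum fun j _ => weight_le G Leg α b T₀ i j t ω).trans ?_
  rw [← Finset.sum_filter, Finset.sum_const, nsmul_eq_mul, mul_one_div,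
    div_le_div_iff₀ (by positivity) (by norm_num)]
  have : Finset.filter (fun j => j ∈ trustedNbrs G α i t ω) (G.neighborFinset i) =
      trustedNbrs G α i t ω := by
    ext j; simp [trustedNbrs]
  rw [this]
  unfold trustDegree
  linarith

/-- The reciprocal of a maximum is a minimum of reciprocals, and `min` moves by at most the larger
change of its arguments. -/
theorem abs_one_div_max_sub_le {a b a' b' : ℝ} (ha : 0 < a) (hb : 0 < b) (ha' : 0 < a')
    (hb' : 0 < b') : |1 / (2 * max a b) - 1 / (2 * max a' b')| ≤
      |a - a'| / (2 * a * a') + |b - b'| / (2 * b * b') := by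
  have key : ∀ {p q : ℝ}, 0 < p → 0 < q → |1 / (2 * p) - 1 / (2 * q)| = |p - q| / (2 * p * q) := by
    intro p q hp hq
    have : 1 / (2 * p) - 1 / (2 * q) = (q - p) / (2 * p * q) := by field_simp
    rw [this, abs_div, abs_sub_comm, abs_of_pos (by positivity : 0 < 2 * p * q)]
  have hmin : ∀ {p q : ℝ}, 0 < p → 0 < q → 1 / (2 * max p q) = min (1 / (2 * p)) (1 / (2 * q)) := by
    intro p q hp hq
    rcases le_total p q with h | h
    · rw [max_eq_right h, min_eq_right (by gcongr)]
    · rw [max_eq_left h, min_eq_left (by gcongr)]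
  rw [hmin ha hb, hmin ha' hb', ← key ha ha', ← key hb hb']
  refine (abs_min_sub_min_le_max _ _ _ _).trans (max_le ?_ ?_)
  · exact le_add_of_nonneg_right (abs_nonneg _)
  · exact le_add_of_nonneg_left (abs_nonneg _)

/-- The weights differ from the nominal weights by at most twice the number of
misclassifications. -/
theorem sum_abs_weight_sub_le {T₀ t : ℕ} (ht : T₀ ≤ t) (ω : Ω) :
    ∑ i ∈ Leg, ∑ j ∈ G.neighborFinset i,
      |weight G Leg α b T₀ i j t ω - if j ∈ Leg then nominalWeight G Leg i j else 0| ≤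
      2 * numMisclass G Leg α t ω := by
  set M : V → ℝ := fun i => ∑ j ∈ G.neighborFinset i, misclass Leg α i j t ω with hM
  have hM0 : ∀ i, 0 ≤ M i := fun i => Finset.sum_nonneg fun _ _ => misclass_nonneg Leg α _ _ _ _
  -- `p i` bounds the change of `1 / (2 d_i)` caused by the misclassifications `M i` at agent `i`.
  -- It affects the weights on all edges at `i`, but carries a reciprocal degree.
  set p : V → ℝ := fun i => M i / (2 * trustDegree G α i t ω * legDegree G Leg i) with hp
  have hp0 : ∀ i, 0 ≤ p i := fun i => by
    have h1 := one_le_trustDegree G α i t ω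
    have h2 := one_le_legDegree G Leg i
    have := hM0 i
    positivity
  have hdeg : ∀ i, |trustDegree G α i t ω - legDegree G Leg i| /
      (2 * trustDegree G α i t ω * legDegree G Leg i) ≤ p i := fun i => by
    have h1 := one_le_trustDegree G α i t ω
    have h2 := one_le_legDegree G Leg i
    refine div_le_div_of_nonneg_right (abs_trustDegree_sub_legDegree_le G Leg α i t ω) ?_
    positivity
  have hterm : ∀ i, ∀ j ∈ G.neighborFinset i,
      |weight G Leg α b T₀ i j t ω - if j ∈ Leg then nominalWeight G Leg i j else 0| ≤
        misclass Leg α i j t ω + if j ∈ Leg then p i + p j else 0 := by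
    intro i j hj
    have hij : G.Adj i j := by simpa using hj
    have hw0 := weight_nonneg G Leg α b T₀ i j t ω
    have hn0 := nominalWeight_nonneg G Leg i j
    have hd1 := one_le_trustDegree G α i t ω
    have hd2 := one_le_legDegree G Leg i
    have hw : weight G Leg α b T₀ i j t ω ≤ 1 := by
      refine (weight_le G Leg α b T₀ i j t ω).trans ?_
      split_ifs
      · rw [div_le_one (by positivity)]; linarith
      · norm_num
    have hn : nominalWeight G Leg i j ≤ 1 := by
      refine (nominalWeight_le G Leg i j).trans ?_
      rw [div_le_one (by positivity)]; linarith
    by_cases hL : j ∈ Leg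
    · rw [if_pos hL, if_pos hL]
      by_cases hT : 0 ≤ trustSum α i j t ω
      · have hT' : j ∈ trustedNbrs G α i t ω := by simp [trustedNbrs, hij, hT]
        rw [weight, if_pos ⟨ht, hT'⟩, nominalWeight, if_pos hij, receivedDegree, if_pos hL]
        have h1 := one_le_trustDegree G α j t ω
        have h2 := one_le_legDegree G Leg j
        refine (abs_one_div_max_sub_le (by positivity) (by positivity) (by positivity)
          (by positivity)).trans ?_
        have := misclass_nonneg Leg α i j t ω
        linarith [hdeg i, hdeg j]
      -- For a misclassified neighbor it is enough that both weights lie in `[0, 1]`.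
      · have : misclass Leg α i j t ω = 1 := by simp [misclass, hL, hT]
        rw [this]
        have := hp0 i
        have := hp0 j
        rw [abs_le]
        constructor <;> linarith
    · rw [if_neg hL, if_neg hL, sub_zero, add_zero, abs_of_nonneg hw0]
      by_cases hT : 0 ≤ trustSum α i j t ω
      · have : misclass Leg α i j t ω = 1 := by simp [misclass, hL, hT]
        rw [this]; exact hw
      · have hT' : j ∉ trustedNbrs G α i t ω := by simp [trustedNbrs, hT]
        rw [weight, if_neg fun h => hT' h.2]
        exact misclass_nonneg Leg α i j t ω
  -- There are fewer than `legDegree` legitimate neighbors, which absorbs that factor in the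
  -- denominator of `p i`. The sums of `p i` and, by symmetry, of `p j` thus cost half of `m` each.
  have hsum : ∑ i ∈ Leg, ∑ j ∈ G.neighborFinset i ∩ Leg, p i ≤
      ∑ i ∈ Leg, M i / 2 := by
    refine Finset.sum_le_sum fun i _ => ?_
    have h1 := one_le_trustDegree G α i t ω
    have h2 := one_le_legDegree G Leg i
    have hcard : ((G.neighborFinset i ∩ Leg).card : ℝ) ≤
        trustDegree G α i t ω * legDegree G Leg i := by
      have : ((G.neighborFinset i ∩ Leg).card : ℝ) ≤ legDegree G Leg i := by
        unfold legDegree; linarith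
      exact this.trans (le_mul_of_one_le_left (by linarith) h1)
    rw [Finset.sum_const, nsmul_eq_mul, hp]
    simp only
    rw [mul_div_assoc', div_le_div_iff₀ (by positivity) (by norm_num)]
    have := mul_le_mul_of_nonneg_left hcard (hM0 i)
    linarith
  calc _ ≤ ∑ i ∈ Leg, ∑ j ∈ G.neighborFinset i,
        (misclass Leg α i j t ω + if j ∈ Leg then p i + p j else 0) :=
        Finset.sum_le_sum fun i _ => Finset.sum_le_sum fun j hj => hterm i j hj
    _ = numMisclass G Leg α t ω + (∑ i ∈ Leg, ∑ j ∈ G.neighborFinset i ∩ Leg, p i +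
        ∑ i ∈ Leg, ∑ j ∈ G.neighborFinset i ∩ Leg, p j) := by
        simp_rw [Finset.sum_add_distrib]
        simp_rw [sum_ite_leg, Finset.sum_add_distrib]
        rfl
    _ ≤ numMisclass G Leg α t ω + (∑ i ∈ Leg, M i / 2 + ∑ i ∈ Leg, M i / 2) := by
        rw [sum_neighbor_inter_comm G Leg fun _ j => p j]
        gcongr
    _ = 2 * numMisclass G Leg α t ω := by
        rw [← Finset.sum_add_distrib]
        simp_rw [add_halves]
        rw [hM, numMisclass]
        ring

variable {G Leg α b}

/-- The mixed point `c_i(t)` of the algorithm. -/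
noncomputable def mixed (G : SimpleGraph V) [DecidableRel G.Adj] (Leg : Finset V)
    (α b : V → V → ℕ → Ω → ℝ) (u : V → V → ℕ → Ω → Vec d) (T₀ : ℕ) (x : V → Vec d) (t : ℕ) (ω : Ω)
    (i : V) : Vec d :=
  selfWeight G Leg α b T₀ i t ω • x i + ∑ j ∈ G.neighborFinset i,
    weight G Leg α b T₀ i j t ω • (if j ∈ Leg then x j else u i j t ω)

variable {u : V → V → ℕ → Ω → Vec d} {T₀ : ℕ} {x : V → Vec d} {t : ℕ} {ω : Ω} {X : Set (Vec d)}

theorem mixed_mem (hX : Convex ℝ X) (hx : ∀ i ∈ Leg, x i ∈ X)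
    (hu : ∀ i ∈ Leg, ∀ j ∉ Leg, G.Adj i j → ∀ t ω, u i j t ω ∈ X) {i : V} (hi : i ∈ Leg) :
    mixed G Leg α b u T₀ x t ω i ∈ X := by
  refine selfCombination_mem hX (fun j _ => weight_nonneg G Leg α b T₀ i j t ω)
    ((sum_weight_le G Leg α b T₀ i t ω).trans (by norm_num)) (hx i hi) fun j hj => ?_
  split_ifs with h
  · exact hx j h
  · exact hu i hi j h (by simpa using hj) t ω

/-- Squared distances in `X` lie in `[0, 4η²]`, so passing from actual to nominal weights costs
`4η²` times the total weight error `2m`. Nominal weights are symmetric, hence cause no increase. -/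
theorem sum_norm_sq_mixed_sub_le {η : ℝ} (hXη : ∀ x ∈ X, ‖x‖ ≤ η)
    (hx : ∀ i ∈ Leg, x i ∈ X) (hu : ∀ i ∈ Leg, ∀ j ∉ Leg, G.Adj i j → ∀ t ω, u i j t ω ∈ X)
    {v : Vec d} (hv : v ∈ X) (ht : T₀ ≤ t) :
    ∑ i ∈ Leg, ‖mixed G Leg α b u T₀ x t ω i - v‖ ^ 2 ≤
      ∑ i ∈ Leg, ‖x i - v‖ ^ 2 + 8 * η ^ 2 * numMisclass G Leg α t ω := by
  set y : V → V → Vec d := fun i j => if j ∈ Leg then x j else u i j t ω with hy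
  have hyX : ∀ i ∈ Leg, ∀ j ∈ G.neighborFinset i, y i j ∈ X := by
    intro i hi j hj
    simp only [hy]
    split_ifs with h
    · exact hx j h
    · exact hu i hi j h (by simpa using hj) t ω
  have hφ : ∀ z ∈ X, 0 ≤ ‖z - v‖ ^ 2 ∧ ‖z - v‖ ^ 2 ≤ 4 * η ^ 2 := by
    intro z hz
    refine ⟨sq_nonneg _, ?_⟩
    have := (norm_sub_le z v).trans (add_le_add (hXη z hz) (hXη v hv))
    have h2 := pow_le_pow_left₀ (norm_nonneg _) this 2
    linarith
  set nom : V → V → ℝ := fun i j => if j ∈ Leg then nominalWeight G Leg i j else 0 with hnom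
  have h1 : ∀ i ∈ Leg, ‖mixed G Leg α b u T₀ x t ω i - v‖ ^ 2 ≤ ‖x i - v‖ ^ 2 +
      ((∑ j ∈ G.neighborFinset i, if j ∈ Leg then
        nominalWeight G Leg i j * (‖x j - v‖ ^ 2 - ‖x i - v‖ ^ 2) else 0) +
        4 * η ^ 2 * ∑ j ∈ G.neighborFinset i, |weight G Leg α b T₀ i j t ω - nom i j|) := by
    intro i hi
    refine (norm_sq_selfCombination_sub_le (fun j _ => weight_nonneg G Leg α b T₀ i j t ω)
      ((sum_weight_le G Leg α b T₀ i t ω).trans (by norm_num)) (x i) v (y i)).trans ?_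
    rw [Finset.mul_sum, ← Finset.sum_add_distrib]
    refine add_le_add_right (Finset.sum_le_sum fun j hj => ?_) _
    have hd : |‖y i j - v‖ ^ 2 - ‖x i - v‖ ^ 2| ≤ 4 * η ^ 2 := by
      have ha := hφ _ (hyX i hi j hj)
      have hb := hφ _ (hx i hi)
      rw [abs_le]
      constructor <;> linarith
    have h2 : (weight G Leg α b T₀ i j t ω - nom i j) * (‖y i j - v‖ ^ 2 - ‖x i - v‖ ^ 2) ≤
        4 * η ^ 2 * |weight G Leg α b T₀ i j t ω - nom i j| := by
      refine (le_abs_self _).trans ?_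
      rw [abs_mul, mul_comm]
      exact mul_le_mul_of_nonneg_right hd (abs_nonneg _)
    have h3 : nom i j * (‖y i j - v‖ ^ 2 - ‖x i - v‖ ^ 2) = if j ∈ Leg then
        nominalWeight G Leg i j * (‖x j - v‖ ^ 2 - ‖x i - v‖ ^ 2) else 0 := by
      simp only [hnom, hy]
      split_ifs <;> simp
    rw [← h3]
    linarith
  -- The summand changes sign when `i` and `j` are exchanged.
  have h0 : ∑ i ∈ Leg, ∑ j ∈ G.neighborFinset i ∩ Leg,
      nominalWeight G Leg i j * (‖x j - v‖ ^ 2 - ‖x i - v‖ ^ 2) = 0 := by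
    have := sum_neighbor_inter_comm G Leg fun i j =>
      nominalWeight G Leg i j * (‖x j - v‖ ^ 2 - ‖x i - v‖ ^ 2)
    have h2 : ∑ i ∈ Leg, ∑ j ∈ G.neighborFinset i ∩ Leg,
        nominalWeight G Leg j i * (‖x i - v‖ ^ 2 - ‖x j - v‖ ^ 2) =
        -∑ i ∈ Leg, ∑ j ∈ G.neighborFinset i ∩ Leg,
        nominalWeight G Leg i j * (‖x j - v‖ ^ 2 - ‖x i - v‖ ^ 2) := by
      simp_rw [← Finset.sum_neg_distrib]
      refine Finset.sum_congr rfl fun i _ => Finset.sum_congr rfl fun j _ => ?_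
      rw [nominalWeight_comm]; ring
    linarith
  refine (Finset.sum_le_sum h1).trans ?_
  rw [Finset.sum_add_distrib, Finset.sum_add_distrib, ← Finset.mul_sum]
  simp_rw [sum_ite_leg]
  rw [h0, zero_add]
  have h4 := mul_le_mul_of_nonneg_left (sum_abs_weight_sub_le G Leg α b ht ω)
    (by positivity : 0 ≤ 4 * η ^ 2)
  have h5 : (4 * η ^ 2) * (2 * numMisclass G Leg α t ω) = 8 * η ^ 2 * numMisclass G Leg α t ω := by
    ring
  rw [h5] at h4
  exact add_le_add_right h4 _

theorem sum_norm_sq_mixed_sub_nominal_le {η : ℝ} (hη : 0 ≤ η) (hconv : Convex ℝ X)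
    (hXη : ∀ x ∈ X, ‖x‖ ≤ η)
    (hx : ∀ i ∈ Leg, x i ∈ X) (hu : ∀ i ∈ Leg, ∀ j ∉ Leg, G.Adj i j → ∀ t ω, u i j t ω ∈ X)
    (ht : T₀ ≤ t) :
    ∑ i : Leg, ‖mixed G Leg α b u T₀ x t ω i - ∑ j : Leg, nominalMatrix G Leg i j • x j‖ ^ 2 ≤
      9 * η ^ 2 * numMisclass G Leg α t ω := by
  set y : V → V → Vec d := fun i j => if j ∈ Leg then x j else u i j t ω with hy
  have hyX : ∀ i ∈ Leg, ∀ j ∈ G.neighborFinset i, y i j ∈ X := by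
    intro i hi j hj
    simp only [hy]
    split_ifs with h
    · exact hx j h
    · exact hu i hi j h (by simpa using hj) t ω
  have hdist : ∀ z ∈ X, ∀ z' ∈ X, ‖z - z'‖ ≤ 2 * η := fun z hz z' hz' => by
    linarith [(norm_sub_le z z').trans (add_le_add (hXη z hz) (hXη z' hz'))]
  set nom : V → V → ℝ := fun i j => if j ∈ Leg then nominalWeight G Leg i j else 0 with hnom
  have hnomX : ∀ i : Leg, x i + ∑ j ∈ G.neighborFinset i ∩ Leg,
      nominalWeight G Leg i j • (x j - x i) ∈ X := by
    intro i
    have := selfCombination_mem hconv (s := G.neighborFinset i ∩ Leg)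
      (w := nominalWeight G Leg i) (fun j _ => nominalWeight_nonneg G Leg i j)
      ((sum_nominalWeight_le G Leg i).trans (by norm_num)) (hx i i.2) (y := x)
      fun j hj => hx j (Finset.mem_inter.1 hj).2
    convert! this using 1
    simp_rw [smul_sub]
    rw [Finset.sum_sub_distrib, ← Finset.sum_smul]
    module
  have h1 : ∀ i : Leg, ‖mixed G Leg α b u T₀ x t ω i -
      ∑ j : Leg, nominalMatrix G Leg i j • x j‖ ^ 2 ≤
      4 * η ^ 2 * ∑ j ∈ G.neighborFinset i, |weight G Leg α b T₀ i j t ω - nom i j| := by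
    intro i
    rw [sum_nominalMatrix_smul]
    set e := mixed G Leg α b u T₀ x t ω i - (x i + ∑ j ∈ G.neighborFinset i ∩ Leg,
      nominalWeight G Leg i j • (x j - x i)) with he
    have he1 : ‖e‖ ≤ 2 * η := hdist _ (mixed_mem hconv hx hu i.2) _ (hnomX i)
    have he2 : e = ∑ j ∈ G.neighborFinset i,
        (weight G Leg α b T₀ i j t ω - nom i j) • (y i j - x i) := by
      have ha : ∑ j ∈ G.neighborFinset i, nom i j • (y i j - x i) =
          ∑ j ∈ G.neighborFinset i ∩ Leg, nominalWeight G Leg i j • (x j - x i) := by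
        rw [← Finset.filter_mem_eq_inter, Finset.sum_filter]
        refine Finset.sum_congr rfl fun j _ => ?_
        simp only [hnom, hy]
        split_ifs <;> simp
      simp_rw [sub_smul (weight G Leg α b T₀ i _ t ω)]
      rw [Finset.sum_sub_distrib, ha, he, mixed, selfWeight]
      simp_rw [smul_sub (weight G Leg α b T₀ i _ t ω)]
      rw [Finset.sum_sub_distrib, ← Finset.sum_smul]
      module
    have he3 : ‖e‖ ≤ 2 * η * ∑ j ∈ G.neighborFinset i, |weight G Leg α b T₀ i j t ω - nom i j| := by
      rw [he2, Finset.mul_sum]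
      refine (norm_sum_le _ _).trans (Finset.sum_le_sum fun j hj => ?_)
      rw [norm_smul, Real.norm_eq_abs, mul_comm]
      exact mul_le_mul_of_nonneg_right (hdist _ (hyX i i.2 j hj) _ (hx i i.2)) (abs_nonneg _)
    -- One factor `‖e‖` is bounded by the diameter and the other by the weight error, so the total
    -- is linear in `m` and not quadratic. It comes to `8η²m`; the 9 in the statement is a perfect
    -- square and gives `3η√m` later.
    have := mul_le_mul he1 he3 (norm_nonneg _) (by positivity)
    calc ‖e‖ ^ 2 = ‖e‖ * ‖e‖ := sq _
      _ ≤ _ := this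
      _ = _ := by ring
  refine (Finset.sum_le_sum fun i _ => h1 i).trans ?_
  rw [← Finset.mul_sum, Finset.sum_coe_sort Leg fun i =>
    ∑ j ∈ G.neighborFinset i, |weight G Leg α b T₀ i j t ω - nom i j|]
  have h4 := mul_le_mul_of_nonneg_left (sum_abs_weight_sub_le G Leg α b ht ω)
    (by positivity : 0 ≤ 4 * η ^ 2)
  have h5 : 0 ≤ η ^ 2 * numMisclass G Leg α t ω :=
    mul_nonneg (sq_nonneg _) (numMisclass_nonneg G Leg α t ω)
  linarith

end Misclassification

/-! ### Geometric and harmonic sums -/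

section Sums

variable {r : ℝ}

theorem sum_pow_le (h0 : 0 ≤ r) (h1 : r < 1) (T : ℕ) :
    ∑ k ∈ Finset.range T, r ^ k ≤ 1 / (1 - r) := by
  rw [one_div]
  exact sum_le_hasSum _ (fun _ _ => by positivity) (hasSum_geometric_of_lt_one h0 h1)

theorem sum_add_one_mul_pow_le (h0 : 0 ≤ r) (h1 : r < 1) (T : ℕ) :
    ∑ k ∈ Finset.range T, ((k : ℝ) + 1) * r ^ k ≤ 1 / (1 - r) ^ 2 := by
  have h := hasSum_choose_mul_geometric_of_norm_lt_one 1
    (by rwa [Real.norm_of_nonneg h0] : ‖r‖ < 1)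
  simpa using sum_le_hasSum (Finset.range T) (fun _ _ => by positivity) h

theorem sum_mul_add_one_mul_pow_le (h0 : 0 ≤ r) (h1 : r < 1) (T : ℕ) :
    ∑ k ∈ Finset.range T, (k : ℝ) * (k + 1) * r ^ k ≤ 2 * r / (1 - r) ^ 3 := by
  -- Summation by parts, with its boundary term, lowers the degree of the polynomial factor by one.
  have hid : (1 - r) * ∑ k ∈ Finset.range T, (k : ℝ) * (k + 1) * r ^ k + (T - 1) * T * r ^ T =
      2 * ∑ k ∈ Finset.range T, (k : ℝ) * r ^ k := by
    induction T with
    | zero => simp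
    | succ T ih =>
      rw [Finset.sum_range_succ, Finset.sum_range_succ, mul_add (1 - r), mul_add 2, ← ih]
      push_cast
      ring
  have h2 : ∑ k ∈ Finset.range T, (k : ℝ) * r ^ k ≤ r / (1 - r) ^ 2 :=
    sum_le_hasSum _ (fun _ _ => by positivity)
      (hasSum_coe_mul_geometric_of_norm_lt_one (by rwa [Real.norm_of_nonneg h0]))
  have h3 : 0 ≤ ((T : ℝ) - 1) * T * r ^ T := by
    rcases Nat.eq_zero_or_pos T with rfl | hT
    · simp
    · have : (1 : ℝ) ≤ T := by exact_mod_cast hT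
      have : 0 ≤ (T : ℝ) - 1 := by linarith
      positivity
  have hr : 0 < 1 - r := by linarith
  have h4 : 2 * r / (1 - r) ^ 3 = 2 * (r / (1 - r) ^ 2) / (1 - r) := by field_simp
  rw [h4, le_div_iff₀ hr]
  linarith

theorem sum_inv_add_two_le (T : ℕ) :
    ∑ k ∈ Finset.range T, 1 / ((k : ℝ) + 2) ≤ 1 + Real.log (((T : ℝ) + 2) / 2) := by
  -- This sharper bound is the inductive one: its increment `log ((T+2)/(T+1))` is at least
  -- `1/(T+2)`. At `T = 0` it needs `log 2 ≤ 1`.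
  have h : ∑ k ∈ Finset.range T, 1 / ((k : ℝ) + 2) ≤ 1 + Real.log (((T : ℝ) + 1) / 2) := by
    induction T with
    | zero =>
      have := Real.log_two_lt_d9
      simp only [Finset.range_zero, Finset.sum_empty, Nat.cast_zero, zero_add, one_div,
        Real.log_inv]
      linarith
    | succ T ih =>
      rw [Finset.sum_range_succ]
      have hT : (0 : ℝ) < T + 1 := by positivity
      have h1 := Real.one_sub_inv_le_log_of_pos (x := ((T : ℝ) + 2) / (T + 1)) (by positivity)
      have h2 : 1 - (((T : ℝ) + 2) / (T + 1))⁻¹ = 1 / ((T : ℝ) + 2) := by field_simp; ring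
      have h3 : ((T + 1 : ℕ) + 1 : ℝ) / 2 = ((T : ℝ) + 1) / 2 * (((T : ℝ) + 2) / (T + 1)) := by
        push_cast; field_simp; ring
      rw [h3, Real.log_mul (by positivity) (by positivity)]
      linarith
  refine h.trans (add_le_add_right (Real.log_le_log (by positivity) ?_) _)
  linarith

end Sums

/-! ### Solving the recursions for step sizes `2 / (μ (τ + 2))` -/

section Rate

variable {a s m q : ℕ → ℝ} {μ g η ρ : ℝ}

/-- The contraction factor is `τ/(τ+2)`, so multiplication by `(τ+1)(τ+2)` makes the recursion
telescope in `τ(τ+1) a τ`; the initial error has weight zero. -/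
theorem mul_le_of_step (hμ : 0 < μ)
    (ha : ∀ τ : ℕ, a (τ + 1) ≤ (1 - 2 / (μ * ((τ : ℝ) + 2)) * μ) * (a τ + 8 * η ^ 2 * m τ) +
      (2 / (μ * ((τ : ℝ) + 2)) * g) ^ 2 + 2 * (2 / (μ * ((τ : ℝ) + 2)) * g) * s τ) (T : ℕ) :
    (T : ℝ) * (T + 1) * a T ≤ 4 * g ^ 2 * T / μ ^ 2 +
      8 * η ^ 2 * ∑ τ ∈ Finset.range T, (τ : ℝ) * (τ + 1) * m τ +
      4 * g / μ * ∑ τ ∈ Finset.range T, ((τ : ℝ) + 1) * s τ := by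
  induction T with
  | zero => simp
  | succ T ih =>
    rw [Finset.sum_range_succ, Finset.sum_range_succ]
    have hT : (0 : ℝ) ≤ T := Nat.cast_nonneg T
    have h1 := mul_le_mul_of_nonneg_left (ha T) (by positivity : 0 ≤ ((T : ℝ) + 1) * (T + 2))
    have h2 : ((T : ℝ) + 1) * (T + 2) * ((1 - 2 / (μ * ((T : ℝ) + 2)) * μ) *
        (a T + 8 * η ^ 2 * m T) + (2 / (μ * ((T : ℝ) + 2)) * g) ^ 2 +
        2 * (2 / (μ * ((T : ℝ) + 2)) * g) * s T) =
        T * (T + 1) * (a T + 8 * η ^ 2 * m T) + 4 * g ^ 2 / μ ^ 2 * ((T + 1) / (T + 2)) +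
          4 * g / μ * ((T + 1) * s T) := by
      field_simp
      ring
    have h3 : 4 * g ^ 2 / μ ^ 2 * (((T : ℝ) + 1) / (T + 2)) ≤ 4 * g ^ 2 / μ ^ 2 :=
      mul_le_of_le_one_right (by positivity) (by rw [div_le_one (by positivity)]; linarith)
    have h4 : 4 * g ^ 2 * ((T : ℝ) + 1) / μ ^ 2 = 4 * g ^ 2 * T / μ ^ 2 + 4 * g ^ 2 / μ ^ 2 := by
      ring
    rw [h2] at h1
    push_cast
    rw [h4]
    linarith

/-- Summing the recursion bounds the sum of `s` by `ρ` times itself plus the forcing. The forcing is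
split because `h` enters with a delay of one step, whereas `e` already acts on `s 0`. -/
theorem sum_le_of_contraction (hη : 0 ≤ η) (hs : ∀ τ, 0 ≤ s τ) (hρ0 : 0 ≤ ρ) {e h : ℕ → ℝ}
    (hh : ∀ τ, 0 ≤ h τ) (hs0 : s 0 ≤ η + e 0) (hs1 : ∀ τ, s (τ + 1) ≤ ρ * s τ + h τ + e (τ + 1))
    (T : ℕ) : (1 - ρ) * ∑ τ ∈ Finset.range T, s τ ≤
      η + ∑ τ ∈ Finset.range T, h τ + ∑ τ ∈ Finset.range T, e τ := by
  have key : ∀ T : ℕ, ∑ τ ∈ Finset.range (T + 1), s τ ≤ ρ * ∑ τ ∈ Finset.range T, s τ +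
      (η + ∑ τ ∈ Finset.range T, h τ + ∑ τ ∈ Finset.range (T + 1), e τ) := by
    intro T
    induction T with
    | zero => simpa using hs0
    | succ T ih =>
      rw [Finset.sum_range_succ, Finset.sum_range_succ s T, Finset.sum_range_succ h T,
        Finset.sum_range_succ e (T + 1), mul_add]
      rw [Finset.sum_range_succ s T] at ih
      linarith [hs1 T]
  cases T with
  | zero => simpa using hη
  | succ T =>
    have h1 := key T
    have h2 : ρ * ∑ τ ∈ Finset.range T, s τ ≤ ρ * ∑ τ ∈ Finset.range (T + 1), s τ := by
      rw [Finset.sum_range_succ, mul_add]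
      exact le_add_of_nonneg_right (mul_nonneg hρ0 (hs T))
    have h3 : ∑ τ ∈ Finset.range T, h τ ≤ ∑ τ ∈ Finset.range (T + 1), h τ := by
      rw [Finset.sum_range_succ]; exact le_add_of_nonneg_right (hh T)
    linarith

/-- The total weighted deviation from consensus, for step sizes `2 / (μ (τ + 2))`. -/
theorem sum_add_one_mul_le (hμ : 0 < μ) (hg : 0 ≤ g) (hη : 0 ≤ η) (hρ0 : 0 ≤ ρ) (hρ1 : ρ < 1)
    (hs : ∀ τ, 0 ≤ s τ) (hs0 : s 0 ≤ η + 3 * η * q 0)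
    (hs1 : ∀ τ : ℕ, s (τ + 1) ≤ ρ * (s τ + 2 / (μ * ((τ : ℝ) + 2)) * g) + 3 * η * q (τ + 1))
    (T : ℕ) : ∑ τ ∈ Finset.range T, ((τ : ℝ) + 1) * s τ ≤
      (η + 2 * g / μ * T + 3 * η * ∑ τ ∈ Finset.range T, ((τ : ℝ) + 1) * q τ +
        (η + 2 * g / μ * (1 + Real.log (((T : ℝ) + 2) / 2)) +
          3 * η * ∑ τ ∈ Finset.range T, q τ) / (1 - ρ)) / (1 - ρ) := by
  have hr : 0 < 1 - ρ := by linarith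
  have hB := sum_le_of_contraction (e := fun τ => 3 * η * q τ)
    (h := fun τ : ℕ => ρ * (2 / (μ * ((τ : ℝ) + 2)) * g)) hη hs hρ0
    (fun τ => by positivity) hs0 (fun τ => by linarith [hs1 τ]) T
  have hH : ∑ τ ∈ Finset.range T, ρ * (2 / (μ * ((τ : ℝ) + 2)) * g) ≤
      2 * g / μ * (1 + Real.log (((T : ℝ) + 2) / 2)) := by
    have h1 := mul_le_mul_of_nonneg_left (sum_inv_add_two_le T)
      (by positivity : 0 ≤ 2 * g / μ)
    refine le_trans ?_ h1
    rw [Finset.mul_sum]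
    refine Finset.sum_le_sum fun τ _ => ?_
    have h2 : ρ * (2 / (μ * ((τ : ℝ) + 2)) * g) = ρ * (2 * g / μ * (1 / ((τ : ℝ) + 2))) := by
      field_simp
    rw [h2]
    exact mul_le_of_le_one_left (by positivity) hρ1.le
  -- The weighted sequence obeys the same contraction: in `τ + 2 = (τ + 1) + 1` the extra 1 produces
  -- the forcing `s τ`, whose sum is bounded by `hB`, and `τ + 2` cancels the decay of the step
  -- size.
  have hA := sum_le_of_contraction (s := fun τ : ℕ => ((τ : ℝ) + 1) * s τ) (ρ := ρ)
    (e := fun τ : ℕ => 3 * η * (((τ : ℝ) + 1) * q τ))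
    (h := fun τ : ℕ => s τ + 2 * g / μ) hη (fun τ => mul_nonneg (by positivity) (hs τ)) hρ0
    (fun τ => add_nonneg (hs τ) (by positivity)) (by simpa using hs0) (fun τ => by
      have h1 := mul_le_mul_of_nonneg_left (hs1 τ) (by positivity : 0 ≤ (τ : ℝ) + 2)
      have h2 : ((τ : ℝ) + 2) * (ρ * (s τ + 2 / (μ * ((τ : ℝ) + 2)) * g) + 3 * η * q (τ + 1)) =
          ρ * (((τ : ℝ) + 1) * s τ) + ρ * (s τ + 2 * g / μ) +
            3 * η * (((τ : ℝ) + 2) * q (τ + 1)) := by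
        field_simp
        ring
      rw [h2] at h1
      have h3 : ρ * (s τ + 2 * g / μ) ≤ s τ + 2 * g / μ :=
        mul_le_of_le_one_left (add_nonneg (hs τ) (by positivity)) hρ1.le
      have h4 : ((τ + 1 : ℕ) : ℝ) + 1 = (τ : ℝ) + 2 := by push_cast; ring
      simp only [h4]
      linarith) T
  rw [Finset.sum_add_distrib, Finset.sum_const, Finset.card_range, nsmul_eq_mul,
    ← Finset.mul_sum] at hA
  rw [← Finset.mul_sum _ _ (3 * η)] at hB
  have hB' : ∑ τ ∈ Finset.range T, s τ ≤ (η + 2 * g / μ * (1 + Real.log (((T : ℝ) + 2) / 2)) +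
      3 * η * ∑ τ ∈ Finset.range T, q τ) / (1 - ρ) := by
    rw [le_div_iff₀ hr]
    linarith
  rw [le_div_iff₀ hr]
  linarith

end Rate

/-! ### Convergence for general step sizes -/

section Convergence

theorem summable_of_contraction {v h : ℕ → ℝ} {ρ : ℝ} (hρ0 : 0 ≤ ρ) (hρ1 : ρ < 1)
    (hv : ∀ τ, 0 ≤ v τ) (hh : ∀ τ, 0 ≤ h τ) (hs : Summable h)
    (hstep : ∀ τ, v (τ + 1) ≤ ρ * v τ + h τ) : Summable v := by
  have hr : 0 < 1 - ρ := by linarith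
  refine summable_of_sum_range_le (c := (v 0 + ∑' τ, h τ) / (1 - ρ)) hv fun T => ?_
  have h1 := sum_le_of_contraction (e := fun _ => 0) (hv 0) hv hρ0 hh (by simp)
    (fun τ => by simpa using hstep τ) T
  rw [le_div_iff₀ hr]
  have := hs.sum_le_tsum (Finset.range T) fun i _ => hh i
  simp only [Finset.sum_const_zero, add_zero] at h1
  linarith

/-- Minus the partial sums of `h`, the sequence `a` decreases and is bounded below, so `a`
converges. A limit `l > 0` would eventually force a decrease of at least `(l/2) δ`, up to `h`, at
each step, which is impossible as `∑ δ` diverges. -/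
theorem tendsto_zero_of_step_le {a δ h : ℕ → ℝ} (ha : ∀ τ, 0 ≤ a τ) (hδ : ∀ τ, 0 ≤ δ τ)
    (hh : ∀ τ, 0 ≤ h τ) (hs : Summable h)
    (hδs : Tendsto (fun n => ∑ t ∈ Finset.range n, δ t) atTop atTop)
    (hstep : ∀ τ, a (τ + 1) ≤ (1 - δ τ) * a τ + h τ) : Tendsto a atTop (𝓝 0) := by
  set S : ℕ → ℝ := fun n => ∑ t ∈ Finset.range n, h t with hS
  have hSle : ∀ n, S n ≤ ∑' t, h t := fun n => hs.sum_le_tsum _ fun i _ => hh i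
  have hanti : Antitone fun n => a n - S n := by
    refine antitone_nat_of_succ_le fun n => ?_
    have := hstep n
    have h2 := mul_nonneg (hδ n) (ha n)
    simp only [hS, Finset.sum_range_succ]
    linarith
  have hlim := tendsto_atTop_ciInf hanti ⟨-∑' t, h t, by
    rintro _ ⟨n, rfl⟩
    have := ha n
    have := hSle n
    simp only
    linarith⟩
  have hlim2 := hlim.add hs.hasSum.tendsto_sum_nat
  set l := (⨅ n, (a n - S n)) + ∑' t, h t with hl
  have hal : Tendsto a atTop (𝓝 l) := by
    refine hlim2.congr fun n => ?_
    simp [hS]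
  have hl0 : 0 ≤ l := ge_of_tendsto' hal ha
  rcases hl0.eq_or_lt with h0 | hpos
  · rw [h0]; exact hal
  exfalso
  obtain ⟨N, hN⟩ := eventually_atTop.1 (hal.eventually (lt_mem_nhds (half_lt_self hpos)))
  have hbound : ∀ n, N ≤ n → l / 2 * ∑ t ∈ Finset.range n, δ t + a n ≤
      l / 2 * (∑ t ∈ Finset.range N, δ t) + (a N - S N) + S n := by
    intro n hn
    induction n, hn using Nat.le_induction with
    | base => linarith
    | succ n hn ih =>
      have h1 := hstep n
      have h2 := mul_le_mul_of_nonneg_left (hN n hn).le (hδ n)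
      simp only [hS, Finset.sum_range_succ] at ih ⊢
      linarith
  obtain ⟨M, hM⟩ := eventually_atTop.1 (hδs.eventually_gt_atTop
    ((l / 2 * (∑ t ∈ Finset.range N, δ t) + (a N - S N) + ∑' t, h t) / (l / 2)))
  have h1 := hM (max M N) (le_max_left _ _)
  have h2 := hbound (max M N) (le_max_right _ _)
  rw [div_lt_iff₀ (by positivity)] at h1
  linarith [hSle (max M N), ha (max M N)]

/-- Squaring the recursion of `s` leaves a contraction forced by `γ²` and `m`, so `s²` is summable.
Then `2γs ≤ γ² + s²` makes all errors in the recursion of `a` summable. -/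
theorem tendsto_zero_of_recursion {a s m γ : ℕ → ℝ} {μ g η ρ : ℝ} (hμ : 0 < μ) (hg : 0 ≤ g)
    (hρ0 : 0 ≤ ρ) (hρ1 : ρ < 1) (ha0 : ∀ τ, 0 ≤ a τ) (hs : ∀ τ, 0 ≤ s τ)
    (hm0 : ∀ τ, 0 ≤ m τ) (hm : Summable m) (hγ0 : ∀ τ, 0 ≤ γ τ)
    (hγ : Tendsto (fun n => ∑ t ∈ Finset.range n, γ t) atTop atTop)
    (hγ2 : Summable fun t => γ t ^ 2)
    (ha : ∀ τ, γ τ * μ ≤ 1 → a (τ + 1) ≤ (1 - γ τ * μ) * (a τ + 8 * η ^ 2 * m τ) +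
      (γ τ * g) ^ 2 + 2 * (γ τ * g) * s τ)
    (hs1 : ∀ τ, s (τ + 1) ≤ ρ * (s τ + γ τ * g) + 3 * η * √(m (τ + 1))) :
    Tendsto a atTop (𝓝 0) := by
  have hr : 0 < 1 - ρ := by linarith
  have hs2 : Summable fun τ => s τ ^ 2 := by
    have hm' : Summable fun τ => m (τ + 1) := (summable_nat_add_iff 1).2 hm
    refine summable_of_contraction (h := fun τ => (2 * (g ^ 2 * γ τ ^ 2) +
      18 * η ^ 2 * m (τ + 1)) / (1 - ρ)) hρ0 hρ1 (fun τ => sq_nonneg _) (fun τ => ?_) ?_ fun τ => ?_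
    · have := hm0 (τ + 1)
      positivity
    · exact (((hγ2.mul_left _).mul_left _).add (hm'.mul_left _)).div_const _
    · set e := ρ * (γ τ * g) + 3 * η * √(m (τ + 1)) with he
      have h1 : s (τ + 1) ^ 2 ≤ (ρ * s τ + e) ^ 2 :=
        pow_le_pow_left₀ (hs _) (by linarith [hs1 τ]) 2
      -- Convexity of the square for the combination of `s` and `e / (1 - ρ)` with weights `ρ` and
      -- `1 - ρ`.
      have h2 : (ρ * s τ + e) ^ 2 ≤ ρ * s τ ^ 2 + e ^ 2 / (1 - ρ) := by
        have : ρ * s τ ^ 2 + e ^ 2 / (1 - ρ) - (ρ * s τ + e) ^ 2 =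
            ρ / (1 - ρ) * ((1 - ρ) * s τ - e) ^ 2 := by
          field_simp; ring
        have h3 : 0 ≤ ρ / (1 - ρ) * ((1 - ρ) * s τ - e) ^ 2 := by positivity
        linarith
      have h4 : e ^ 2 ≤ 2 * (g ^ 2 * γ τ ^ 2) + 18 * η ^ 2 * m (τ + 1) := by
        have h5 : (ρ * (γ τ * g)) ^ 2 ≤ (γ τ * g) ^ 2 :=
          pow_le_pow_left₀ (mul_nonneg hρ0 (mul_nonneg (hγ0 τ) hg))
            (mul_le_of_le_one_left (mul_nonneg (hγ0 τ) hg) hρ1.le) 2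
        have h6 : (3 * η * √(m (τ + 1))) ^ 2 = 9 * η ^ 2 * m (τ + 1) := by
          rw [mul_pow, Real.sq_sqrt (hm0 _)]; ring
        have h7 : e ^ 2 ≤ 2 * (ρ * (γ τ * g)) ^ 2 + 2 * (3 * η * √(m (τ + 1))) ^ 2 := by
          rw [he]; linarith [sq_nonneg (ρ * (γ τ * g) - 3 * η * √(m (τ + 1)))]
        linarith
      have h8 := div_le_div_of_nonneg_right h4 hr.le
      linarith
  have hγlim : Tendsto γ atTop (𝓝 0) := by
    have := hγ2.tendsto_atTop_zero.sqrt
    simpa [Real.sqrt_sq (hγ0 _)] using this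
  have hev : ∀ᶠ τ in atTop, γ τ * μ ≤ 1 := by
    have h1 : Tendsto (fun τ => γ τ * μ) atTop (𝓝 (0 * μ)) := hγlim.mul_const μ
    rw [zero_mul] at h1
    exact (h1.eventually (gt_mem_nhds zero_lt_one)).mono fun _ h => h.le
  obtain ⟨N, hN⟩ := eventually_atTop.1 hev
  -- The recursion of `a` is available only once `γ μ ≤ 1`, so finitely many steps are discarded.
  rw [← tendsto_add_atTop_iff_nat N]
  set h : ℕ → ℝ := fun τ => 8 * η ^ 2 * m τ + g ^ 2 * γ τ ^ 2 + g * (γ τ ^ 2 + s τ ^ 2) with hh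
  have hsum : Summable h :=
    ((hm.mul_left _).add (hγ2.mul_left _)).add ((hγ2.add hs2).mul_left _)
  refine tendsto_zero_of_step_le (δ := fun τ => γ (τ + N) * μ) (h := fun τ => h (τ + N))
    (fun τ => ha0 _) (fun τ => mul_nonneg (hγ0 _) hμ.le) (fun τ => ?_)
    ((summable_nat_add_iff N).2 hsum) ?_ fun τ => ?_
  · have := hm0 (τ + N)
    positivity
  · simp_rw [← Finset.sum_mul]
    refine Tendsto.atTop_mul_const hμ ?_
    have h1 : ∀ n, ∑ t ∈ Finset.range n, γ (t + N) =
        ∑ t ∈ Finset.range (n + N), γ t - ∑ t ∈ Finset.range N, γ t := by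
      intro n
      rw [add_comm n N, Finset.sum_range_add]
      simp [add_comm]
    simp_rw [h1]
    exact tendsto_atTop_add_const_right _ _ ((tendsto_add_atTop_iff_nat N).2 hγ)
  · have h1 := ha (τ + N) (hN _ (by omega))
    have h2 : (1 - γ (τ + N) * μ) * (8 * η ^ 2 * m (τ + N)) ≤ 8 * η ^ 2 * m (τ + N) :=
      mul_le_of_le_one_left (mul_nonneg (by positivity) (hm0 _))
        (by linarith [mul_nonneg (hγ0 (τ + N)) hμ.le])
    have h3 := mul_le_mul_of_nonneg_left (two_mul_le_add_sq (γ (τ + N)) (s (τ + N))) hg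
    have h4 : τ + 1 + N = τ + N + 1 := by omega
    simp only [hh, h4]
    linarith

end Convergence

/-! ### The pathwise recursions of the algorithm -/

section Dynamics

variable {V : Type*} {Ω : Type*} {d : ℕ}

/-- The deterministic assumptions on the graph, the constraint set, the objectives and the
minimizer. -/
structure IsProblem (G : SimpleGraph V) (Leg : Finset V) (X : Set (Vec d)) (f : V → Vec d → ℝ)
    (μ η g : ℝ) (xstar : Vec d) : Prop where
  conn : (G.induce (Leg : Set V)).Connected
  closed : IsClosed X
  convex : Convex ℝ X
  norm_le : ∀ x ∈ X, ‖x‖ ≤ η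
  mu_pos : 0 < μ
  diff : ∀ i ∈ Leg, Differentiable ℝ (f i)
  strongConvex : ∀ i ∈ Leg, StrongConvexOn Set.univ μ (f i)
  grad_le : ∀ i ∈ Leg, ∀ x ∈ X, ‖gradient (f i) x‖ ≤ g
  star_mem : xstar ∈ X
  isMinOn : IsMinOn (legObjective Leg f) X xstar

variable {G : SimpleGraph V} {Leg : Finset V} {X : Set (Vec d)} {f : V → Vec d → ℝ}
  {μ η g : ℝ} {xstar : Vec d}

namespace IsProblem

theorem nonempty (h : IsProblem G Leg X f μ η g xstar) : Nonempty Leg := by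
  obtain ⟨i⟩ := h.conn.nonempty
  exact ⟨⟨i, i.2⟩⟩

theorem eta_nonneg (h : IsProblem G Leg X f μ η g xstar) : 0 ≤ η :=
  (norm_nonneg _).trans (h.norm_le _ h.star_mem)

theorem g_nonneg (h : IsProblem G Leg X f μ η g xstar) : 0 ≤ g := by
  obtain ⟨i⟩ := h.nonempty
  exact (norm_nonneg _).trans (h.grad_le i i.2 _ h.star_mem)

theorem card_pos (h : IsProblem G Leg X f μ η g xstar) : 0 < (Leg.card : ℝ) := by
  obtain ⟨i⟩ := h.nonempty
  exact_mod_cast Finset.card_pos.2 ⟨i.1, i.2⟩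

theorem sum_le (h : IsProblem G Leg X f μ η g xstar) {x : Vec d} (hx : x ∈ X) :
    ∑ i : Leg, f i xstar ≤ ∑ i : Leg, f i x := by
  have h1 := isMinOn_iff.1 h.isMinOn x hx
  unfold legObjective at h1
  have h2 := le_of_mul_le_mul_left h1 (one_div_pos.2 h.card_pos)
  rwa [Finset.sum_coe_sort Leg fun i => f i xstar, Finset.sum_coe_sort Leg fun i => f i x]

theorem norm_sub_star_sq_le (h : IsProblem G Leg X f μ η g xstar) {x : Vec d} (hx : x ∈ X) :
    ‖x - xstar‖ ^ 2 ≤ 4 * η ^ 2 := by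
  have := (norm_sub_le x xstar).trans (add_le_add (h.norm_le x hx) (h.norm_le _ h.star_mem))
  have h2 := pow_le_pow_left₀ (norm_nonneg _) this 2
  linarith

variable [Fintype V] [DecidableEq V] [DecidableRel G.Adj]

theorem rhoLeg_eq (h : IsProblem G Leg X f μ η g xstar) :
    rhoLeg G Leg = sigmaTwo (nominalMatrix G Leg) := by
  have := h.nonempty
  exact (isMixing_nominalMatrix h.conn).iSup_sigmaTwo_pow

theorem rhoLeg_nonneg (h : IsProblem G Leg X f μ η g xstar) : 0 ≤ rhoLeg G Leg := by
  rw [h.rhoLeg_eq]; exact sigmaTwo_nonneg _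

theorem rhoLeg_lt_one (h : IsProblem G Leg X f μ η g xstar) : rhoLeg G Leg < 1 := by
  have := h.nonempty
  rw [h.rhoLeg_eq]
  exact (isMixing_nominalMatrix h.conn).sigmaTwo_lt_one

variable {α b : V → V → ℕ → Ω → ℝ} {u : V → V → ℕ → Ω → Vec d} {γ : ℕ → ℝ} {T₀ : ℕ}
  {x₀ : V → Vec d}

theorem iterate_succ_eq (t : ℕ) (ω : Ω) (i : V) :
    iterate G Leg X f α b u γ T₀ x₀ (t + 1) ω i =
      proj X (mixed G Leg α b u T₀ (iterate G Leg X f α b u γ T₀ x₀ t ω) t ω i -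
        (if T₀ ≤ t then γ (t - T₀) else 0) •
        gradient (f i) (mixed G Leg α b u T₀ (iterate G Leg X f α b u γ T₀ x₀ t ω) t ω i)) := rfl

theorem iterate_mem (h : IsProblem G Leg X f μ η g xstar) (hx₀ : ∀ i ∈ Leg, x₀ i ∈ X) (t : ℕ)
    (ω : Ω) (i : V) (hi : i ∈ Leg) : iterate G Leg X f α b u γ T₀ x₀ t ω i ∈ X := by
  cases t with
  | zero => exact hx₀ i hi
  | succ t =>
    rw [iterate_succ_eq]
    exact (proj_spec h.closed ⟨_, h.star_mem⟩ _).1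

theorem dev_mixed_le (h : IsProblem G Leg X f μ η g xstar)
    (hu : ∀ i ∈ Leg, ∀ j ∉ Leg, G.Adj i j → ∀ t ω, u i j t ω ∈ X) {x : V → Vec d}
    (hx : ∀ i ∈ Leg, x i ∈ X) {t : ℕ} (ht : T₀ ≤ t) (ω : Ω) :
    dev (fun i : Leg => mixed G Leg α b u T₀ x t ω i) ≤
      rhoLeg G Leg * dev (fun i : Leg => x i) + 3 * η * √(numMisclass G Leg α t ω) := by
  have := h.nonempty
  refine (dev_le_add _ fun i : Leg => ∑ j : Leg, nominalMatrix G Leg i j • x j).trans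
    (add_le_add ?_ ?_)
  · rw [h.rhoLeg_eq]
    exact (isMixing_nominalMatrix h.conn).dev_apply_le fun i : Leg => x i
  · refine Real.sqrt_le_iff.2 ⟨mul_nonneg (by linarith [h.eta_nonneg]) (Real.sqrt_nonneg _), ?_⟩
    rw [mul_pow, Real.sq_sqrt (numMisclass_nonneg G Leg α t ω), mul_pow]
    have := sum_norm_sq_mixed_sub_nominal_le (α := α) (b := b) (ω := ω) h.eta_nonneg h.convex
      h.norm_le hx hu ht
    linarith

/-- The recursions satisfied by the mean square distance to the minimizer and by the normalized
deviation from consensus. -/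
theorem exists_recursion (h : IsProblem G Leg X f μ η g xstar)
    (hu : ∀ i ∈ Leg, ∀ j ∉ Leg, G.Adj i j → ∀ t ω, u i j t ω ∈ X)
    (hx₀ : ∀ i ∈ Leg, x₀ i ∈ X) (hγ : ∀ t, 0 ≤ γ t) (ω : Ω) (a m : ℕ → ℝ)
    (ha : ∀ τ, a τ = 1 / (Leg.card : ℝ) *
      ∑ i ∈ Leg, ‖iterate G Leg X f α b u γ T₀ x₀ (T₀ + τ) ω i - xstar‖ ^ 2)
    (hm : ∀ τ, m τ = numMisclass G Leg α (T₀ + τ) ω) :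
    ∃ s : ℕ → ℝ, (∀ τ, 0 ≤ s τ) ∧ s 0 ≤ η + 3 * η * √(m 0) ∧
      (∀ τ, s (τ + 1) ≤ rhoLeg G Leg * (s τ + γ τ * g) + 3 * η * √(m (τ + 1))) ∧
      ∀ τ, γ τ * μ ≤ 1 → a (τ + 1) ≤ (1 - γ τ * μ) * (a τ + 8 * η ^ 2 * m τ) +
        (γ τ * g) ^ 2 + 2 * (γ τ * g) * s τ := by
  have hne := h.nonempty
  have hη := h.eta_nonneg
  have hg := h.g_nonneg
  have hρ := h.rhoLeg_nonneg
  set x : ℕ → V → Vec d := fun τ => iterate G Leg X f α b u γ T₀ x₀ (T₀ + τ) ω with hx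
  have hxX : ∀ τ, ∀ i ∈ Leg, x τ i ∈ X := fun τ i hi => h.iterate_mem hx₀ _ ω i hi
  set c : ℕ → Leg → Vec d := fun τ i => mixed G Leg α b u T₀ (x τ) (T₀ + τ) ω i with hc
  have hcX : ∀ τ i, c τ i ∈ X := fun τ i => mixed_mem h.convex (hxX τ) hu i.2
  have hstep : ∀ τ (i : Leg), x (τ + 1) i =
      proj X (c τ i - γ τ • gradient (f i) (c τ i)) := by
    intro τ i
    have := iterate_succ_eq (G := G) (Leg := Leg) (X := X) (f := f) (α := α) (b := b) (u := u)
      (γ := γ) (T₀ := T₀) (x₀ := x₀) (T₀ + τ) ω i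
    rw [if_pos (Nat.le_add_right _ _), Nat.add_sub_cancel_left] at this
    exact this
  have hcard : (Fintype.card Leg : ℝ) = Leg.card := by simp
  have hn := h.card_pos
  have hn1 : (1 : ℝ) ≤ Leg.card := by
    have : 0 < Leg.card := by exact_mod_cast hn
    exact_mod_cast this
  have hsn : 1 ≤ √(Leg.card : ℝ) := Real.one_le_sqrt.2 hn1
  have hsn0 : 0 < √(Leg.card : ℝ) := by linarith
  have hm0 : ∀ τ, 0 ≤ m τ := fun τ => by rw [hm]; exact numMisclass_nonneg _ _ _ _ _
  have hcdev : ∀ τ, dev (c τ) ≤ rhoLeg G Leg * dev (fun i : Leg => x τ i) + 3 * η * √(m τ) := by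
    intro τ
    rw [hm]
    exact h.dev_mixed_le hu (hxX τ) (Nat.le_add_right _ _) ω
  have hdrop : ∀ τ, 3 * η * √(m τ) / √(Leg.card : ℝ) ≤ 3 * η * √(m τ) := fun τ =>
    div_le_self (by positivity) hsn
  -- The deviation is taken after mixing, at the points where gradients are evaluated. Division by
  -- `√|L|` removes the number of agents from the recursions: `√|L| * dev / |L|` is what averaging
  -- the gradient-step bound leaves.
  refine ⟨fun τ => dev (c τ) / √(Leg.card : ℝ), fun τ => div_nonneg (dev_nonneg _) hsn0.le,
    ?_, fun τ => ?_, fun τ hτ => ?_⟩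
  · have h1 : dev (fun i : Leg => x 0 i) ≤ η * √(Leg.card : ℝ) := by
      refine (dev_le _).trans (Real.sqrt_le_iff.2 ⟨by positivity, ?_⟩)
      rw [mul_pow, Real.sq_sqrt hn.le]
      refine (Finset.sum_le_sum fun (i : Leg) _ =>
        pow_le_pow_left₀ (norm_nonneg _) (h.norm_le _ (hxX 0 i i.2)) 2).trans ?_
      simp [mul_comm]
    have h2 : dev (c 0) ≤ η * √(Leg.card : ℝ) + 3 * η * √(m 0) :=
      (hcdev 0).trans (add_le_add_left
        ((mul_le_of_le_one_left (dev_nonneg _) h.rhoLeg_lt_one.le).trans h1) _)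
    refine (div_le_div_of_nonneg_right h2 hsn0.le).trans ?_
    rw [add_div, mul_div_cancel_right₀ _ hsn0.ne']
    exact add_le_add_right (hdrop 0) _
  · have h1 : dev (fun i : Leg => x (τ + 1) i) ≤
        dev (c τ) + √(Leg.card : ℝ) * (γ τ * g) := by
      simp_rw [hstep]
      rw [← hcard]
      exact dev_step_le (f := fun i : Leg => f i) h.closed h.convex hg
        (fun i => h.grad_le i i.2) (hcX τ) (hγ τ)
    have h2 := (hcdev (τ + 1)).trans (add_le_add_left (mul_le_mul_of_nonneg_left h1 hρ) _)
    refine (div_le_div_of_nonneg_right h2 hsn0.le).trans ?_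
    rw [add_div]
    refine add_le_add (le_of_eq ?_) (hdrop _)
    field_simp
  · have h1 := sum_norm_sq_mixed_sub_le (α := α) (b := b) (ω := ω) (x := x τ) h.norm_le (hxX τ) hu
      h.star_mem (Nat.le_add_right T₀ τ)
    rw [← hm, ← Finset.sum_coe_sort Leg fun i =>
      ‖mixed G Leg α b u T₀ (x τ) (T₀ + τ) ω i - xstar‖ ^ 2] at h1
    have h2 := sum_norm_sq_step_le (f := fun i : Leg => f i) h.closed h.convex h.mu_pos.le hg
      (fun i => h.diff i i.2) (fun i => h.strongConvex i i.2) (fun i => h.grad_le i i.2) h.star_mem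
      (fun z hz => h.sum_le hz) (hcX τ) (hγ τ) hτ h1
    simp_rw [← hstep] at h2
    rw [hcard, Finset.sum_coe_sort Leg fun i => ‖x (τ + 1) i - xstar‖ ^ 2] at h2
    have h3 := mul_le_mul_of_nonneg_left h2 (one_div_nonneg.2 hn.le)
    rw [ha (τ + 1)]
    refine h3.trans ?_
    have h4 : 1 / (Leg.card : ℝ) * ((1 - γ τ * μ) * (∑ i ∈ Leg, ‖x τ i - xstar‖ ^ 2 +
        8 * η ^ 2 * m τ) + Leg.card * (γ τ * g) ^ 2 +
        2 * (γ τ * g) * (√(Leg.card : ℝ) * dev (c τ))) =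
        (1 - γ τ * μ) * (a τ + 8 * η ^ 2 * m τ / Leg.card) + (γ τ * g) ^ 2 +
        2 * (γ τ * g) * (√(Leg.card : ℝ) * dev (c τ) / Leg.card) := by
      have ha' : a τ = 1 / (Leg.card : ℝ) * ∑ i ∈ Leg, ‖x τ i - xstar‖ ^ 2 := ha τ
      rw [ha']
      field_simp
    have h5 : √(Leg.card : ℝ) * dev (c τ) / Leg.card = dev (c τ) / √(Leg.card : ℝ) := by
      rw [div_eq_div_iff hn.ne' hsn0.ne']
      have := Real.mul_self_sqrt hn.le
      linear_combination (dev (c τ)) * this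
    rw [h4, h5]
    have h6 : 8 * η ^ 2 * m τ / Leg.card ≤ 8 * η ^ 2 * m τ :=
      div_le_self (mul_nonneg (by positivity) (hm0 τ)) hn1
    have h7 := mul_le_mul_of_nonneg_left (add_le_add_right h6 (a τ)) (sub_nonneg.2 hτ)
    linarith

end IsProblem

end Dynamics

/-! ### Probability of misclassification, measurability and summability -/

section Probability

theorem sqrt_add_le {p q : ℝ} (hp : 0 ≤ p) (hq : 0 ≤ q) : √(p + q) ≤ √p + √q := by
  refine Real.sqrt_le_iff.2 ⟨by positivity, ?_⟩
  rw [add_sq, Real.sq_sqrt hp, Real.sq_sqrt hq]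
  have : 0 ≤ 2 * √p * √q := by positivity
  linarith

/-- Jensen's inequality in the form "the variance of `√m` is nonnegative". -/
theorem sq_integral_sqrt_le {Ω : Type*} [MeasurableSpace Ω] {P : Measure Ω} [IsProbabilityMeasure P]
    {m : Ω → ℝ} (hm0 : ∀ ω, 0 ≤ m ω) (hm : Integrable m P) (hs : Integrable (fun ω => √(m ω)) P) :
    ∫ ω, √(m ω) ∂P ≤ √(∫ ω, m ω ∂P) := by
  refine Real.le_sqrt_of_sq_le ?_
  set c := ∫ ω, √(m ω) ∂P with hc
  have h0 : 0 ≤ ∫ ω, (m ω - 2 * c * √(m ω) + c ^ 2) ∂P := by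
    refine integral_nonneg fun ω => ?_
    have := Real.sq_sqrt (hm0 ω)
    simp only [Pi.zero_apply]
    linarith [sq_nonneg (√(m ω) - c)]
  have h1 : Integrable (fun ω => m ω - 2 * c * √(m ω)) P := hm.sub (hs.const_mul _)
  rw [integral_add h1 (integrable_const _), integral_sub hm (hs.const_mul _), integral_const_mul,
    ← hc] at h0
  simp only [integral_const, probReal_univ, one_smul] at h0
  linarith

theorem misclass_eq_indicator {V : Type*} [DecidableEq V] {Ω : Type*} {Leg : Finset V}
    {α : V → V → ℕ → Ω → ℝ} (i j : V) (t : ℕ) (ω : Ω) : misclass Leg α i j t ω =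
    {ω | ¬ (j ∈ Leg ↔ 0 ≤ trustSum α i j t ω)}.indicator (fun _ => (1 : ℝ)) ω := by
  simp only [misclass, Set.indicator, Set.mem_ofPred_eq]
  split_ifs <;> simp_all

variable {V : Type*} {Ω : Type*} [MeasurableSpace Ω] {d : ℕ}

/-- The assumptions on the trust observations. -/
structure IsTrust (P : Measure Ω) (G : SimpleGraph V) (Leg : Finset V) (α : V → V → ℕ → Ω → ℝ)
    (EL EM : ℝ) : Prop where
  meas : ∀ i ∈ Leg, ∀ j, G.Adj i j → ∀ t, Measurable (α i j t)
  mem : ∀ i ∈ Leg, ∀ j, G.Adj i j → ∀ t, ∀ᵐ ω ∂P, α i j t ω ∈ Set.Icc (0 : ℝ) 1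
  pos : 0 < EL
  neg : EM < 0
  leg : ∀ i ∈ Leg, ∀ j ∈ Leg, G.Adj i j → ∀ t, (∫ ω, α i j t ω ∂P) - 1 / 2 = EL
  mal : ∀ i ∈ Leg, ∀ j ∉ Leg, G.Adj i j → ∀ t, (∫ ω, α i j t ω ∂P) - 1 / 2 = EM
  indep : iIndepFun (fun (p : {p : V × V × ℕ // p.1 ∈ Leg ∧ G.Adj p.1 p.2.1}) =>
    α p.1.1 p.1.2.1 p.1.2.2) P

variable {P : Measure Ω} {G : SimpleGraph V} {Leg : Finset V}
  {α : V → V → ℕ → Ω → ℝ} {EL EM : ℝ}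

namespace IsTrust

theorem measurable_trustSum (h : IsTrust P G Leg α EL EM) {i j : V} (hi : i ∈ Leg)
    (hij : G.Adj i j) (t : ℕ) : Measurable (trustSum α i j t) := by
  unfold trustSum
  exact Finset.measurable_sum _ fun k _ => (h.meas i hi j hij k).sub_const _

section Measurability

section

variable [DecidableEq V]

theorem measurableSet_misclass (h : IsTrust P G Leg α EL EM) {i j : V} (hi : i ∈ Leg)
    (hij : G.Adj i j) (t : ℕ) :
    MeasurableSet {ω | ¬ (j ∈ Leg ↔ 0 ≤ trustSum α i j t ω)} := by
  have := measurableSet_le measurable_const (h.measurable_trustSum hi hij t) (f := fun _ => (0 : ℝ))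
  by_cases hj : j ∈ Leg
  · simp only [hj, true_iff]; exact this.compl
  · simp only [hj, false_iff, not_not]; exact this

theorem measurable_misclass (h : IsTrust P G Leg α EL EM) {i j : V} (hi : i ∈ Leg)
    (hij : G.Adj i j) (t : ℕ) : Measurable (misclass Leg α i j t) := by
  rw [funext (misclass_eq_indicator i j t)]
  exact measurable_const.indicator (h.measurableSet_misclass hi hij t)

end

variable [Fintype V] [DecidableRel G.Adj]

theorem measurableSet_mem_trustedNbrs (h : IsTrust P G Leg α EL EM) {i : V} (hi : i ∈ Leg) (j : V)
    (t : ℕ) : MeasurableSet {ω | j ∈ trustedNbrs G α i t ω} := by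
  by_cases hij : G.Adj i j
  · have := measurableSet_le measurable_const (h.measurable_trustSum hi hij t)
      (f := fun _ => (0 : ℝ))
    simpa [trustedNbrs, hij] using this
  · simp [trustedNbrs, hij]

variable [DecidableEq V]

theorem measurable_numMisclass (h : IsTrust P G Leg α EL EM) (t : ℕ) :
    Measurable (numMisclass G Leg α t) := by
  unfold numMisclass
  exact Finset.measurable_sum _ fun i hi => Finset.measurable_sum _ fun j hj =>
    h.measurable_misclass hi (by simpa using hj) t

theorem measurable_trustDegree (h : IsTrust P G Leg α EL EM) {i : V} (hi : i ∈ Leg) (t : ℕ) :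
    Measurable (trustDegree G α i t) := by
  have h1 : trustDegree G α i t = fun ω => (∑ j ∈ G.neighborFinset i,
      {ω | j ∈ trustedNbrs G α i t ω}.indicator (fun _ => (1 : ℝ)) ω) + 1 := by
    ext ω
    unfold trustDegree
    congr 1
    simp only [Set.indicator, Set.mem_ofPred_eq]
    rw [Finset.sum_boole]
    congr 2
    ext j; simp [trustedNbrs]
  rw [h1]
  exact (Finset.measurable_sum _ fun j _ =>
    measurable_const.indicator (h.measurableSet_mem_trustedNbrs hi j t)).add_const _

variable {b : V → V → ℕ → Ω → ℝ} {u : V → V → ℕ → Ω → Vec d} {T₀ : ℕ}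

theorem measurable_weight (h : IsTrust P G Leg α EL EM)
    (hb : ∀ i ∈ Leg, ∀ j ∉ Leg, G.Adj i j → ∀ t, Measurable (b i j t)) {i j : V} (hi : i ∈ Leg)
    (hij : G.Adj i j) (t : ℕ) : Measurable (weight G Leg α b T₀ i j t) := by
  have hrec : Measurable (receivedDegree G Leg α b i j t) := by
    unfold receivedDegree
    by_cases hj : j ∈ Leg
    · simpa [hj] using h.measurable_trustDegree hj t
    · simpa [hj] using hb i hi j hj hij t
  unfold weight
  refine Measurable.ite ?_ ?_ measurable_const
  · exact (MeasurableSet.const _).inter (h.measurableSet_mem_trustedNbrs hi j t)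
  · exact measurable_const.div
      (measurable_const.mul ((h.measurable_trustDegree hi t).max hrec))

theorem measurable_mixed (h : IsTrust P G Leg α EL EM)
    (hb : ∀ i ∈ Leg, ∀ j ∉ Leg, G.Adj i j → ∀ t, Measurable (b i j t))
    (hu : ∀ i ∈ Leg, ∀ j ∉ Leg, G.Adj i j → ∀ t, Measurable (u i j t)) {x : Ω → V → Vec d}
    (hx : ∀ i ∈ Leg, Measurable fun ω => x ω i) {i : V} (hi : i ∈ Leg) (t : ℕ) :
    Measurable fun ω => mixed G Leg α b u T₀ (x ω) t ω i := by
  have hw : ∀ j ∈ G.neighborFinset i, Measurable fun ω => weight G Leg α b T₀ i j t ω :=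
    fun j hj => h.measurable_weight hb hi (by simpa using hj) t
  unfold mixed selfWeight
  refine ((measurable_const.sub (Finset.measurable_fun_sum _ hw)).smul (hx i hi)).add
    (Finset.measurable_fun_sum _ fun j hj => (hw j hj).smul ?_)
  by_cases hj' : j ∈ Leg
  · simpa [hj'] using hx j hj'
  · simpa [hj'] using hu i hi j hj' (by simpa using hj) t

theorem measurable_iterate (h : IsTrust P G Leg α EL EM) {X : Set (Vec d)} {f : V → Vec d → ℝ}
    {μ η g : ℝ} {xstar : Vec d} (hp : IsProblem G Leg X f μ η g xstar)
    (hf : ∀ i ∈ Leg, Continuous (gradient (f i)))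
    (hb : ∀ i ∈ Leg, ∀ j ∉ Leg, G.Adj i j → ∀ t, Measurable (b i j t))
    (hu : ∀ i ∈ Leg, ∀ j ∉ Leg, G.Adj i j → ∀ t, Measurable (u i j t)) {γ : ℕ → ℝ}
    {x₀ : V → Vec d} (t : ℕ) :
    ∀ i ∈ Leg, Measurable fun ω => iterate G Leg X f α b u γ T₀ x₀ t ω i := by
  induction t with
  | zero => exact fun i _ => measurable_const
  | succ t ih =>
    intro i hi
    simp_rw [IsProblem.iterate_succ_eq]
    have hc := h.measurable_mixed (T₀ := T₀) hb hu ih hi t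
    have hg : Measurable fun ω => gradient (f i)
        (mixed G Leg α b u T₀ (iterate G Leg X f α b u γ T₀ x₀ t ω) t ω i) :=
      (hf i hi).measurable.comp hc
    exact (continuous_proj hp.closed hp.convex ⟨_, hp.star_mem⟩).measurable.comp
      (hc.sub (hg.const_smul (if T₀ ≤ t then γ (t - T₀) else 0)))

end Measurability

theorem iIndepFun_nbr (h : IsTrust P G Leg α EL EM) {i j : V} (hi : i ∈ Leg) (hij : G.Adj i j) :
    iIndepFun (fun k => α i j k) P := by
  have hinj : Function.Injective (fun k : ℕ =>
      (⟨(i, j, k), hi, hij⟩ : {p : V × V × ℕ // p.1 ∈ Leg ∧ G.Adj p.1 p.2.1})) := by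
    intro k l hkl
    simpa using hkl
  exact iIndepFun.precomp (g := fun k : ℕ =>
    (⟨(i, j, k), hi, hij⟩ : {p : V × V × ℕ // p.1 ∈ Leg ∧ G.Adj p.1 p.2.1})) hinj h.indep

/-- A centred variable ranging in a unit interval is sub-Gaussian with parameter `1/4`, and the
exponent is `(tE)² / (2t/4) = 2tE²`. -/
theorem hoeffding {X : ℕ → Ω → ℝ} (hX : iIndepFun X P) (t : ℕ) {E : ℝ} (hE : 0 ≤ E)
    (hsub : ∀ k < t, HasSubgaussianMGF (X k) ((‖(1 : ℝ) - 0‖₊ / 2) ^ 2) P) :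
    P.real {ω | t * E ≤ ∑ k ∈ Finset.range t, X k ω} ≤ Real.exp (-(2 * t * E ^ 2)) := by
  refine (HasSubgaussianMGF.measure_sum_range_ge_le_of_iIndepFun hX hsub (by positivity)).trans ?_
  refine Real.exp_le_exp.2 (le_of_eq ?_)
  rcases Nat.eq_zero_or_pos t with rfl | ht
  · simp
  · have : (t : ℝ) ≠ 0 := by positivity
    simp
    field_simp

variable [IsProbabilityMeasure P]

/-- The trust sum has mean `t * EL`, so a negative value is a downward deviation of at least `t *
EL`. The malicious case is its mirror image, with deviation `-(t * EM)`. -/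
theorem real_trustSum_neg_le (h : IsTrust P G Leg α EL EM) {i j : V} (hi : i ∈ Leg)
    (hij : G.Adj i j) (hj : j ∈ Leg) (t : ℕ) :
    P.real {ω | ¬ 0 ≤ trustSum α i j t ω} ≤ Real.exp (-(2 * t * EL ^ 2)) := by
  have hind := (h.iIndepFun_nbr hi hij).comp (fun _ x => -(x - (EL + 1 / 2)))
    fun _ => by fun_prop
  have := hoeffding hind t h.pos.le fun k _ => by
    have h1 := (hasSubgaussianMGF_of_mem_Icc (h.meas i hi j hij k).aemeasurable
      (h.mem i hi j hij k)).neg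
    have h2 : ∫ ω, α i j k ω ∂P = EL + 1 / 2 := by linarith [h.leg i hi j hj hij k]
    rw [h2] at h1
    exact h1
  refine le_trans (measureReal_mono fun ω hω => ?_) this
  simp only [Set.mem_ofPred_eq, not_le, trustSum, Function.comp_apply, Finset.sum_sub_distrib,
    Finset.sum_neg_distrib, Finset.sum_const, Finset.card_range, nsmul_eq_mul] at hω ⊢
  linarith

theorem real_trustSum_nonneg_le (h : IsTrust P G Leg α EL EM) {i j : V} (hi : i ∈ Leg)
    (hij : G.Adj i j) (hj : j ∉ Leg) (t : ℕ) :
    P.real {ω | 0 ≤ trustSum α i j t ω} ≤ Real.exp (-(2 * t * EM ^ 2)) := by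
  have hind := (h.iIndepFun_nbr hi hij).comp (fun _ x => x - (EM + 1 / 2))
    fun _ => by fun_prop
  have := hoeffding hind t (neg_nonneg.2 h.neg.le) fun k _ => by
    have h1 := (hasSubgaussianMGF_of_mem_Icc (h.meas i hi j hij k).aemeasurable
      (h.mem i hi j hij k))
    have h2 : ∫ ω, α i j k ω ∂P = EM + 1 / 2 := by linarith [h.mal i hi j hj hij k]
    rw [h2] at h1
    exact h1
  rw [neg_sq] at this
  refine le_trans (measureReal_mono fun ω hω => ?_) this
  simp only [Set.mem_ofPred_eq, trustSum, Function.comp_apply, Finset.sum_sub_distrib,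
    Finset.sum_const, Finset.card_range, nsmul_eq_mul] at hω ⊢
  linarith

variable [DecidableEq V]

theorem integral_misclass_le (h : IsTrust P G Leg α EL EM) {i j : V} (hi : i ∈ Leg)
    (hij : G.Adj i j) (t : ℕ) : ∫ ω, misclass Leg α i j t ω ∂P ≤
      if j ∈ Leg then Real.exp (-(2 * t * EL ^ 2)) else Real.exp (-(2 * t * EM ^ 2)) := by
  simp_rw [misclass_eq_indicator]
  rw [integral_indicator_const _ (h.measurableSet_misclass hi hij t), smul_eq_mul, mul_one]
  by_cases hj : j ∈ Leg
  · simp only [hj, true_iff, if_true]; exact h.real_trustSum_neg_le hi hij hj t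
  · simp only [hj, false_iff, not_not, if_false]; exact h.real_trustSum_nonneg_le hi hij hj t

theorem integrable_misclass (h : IsTrust P G Leg α EL EM) {i j : V} (hi : i ∈ Leg)
    (hij : G.Adj i j) (t : ℕ) : Integrable (misclass Leg α i j t) P :=
  Integrable.of_bound (h.measurable_misclass hi hij t).aestronglyMeasurable 1
    (ae_of_all _ fun ω => by
      rw [Real.norm_of_nonneg (misclass_nonneg Leg α i j t ω)]
      exact misclass_le_one Leg α i j t ω)

variable [Fintype V] [DecidableRel G.Adj]

theorem integrable_numMisclass (h : IsTrust P G Leg α EL EM) (t : ℕ) :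
    Integrable (numMisclass G Leg α t) P := by
  unfold numMisclass
  exact integrable_finsetSum _ fun i hi => integrable_finsetSum _ fun j hj =>
    h.integrable_misclass hi (by simpa using hj) t

theorem integrable_sqrt_numMisclass (h : IsTrust P G Leg α EL EM) (t : ℕ) :
    Integrable (fun ω => √(numMisclass G Leg α t ω)) P := by
  refine ((h.integrable_numMisclass t).add (integrable_const 1)).mono'
    (h.measurable_numMisclass t).sqrt.aestronglyMeasurable (ae_of_all _ fun ω => ?_)
  rw [Real.norm_of_nonneg (Real.sqrt_nonneg _)]
  have h0 := numMisclass_nonneg G Leg α t ω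
  refine Real.sqrt_le_iff.2 ⟨add_nonneg h0 zero_le_one, ?_⟩
  simp only [Pi.add_apply]
  linarith [sq_nonneg (numMisclass G Leg α t ω)]

theorem integral_numMisclass_le (h : IsTrust P G Leg α EL EM) (t : ℕ) :
    ∫ ω, numMisclass G Leg α t ω ∂P ≤ numLeg G Leg * Real.exp (-(2 * t * EL ^ 2)) +
      numMal G Leg * Real.exp (-(2 * t * EM ^ 2)) := by
  have hadj : ∀ {i j}, j ∈ G.neighborFinset i → G.Adj i j := fun hj => by simpa using hj
  unfold numMisclass
  rw [integral_finsetSum _ fun i hi => integrable_finsetSum _ fun j hj =>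
    h.integrable_misclass hi (hadj hj) t]
  unfold numLeg numMal
  rw [Finset.sum_mul, Finset.sum_mul, ← Finset.sum_add_distrib]
  refine Finset.sum_le_sum fun i hi => ?_
  rw [integral_finsetSum _ fun j hj => h.integrable_misclass hi (hadj hj) t]
  refine (Finset.sum_le_sum fun j hj => h.integral_misclass_le hi (hadj hj) t).trans ?_
  rw [Finset.sum_ite, Finset.sum_const, Finset.sum_const, Finset.filter_mem_eq_inter,
    ← Finset.sdiff_eq_filter, nsmul_eq_mul, nsmul_eq_mul]

/-- Jensen's inequality and subadditivity of the square root; the root halves the Hoeffding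
exponent. -/
theorem integral_sqrt_numMisclass_le (h : IsTrust P G Leg α EL EM) (t : ℕ) :
    ∫ ω, √(numMisclass G Leg α t ω) ∂P ≤ √(numLeg G Leg) * Real.exp (-(t * EL ^ 2)) +
      √(numMal G Leg) * Real.exp (-(t * EM ^ 2)) := by
  refine (sq_integral_sqrt_le (numMisclass_nonneg G Leg α t) (h.integrable_numMisclass t)
    (h.integrable_sqrt_numMisclass t)).trans ?_
  refine (Real.sqrt_le_sqrt (h.integral_numMisclass_le t)).trans ?_
  have key : ∀ D E : ℝ, √(D * Real.exp (-(2 * t * E ^ 2))) = √D * Real.exp (-(t * E ^ 2)) := by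
    intro D E
    have h1 : Real.exp (-(2 * t * E ^ 2)) = Real.exp (-(t * E ^ 2)) ^ 2 := by
      rw [← Real.exp_nat_mul]; congr 1; push_cast; ring
    rw [h1, Real.sqrt_mul' _ (sq_nonneg _), Real.sqrt_sq (Real.exp_pos _).le]
  rw [← key, ← key]
  have h0 : ∀ D E : ℝ, 0 ≤ D → 0 ≤ D * Real.exp (-(2 * t * E ^ 2)) := fun D E hD => by positivity
  exact sqrt_add_le (h0 _ _ (Finset.sum_nonneg fun _ _ => Nat.cast_nonneg _))
    (h0 _ _ (Finset.sum_nonneg fun _ _ => Nat.cast_nonneg _))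

/-- By Tonelli the expected total number of misclassifications is a finite geometric sum, so the
total is almost surely finite. -/
theorem ae_summable_numMisclass (h : IsTrust P G Leg α EL EM) :
    ∀ᵐ ω ∂P, Summable fun t => numMisclass G Leg α t ω := by
  have hgeo : ∀ E : ℝ, E ≠ 0 → Summable fun t : ℕ => Real.exp (-(2 * t * E ^ 2)) := by
    intro E hE
    have h1 : ∀ t : ℕ, Real.exp (-(2 * t * E ^ 2)) = Real.exp (-(2 * E ^ 2)) ^ t := by
      intro t; rw [← Real.exp_nat_mul]; congr 1; ring
    simp_rw [h1]
    refine summable_geometric_of_lt_one (Real.exp_pos _).le (Real.exp_lt_one_iff.2 ?_)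
    have := sq_pos_of_ne_zero hE
    linarith
  have hsum : Summable fun t => ∫ ω, numMisclass G Leg α t ω ∂P :=
    Summable.of_nonneg_of_le (fun t => integral_nonneg (numMisclass_nonneg G Leg α t))
      h.integral_numMisclass_le
      (((hgeo EL h.pos.ne').mul_left _).add ((hgeo EM h.neg.ne).mul_left _))
  have hfin : ∫⁻ ω, ∑' t, ENNReal.ofReal (numMisclass G Leg α t ω) ∂P ≠ ⊤ := by
    rw [lintegral_tsum fun t => (h.measurable_numMisclass t).ennreal_ofReal.aemeasurable]
    simp_rw [← ofReal_integral_eq_lintegral_ofReal (h.integrable_numMisclass _)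
      (ae_of_all _ (numMisclass_nonneg G Leg α _))]
    exact hsum.tsum_ofReal_ne_top
  filter_upwards [ae_lt_top' (AEMeasurable.tsum fun t =>
    (h.measurable_numMisclass t).ennreal_ofReal.aemeasurable) hfin] with ω hω
  have := ENNReal.summable_toReal hω.ne
  simpa [ENNReal.toReal_ofReal (numMisclass_nonneg G Leg α _ ω)] using this

end IsTrust

end Probability

/-! ### Comparison with the explicit constants -/

section ConstantBounds

variable {μ L η g ρ E D : ℝ}

theorem exp_neg_sq_lt_one (hE : E ≠ 0) : Real.exp (-E ^ 2) < 1 :=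
  Real.exp_lt_one_iff.2 (neg_neg_of_pos (sq_pos_of_ne_zero hE))

theorem exp_neg_two_mul_sq_lt_one (hE : E ≠ 0) : Real.exp (-(2 * E ^ 2)) < 1 :=
  Real.exp_lt_one_iff.2 (neg_neg_of_pos (mul_pos two_pos (sq_pos_of_ne_zero hE)))

theorem cOne_nonneg (hμ : 0 < μ) (hL : 0 ≤ L) (hη : 0 ≤ η) (hg : 0 ≤ g) (hρ : ρ < 1) (T₀ : ℕ) :
    0 ≤ cOne μ L η g ρ E D T₀ := by
  have hr : 0 < 1 - ρ := by linarith
  unfold cOne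
  positivity

theorem cTwo_nonneg (hμ : 0 < μ) (hL : 0 ≤ L) (hη : 0 ≤ η) (hg : 0 ≤ g) (hE : E ≠ 0)
    (hD : 0 ≤ D) (T₀ : ℕ) : 0 ≤ cTwo μ L η g E D T₀ := by
  have hr := sub_pos.2 (exp_neg_two_mul_sq_lt_one hE)
  unfold cTwo
  positivity

theorem cOne_antitone (hμ : 0 < μ) (hL : 0 ≤ L) (hη : 0 ≤ η) (hg : 0 ≤ g) (hρ : ρ < 1) :
    Antitone (cOne μ L η g ρ E D) := by
  intro S T hST
  have hr : 0 < 1 - ρ := by linarith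
  unfold cOne
  gcongr

theorem cTwo_antitone (hμ : 0 < μ) (hL : 0 ≤ L) (hη : 0 ≤ η) (hg : 0 ≤ g) (hE : E ≠ 0)
    (hD : 0 ≤ D) : Antitone (cTwo μ L η g E D) := by
  intro S T hST
  have hr := sub_pos.2 (exp_neg_two_mul_sq_lt_one hE)
  unfold cTwo
  gcongr

/-- The exponential in front supplies the decay; the one inside the bracket is only bounded by 1,
its value at delay zero. -/
theorem cOne_le_mul_exp (hμ : 0 < μ) (hL : 0 ≤ L) (hη : 0 ≤ η) (hg : 0 ≤ g) (hρ : ρ < 1)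
    {c : ℝ} (hc : c ≤ E ^ 2) (T₀ : ℕ) :
    cOne μ L η g ρ E D T₀ ≤ cOne μ L η g ρ E D 0 * Real.exp (-(c * T₀)) := by
  have hr : 0 < 1 - ρ := by linarith
  have h1 : Real.exp (-(T₀ * E ^ 2)) ≤ 1 := Real.exp_le_one_iff.2 (by
    have : 0 ≤ (T₀ : ℝ) * E ^ 2 := by positivity
    linarith)
  have h2 : Real.exp (-(T₀ * E ^ 2)) ≤ Real.exp (-(c * T₀)) := by
    rw [mul_comm c]; gcongr
  have h3 : cOne μ L η g ρ E D 0 * Real.exp (-(c * T₀)) =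
      16 * η * Real.exp (-(c * T₀)) * √D / (1 - ρ) *
    (g / (1 - Real.exp (-E ^ 2)) ^ 2
      + (g + (η + 4 / μ) * (μ + L)) / (1 - ρ) ^ 2
      + (μ + L) * (g + 2 * μ * √D * 1) / (μ * (1 - ρ) ^ 3)) := by
    simp only [cOne, Nat.cast_zero, zero_mul, neg_zero, Real.exp_zero]
    ring
  rw [h3]
  unfold cOne
  gcongr

theorem cTwo_le_mul_exp (hμ : 0 < μ) (hL : 0 ≤ L) (hη : 0 ≤ η) (hg : 0 ≤ g) (hE : E ≠ 0)
    (hD : 0 ≤ D) {c : ℝ} (hc : c ≤ E ^ 2) (T₀ : ℕ) :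
    cTwo μ L η g E D T₀ ≤ cTwo μ L η g E D 0 * Real.exp (-(c * T₀)) := by
  have hr := sub_pos.2 (exp_neg_two_mul_sq_lt_one hE)
  have h2 : Real.exp (-(2 * T₀ * E ^ 2)) ≤ Real.exp (-(c * T₀)) := by
    refine Real.exp_le_exp.2 (neg_le_neg ?_)
    have h3 : c * T₀ ≤ E ^ 2 * T₀ := by gcongr
    have h4 : 0 ≤ E ^ 2 * T₀ := by positivity
    linarith
  have h3 : cTwo μ L η g E D 0 * Real.exp (-(c * T₀)) =
      4 * η * (L + 1) * D * Real.exp (-(c * T₀)) / (1 - Real.exp (-(2 * E ^ 2))) *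
    (4 * η * Real.exp (-(2 * E ^ 2)) / (1 - Real.exp (-(2 * E ^ 2))) ^ 2
      + (6 * η + g / μ) * Real.exp (-(2 * E ^ 2)) / (1 - Real.exp (-(2 * E ^ 2)))
      + 4 * η + 4 * η * L / μ ^ 2 + g / μ) := by
    simp only [cTwo, Nat.cast_zero, mul_zero, zero_mul, neg_zero, Real.exp_zero]
    ring
  rw [h3]
  unfold cTwo
  gcongr

/-- The contribution of one kind of misclassification to the error bound. -/
theorem misclass_contribution_le (hμ : 0 < μ) (hL : 0 ≤ L) (hη : 0 ≤ η) (hg : 0 ≤ g) (hρ : ρ < 1)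
    (hE : E ≠ 0) (hD : 0 ≤ D) (T₀ T : ℕ) :
    ∑ τ ∈ Finset.range T, (8 * η ^ 2 * ((τ : ℝ) * (τ + 1)) *
        (D * Real.exp (-(2 * (T₀ + τ : ℕ) * E ^ 2))) +
      12 * g * η / μ * (((τ : ℝ) + 1) / (1 - ρ) + 1 / (1 - ρ) ^ 2) *
        (√D * Real.exp (-((T₀ + τ : ℕ) * E ^ 2)))) ≤
      2 / μ * cOne μ L η g ρ E D T₀ + cTwo μ L η g E D T₀ := by
  have hr : 0 < 1 - ρ := by linarith
  have hκ := sub_pos.2 (exp_neg_sq_lt_one hE)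
  have hκ2 := sub_pos.2 (exp_neg_two_mul_sq_lt_one hE)
  have e1 : ∀ τ : ℕ, Real.exp (-(2 * (T₀ + τ : ℕ) * E ^ 2)) =
      Real.exp (-(2 * T₀ * E ^ 2)) * Real.exp (-(2 * E ^ 2)) ^ τ := by
    intro τ
    rw [← Real.exp_nat_mul, ← Real.exp_add]; congr 1; push_cast; ring
  have e2 : ∀ τ : ℕ, Real.exp (-((T₀ + τ : ℕ) * E ^ 2)) =
      Real.exp (-(T₀ * E ^ 2)) * Real.exp (-E ^ 2) ^ τ := by
    intro τ
    rw [← Real.exp_nat_mul, ← Real.exp_add]; congr 1; push_cast; ring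
  have hS3 := sum_mul_add_one_mul_pow_le (Real.exp_pos (-(2 * E ^ 2))).le (sub_pos.1 hκ2) T
  have hS2 := sum_add_one_mul_pow_le (Real.exp_pos (-E ^ 2)).le (sub_pos.1 hκ) T
  have hS1 := sum_pow_le (Real.exp_pos (-E ^ 2)).le (sub_pos.1 hκ) T
  simp_rw [e1, e2]
  set r := Real.exp (-(2 * E ^ 2))
  set κ := Real.exp (-E ^ 2)
  set y := Real.exp (-(2 * T₀ * E ^ 2)) with hy
  set z := Real.exp (-(T₀ * E ^ 2)) with hz
  have hy0 : 0 < y := Real.exp_pos _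
  have hz0 : 0 < z := Real.exp_pos _
  have hr0 : 0 < r := Real.exp_pos _
  have hsplit : ∑ τ ∈ Finset.range T, (8 * η ^ 2 * ((τ : ℝ) * (τ + 1)) * (D * (y * r ^ τ)) +
      12 * g * η / μ * (((τ : ℝ) + 1) / (1 - ρ) + 1 / (1 - ρ) ^ 2) * (√D * (z * κ ^ τ))) =
      8 * η ^ 2 * D * y * ∑ τ ∈ Finset.range T, (τ : ℝ) * (τ + 1) * r ^ τ +
      12 * g * η / μ * (√D * z) * (1 / (1 - ρ) * ∑ τ ∈ Finset.range T, ((τ : ℝ) + 1) * κ ^ τ +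
        1 / (1 - ρ) ^ 2 * ∑ τ ∈ Finset.range T, κ ^ τ) := by
    rw [Finset.mul_sum, Finset.mul_sum (Finset.range T) _ (1 / (1 - ρ)),
      Finset.mul_sum (Finset.range T) _ (1 / (1 - ρ) ^ 2), ← Finset.sum_add_distrib,
      Finset.mul_sum, ← Finset.sum_add_distrib]
    refine Finset.sum_congr rfl fun τ _ => ?_
    ring
  rw [hsplit, add_comm (2 / μ * _)]
  refine add_le_add ?_ ?_
  -- The first summand of the bracket in `cTwo` already suffices. Zeros stand for the other terms,
  -- and for `L`, to permit a termwise comparison.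
  · have h1 : 8 * η ^ 2 * D * y * (2 * r / (1 - r) ^ 3) =
        4 * η * (0 + 1) * D * y / (1 - r) * (4 * η * r / (1 - r) ^ 2 + 0 + 0 + 0 + 0) := by
      field_simp; ring
    refine (mul_le_mul_of_nonneg_left hS3 (by positivity)).trans ?_
    rw [h1]
    unfold cTwo
    gcongr <;> positivity
  · have h1 : 1 / (1 - ρ) * ∑ τ ∈ Finset.range T, ((τ : ℝ) + 1) * κ ^ τ +
        1 / (1 - ρ) ^ 2 * ∑ τ ∈ Finset.range T, κ ^ τ ≤
        1 / (1 - ρ) * (1 / (1 - κ) ^ 2) + 1 / (1 - ρ) ^ 2 * (1 / (1 - κ)) := by gcongr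
    -- The mixed product is split by the arithmetic–geometric mean inequality, because `cOne` has
    -- only pure powers. The resulting coefficient 24 stays below the available 32.
    have h2 : 1 / (1 - ρ) * (1 / (1 - κ) ^ 2) + 1 / (1 - ρ) ^ 2 * (1 / (1 - κ)) ≤
        1 / (1 - ρ) * (2 * (1 / (1 - κ) ^ 2 + 1 / (1 - ρ) ^ 2)) := by
      have h3 := two_mul_le_add_sq (1 / (1 - κ)) (1 / (1 - ρ))
      have h4 : (0 : ℝ) ≤ (1 / (1 - κ)) ^ 2 := sq_nonneg _
      have h5 : (0 : ℝ) ≤ (1 / (1 - ρ)) ^ 2 := sq_nonneg _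
      have h6 : 0 ≤ 1 / (1 - ρ) := by positivity
      have h7 := mul_le_mul_of_nonneg_left (show (1 / (1 - κ)) ^ 2 + 1 / (1 - ρ) * (1 / (1 - κ)) ≤
        2 * ((1 / (1 - κ)) ^ 2 + (1 / (1 - ρ)) ^ 2) by linarith) h6
      simp only [div_pow, one_pow] at h7 ⊢
      refine le_trans (le_of_eq ?_) h7
      field_simp
    refine (mul_le_mul_of_nonneg_left (h1.trans h2) (by positivity)).trans ?_
    have h8 : 2 / μ * (16 * η * z * √D / (1 - ρ) * (g / (1 - κ) ^ 2 + (g + 0) / (1 - ρ) ^ 2 + 0)) =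
        32 * g * η / μ * (√D * z) * (1 / (1 - ρ) * (1 / (1 - κ) ^ 2 + 1 / (1 - ρ) ^ 2)) := by
      field_simp
      ring
    have h9 : 2 / μ * (16 * η * z * √D / (1 - ρ) *
        (g / (1 - κ) ^ 2 + (g + 0) / (1 - ρ) ^ 2 + 0)) ≤ 2 / μ * cOne μ L η g ρ E D T₀ := by
      unfold cOne
      gcongr <;> positivity
    refine le_trans ?_ h9
    rw [h8]
    have h10 : 0 ≤ g * η / μ * (√D * z) * (1 / (1 - ρ) * (1 / (1 - κ) ^ 2 + 1 / (1 - ρ) ^ 2)) := by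
      positivity
    have h11 : 12 * g * η / μ * (√D * z) *
        (1 / (1 - ρ) * (2 * (1 / (1 - κ) ^ 2 + 1 / (1 - ρ) ^ 2))) =
        24 * (g * η / μ * (√D * z) * (1 / (1 - ρ) * (1 / (1 - κ) ^ 2 + 1 / (1 - ρ) ^ 2))) := by
      ring
    have h12 : 32 * g * η / μ * (√D * z) *
        (1 / (1 - ρ) * (1 / (1 - κ) ^ 2 + 1 / (1 - ρ) ^ 2)) =
        32 * (g * η / μ * (√D * z) * (1 / (1 - ρ) * (1 / (1 - κ) ^ 2 + 1 / (1 - ρ) ^ 2))) := by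
      ring
    rw [h11, h12]
    linarith

/-- The error bound without misclassifications. -/
theorem nominal_contribution_le (hμ : 0 < μ) (hL : 0 ≤ L) (hη : 0 ≤ η) (hg : 0 ≤ g)
    (hρ0 : 0 ≤ ρ) (hρ : ρ < 1) {T : ℝ} (hT : 0 ≤ T) :
    4 * g ^ 2 * T / μ ^ 2 + 4 * g / μ * ((η + 2 * g / μ * T +
      (η + 2 * g / μ * (1 + Real.log ((T + 2) / 2))) / (1 - ρ)) / (1 - ρ)) ≤
      4 / μ * hBar μ L η g ρ T := by
  have hr : 0 < 1 - ρ := by linarith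
  have hlog : 0 ≤ Real.log ((T + 2) / 2) := Real.log_nonneg (by linarith)
  set l := Real.log ((T + 2) / 2)
  -- The left side is put in the shape of `hBar`, with zeros for `L` and for the unneeded last term.
  have h1 : 4 * g ^ 2 * T / μ ^ 2 + 4 * g / μ * ((η + 2 * g / μ * T +
      (η + 2 * g / μ * (1 + l)) / (1 - ρ)) / (1 - ρ)) =
      4 / μ * (g ^ 2 * T / μ + 2 * g ^ 2 * T / (μ * (1 - ρ)) +
        2 * (μ + 0) * g ^ 2 / (μ ^ 2 * (1 - ρ) ^ 2) * l + η * g / (1 - ρ) +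
        2 * (μ + 0) * g ^ 2 / (μ ^ 2 * (1 - ρ) ^ 2) + g * η * (μ + 0) / (μ * (1 - ρ) ^ 2) + 0) := by
    field_simp
    ring
  rw [h1]
  unfold hBar
  have hpow : (1 - ρ) ^ 3 ≤ (1 - ρ) ^ 2 :=
    pow_le_pow_of_le_one hr.le (by linarith) (by norm_num)
  gcongr
  · norm_num
  · linarith [mul_nonneg hη hg]
  · have : 0 ≤ μ * η := by positivity
    linarith
  · have : 0 ≤ g * η * (μ + L) := by positivity
    have : g * η * (μ + 0) ≤ g * η * (μ + L) := by gcongr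
    linarith [sq_nonneg g]
  · positivity

theorem exists_hBar_le (hμ : 0 < μ) (hL : 0 ≤ L) (hη : 0 ≤ η) (hg : 0 ≤ g) (hρ : ρ < 1) :
    ∃ K, 0 ≤ K ∧ ∀ T, 1 ≤ T → hBar μ L η g ρ T ≤ K * T := by
  have hr : 0 < 1 - ρ := by linarith
  refine ⟨g ^ 2 / μ + 2 * g ^ 2 / (μ * (1 - ρ)) + 8 * (μ + L) * g ^ 2 / (μ ^ 2 * (1 - ρ) ^ 2) +
    (2 * η * g / (1 - ρ) + 2 * (μ + L) * (μ * η + 2 * g) ^ 2 / (μ ^ 2 * (1 - ρ) ^ 2)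
    + (2 * g ^ 2 + 4 * g * η * (μ + L)) / (μ * (1 - ρ) ^ 3)
    + g ^ 2 * (μ + L) / (μ ^ 2 * (1 - ρ) ^ 4)), by positivity, fun T hT => ?_⟩
  have hlog : Real.log ((T + 2) / 2) ≤ T := by
    have := Real.log_le_sub_one_of_pos (x := (T + 2) / 2) (by linarith)
    linarith
  have h1 : 8 * (μ + L) * g ^ 2 / (μ ^ 2 * (1 - ρ) ^ 2) * Real.log ((T + 2) / 2) ≤
      8 * (μ + L) * g ^ 2 / (μ ^ 2 * (1 - ρ) ^ 2) * T := by gcongr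
  have h2 : (2 * η * g / (1 - ρ) + 2 * (μ + L) * (μ * η + 2 * g) ^ 2 / (μ ^ 2 * (1 - ρ) ^ 2)
    + (2 * g ^ 2 + 4 * g * η * (μ + L)) / (μ * (1 - ρ) ^ 3)
    + g ^ 2 * (μ + L) / (μ ^ 2 * (1 - ρ) ^ 4)) ≤
    (2 * η * g / (1 - ρ) + 2 * (μ + L) * (μ * η + 2 * g) ^ 2 / (μ ^ 2 * (1 - ρ) ^ 2)
    + (2 * g ^ 2 + 4 * g * η * (μ + L)) / (μ * (1 - ρ) ^ 3)
    + g ^ 2 * (μ + L) / (μ ^ 2 * (1 - ρ) ^ 4)) * T :=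
    le_mul_of_one_le_right (by positivity) hT
  have h3 : g ^ 2 * T / μ = g ^ 2 / μ * T := by ring
  have h4 : 2 * g ^ 2 * T / (μ * (1 - ρ)) = 2 * g ^ 2 / (μ * (1 - ρ)) * T := by ring
  unfold hBar
  rw [h3, h4]
  linarith

end ConstantBounds

/-! ### Sign, monotonicity and decay of the total constant -/

section Constant

variable {V : Type*} [Fintype V] [DecidableEq V] {d : ℕ} {G : SimpleGraph V} [DecidableRel G.Adj]
  {Leg : Finset V} {μ L η g ρ EL EM DL DM : ℝ}

theorem numLeg_nonneg (G : SimpleGraph V) [DecidableRel G.Adj] (Leg : Finset V) :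
    0 ≤ numLeg G Leg :=
  Finset.sum_nonneg fun _ _ => Nat.cast_nonneg _

theorem numMal_nonneg (G : SimpleGraph V) [DecidableRel G.Adj] (Leg : Finset V) :
    0 ≤ numMal G Leg :=
  Finset.sum_nonneg fun _ _ => Nat.cast_nonneg _

theorem cMal_nonneg (hμ : 0 < μ) (hL : 0 ≤ L) (hη : 0 ≤ η) (hg : 0 ≤ g) (hρ : ρ < 1)
    (hEL : EL ≠ 0) (hEM : EM ≠ 0) (hDL : 0 ≤ DL) (hDM : 0 ≤ DM) (T₀ : ℕ) :
    0 ≤ cMal μ L η g ρ EL EM DL DM T₀ := by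
  have h1 := cOne_nonneg (E := EL) (D := DL) hμ hL hη hg hρ T₀
  have h2 := cOne_nonneg (E := EM) (D := DM) hμ hL hη hg hρ T₀
  have h3 := cTwo_nonneg hμ hL hη hg hEL hDL T₀
  have h4 := cTwo_nonneg hμ hL hη hg hEM hDM T₀
  unfold cMal
  positivity

theorem cMal_antitone (hμ : 0 < μ) (hL : 0 ≤ L) (hη : 0 ≤ η) (hg : 0 ≤ g) (hρ : ρ < 1)
    (hEL : EL ≠ 0) (hEM : EM ≠ 0) (hDL : 0 ≤ DL) (hDM : 0 ≤ DM) :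
    Antitone (cMal μ L η g ρ EL EM DL DM) := by
  intro S T hST
  have h1 := cOne_antitone (E := EL) (D := DL) hμ hL hη hg hρ hST
  have h2 := cOne_antitone (E := EM) (D := DM) hμ hL hη hg hρ hST
  have h3 := cTwo_antitone hμ hL hη hg hEL hDL hST
  have h4 := cTwo_antitone hμ hL hη hg hEM hDM hST
  unfold cMal
  gcongr

theorem cMal_le_mul_exp (hμ : 0 < μ) (hL : 0 ≤ L) (hη : 0 ≤ η) (hg : 0 ≤ g) (hρ : ρ < 1)
    (hEL : EL ≠ 0) (hEM : EM ≠ 0) (hDL : 0 ≤ DL) (hDM : 0 ≤ DM) (T₀ : ℕ) :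
    cMal μ L η g ρ EL EM DL DM T₀ ≤
      cMal μ L η g ρ EL EM DL DM 0 * Real.exp (-(min (EL ^ 2) (EM ^ 2) * T₀)) := by
  have h1 := cOne_le_mul_exp (D := DL) hμ hL hη hg hρ (min_le_left (EL ^ 2) (EM ^ 2)) T₀
  have h2 := cOne_le_mul_exp (D := DM) hμ hL hη hg hρ (min_le_right (EL ^ 2) (EM ^ 2)) T₀
  have h3 := cTwo_le_mul_exp hμ hL hη hg hEL hDL (min_le_left (EL ^ 2) (EM ^ 2)) T₀
  have h4 := cTwo_le_mul_exp hμ hL hη hg hEM hDM (min_le_right (EL ^ 2) (EM ^ 2)) T₀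
  have h5 := mul_le_mul_of_nonneg_left (add_le_add h3 h4) hμ.le
  unfold cMal
  linarith

end Constant

/-! ### From the pathwise bounds to the theorem -/

section Main

variable {V : Type*} [Fintype V] [DecidableEq V] {Ω : Type*} {d : ℕ} {G : SimpleGraph V}
  [DecidableRel G.Adj] {Leg : Finset V} {α : V → V → ℕ → Ω → ℝ} {X : Set (Vec d)}
  {f : V → Vec d → ℝ} {μ η g : ℝ} {xstar : Vec d} {b : V → V → ℕ → Ω → ℝ}
  {u : V → V → ℕ → Ω → Vec d} {γ : ℕ → ℝ} {T₀ : ℕ} {x₀ : V → Vec d}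

namespace IsProblem

/-- The pathwise error bound for step sizes `2 / (μ (t + 2))`. -/
theorem mul_error_le (h : IsProblem G Leg X f μ η g xstar)
    (hu : ∀ i ∈ Leg, ∀ j ∉ Leg, G.Adj i j → ∀ t ω, u i j t ω ∈ X)
    (hx₀ : ∀ i ∈ Leg, x₀ i ∈ X) (ω : Ω) (T : ℕ) :
    (T : ℝ) * (T + 1) * (1 / (Leg.card : ℝ) * ∑ i ∈ Leg, ‖iterate G Leg X f α b u
      (fun t => 2 / (μ * ((t : ℝ) + 2))) T₀ x₀ (T₀ + T) ω i - xstar‖ ^ 2) ≤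
    (4 * g ^ 2 * T / μ ^ 2 + 4 * g / μ * ((η + 2 * g / μ * T +
      (η + 2 * g / μ * (1 + Real.log (((T : ℝ) + 2) / 2))) / (1 - rhoLeg G Leg)) /
        (1 - rhoLeg G Leg))) +
    ∑ τ ∈ Finset.range T, (8 * η ^ 2 * ((τ : ℝ) * (τ + 1)) * numMisclass G Leg α (T₀ + τ) ω +
      12 * g * η / μ * (((τ : ℝ) + 1) / (1 - rhoLeg G Leg) + 1 / (1 - rhoLeg G Leg) ^ 2) *
        √(numMisclass G Leg α (T₀ + τ) ω)) := by
  have hμ := h.mu_pos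
  have hr : 0 < 1 - rhoLeg G Leg := by linarith [h.rhoLeg_lt_one]
  set a : ℕ → ℝ := fun τ => 1 / (Leg.card : ℝ) * ∑ i ∈ Leg, ‖iterate G Leg X f α b u
    (fun t => 2 / (μ * ((t : ℝ) + 2))) T₀ x₀ (T₀ + τ) ω i - xstar‖ ^ 2 with ha
  set m : ℕ → ℝ := fun τ => numMisclass G Leg α (T₀ + τ) ω with hm
  obtain ⟨s, hs, hs0, hs1, ha1⟩ := h.exists_recursion hu hx₀
    (fun t => by positivity) ω a m (fun _ => rfl) fun _ => rfl
  -- Here `γ τ * μ = 2/(τ+2) ≤ 1` from the first step on, so no initial segment is lost.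
  have h1 := mul_le_of_step (a := a) (s := s) (m := m) (g := g) (η := η) hμ (fun τ => ha1 τ (by
    rw [div_mul_eq_mul_div, mul_comm 2 μ, div_le_one (by positivity)]
    gcongr
    linarith [Nat.cast_nonneg (α := ℝ) τ])) T
  have h2 := sum_add_one_mul_le (q := fun τ => √(m τ)) hμ h.g_nonneg h.eta_nonneg
    h.rhoLeg_nonneg h.rhoLeg_lt_one hs hs0 hs1 T
  have hg : 0 ≤ 4 * g / μ := div_nonneg (by linarith [h.g_nonneg]) hμ.le
  have h3 := mul_le_mul_of_nonneg_left h2 hg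
  refine (h1.trans (add_le_add_right h3 _)).trans (le_of_eq ?_)
  have h4 : ∑ τ ∈ Finset.range T, (8 * η ^ 2 * ((τ : ℝ) * (τ + 1)) * m τ +
      12 * g * η / μ * (((τ : ℝ) + 1) / (1 - rhoLeg G Leg) + 1 / (1 - rhoLeg G Leg) ^ 2) *
        √(m τ)) = 8 * η ^ 2 * ∑ τ ∈ Finset.range T, (τ : ℝ) * (τ + 1) * m τ +
      12 * g * η / μ * (1 / (1 - rhoLeg G Leg) * ∑ τ ∈ Finset.range T, ((τ : ℝ) + 1) * √(m τ) +
        1 / (1 - rhoLeg G Leg) ^ 2 * ∑ τ ∈ Finset.range T, √(m τ)) := by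
    rw [Finset.mul_sum, Finset.mul_sum (Finset.range T) _ (1 / (1 - rhoLeg G Leg)),
      Finset.mul_sum (Finset.range T) _ (1 / (1 - rhoLeg G Leg) ^ 2), ← Finset.sum_add_distrib,
      Finset.mul_sum, ← Finset.sum_add_distrib]
    refine Finset.sum_congr rfl fun τ _ => ?_
    ring
  rw [h4]
  field_simp
  ring

variable [MeasurableSpace Ω] {P : Measure Ω} [IsProbabilityMeasure P] {EL EM : ℝ}

theorem integrable_error (h : IsProblem G Leg X f μ η g xstar) (ht : IsTrust P G Leg α EL EM)
    (hf : ∀ i ∈ Leg, Continuous (gradient (f i)))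
    (hb : ∀ i ∈ Leg, ∀ j ∉ Leg, G.Adj i j → ∀ t, Measurable (b i j t))
    (hum : ∀ i ∈ Leg, ∀ j ∉ Leg, G.Adj i j → ∀ t, Measurable (u i j t))
    (hx₀ : ∀ i ∈ Leg, x₀ i ∈ X) {i : V} (hi : i ∈ Leg) (t : ℕ) :
    Integrable (fun ω => ‖iterate G Leg X f α b u γ T₀ x₀ t ω i - xstar‖ ^ 2) P := by
  refine Integrable.of_bound (((ht.measurable_iterate h hf hb hum t i hi).sub_const
    xstar).norm.pow_const 2).aestronglyMeasurable (4 * η ^ 2) (ae_of_all _ fun ω => ?_)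
  rw [Real.norm_of_nonneg (sq_nonneg _)]
  exact h.norm_sub_star_sq_le (h.iterate_mem hx₀ t ω i hi)

theorem ae_tendsto_error (h : IsProblem G Leg X f μ η g xstar) (ht : IsTrust P G Leg α EL EM)
    (hu : ∀ i ∈ Leg, ∀ j ∉ Leg, G.Adj i j → ∀ t ω, u i j t ω ∈ X)
    (hx₀ : ∀ i ∈ Leg, x₀ i ∈ X) (hγ0 : ∀ t, 0 ≤ γ t)
    (hγ : Tendsto (fun n => ∑ t ∈ Finset.range n, γ t) atTop atTop)
    (hγ2 : Summable fun t => γ t ^ 2) {i : V} (hi : i ∈ Leg) :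
    ∀ᵐ ω ∂P, Tendsto (fun t => ‖iterate G Leg X f α b u γ T₀ x₀ t ω i - xstar‖ ^ 2) atTop
      (𝓝 0) := by
  filter_upwards [ht.ae_summable_numMisclass] with ω hω
  have hn := h.card_pos
  set a : ℕ → ℝ := fun τ => 1 / (Leg.card : ℝ) *
    ∑ i ∈ Leg, ‖iterate G Leg X f α b u γ T₀ x₀ (T₀ + τ) ω i - xstar‖ ^ 2 with ha
  obtain ⟨s, hs0, _, hs1, ha1⟩ := h.exists_recursion hu hx₀ hγ0 ω a
    (fun τ => numMisclass G Leg α (T₀ + τ) ω) (fun _ => rfl) fun _ => rfl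
  have hsum : Summable fun τ => numMisclass G Leg α (T₀ + τ) ω := by
    simpa [add_comm] using (summable_nat_add_iff T₀).2 hω
  have hlim := tendsto_zero_of_recursion h.mu_pos h.g_nonneg h.rhoLeg_nonneg h.rhoLeg_lt_one
    (fun τ => by positivity) hs0 (fun τ => numMisclass_nonneg _ _ _ _ _) hsum hγ0 hγ hγ2 ha1 hs1
  rw [← tendsto_add_atTop_iff_nat T₀]
  have hlim2 := hlim.const_mul (Leg.card : ℝ)
  rw [mul_zero] at hlim2
  refine squeeze_zero (fun τ => sq_nonneg _) (fun τ => ?_) hlim2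
  rw [ha]
  simp only
  rw [← mul_assoc, mul_one_div_cancel hn.ne', one_mul, add_comm τ]
  exact Finset.single_le_sum (f := fun i =>
    ‖iterate G Leg X f α b u γ T₀ x₀ (T₀ + τ) ω i - xstar‖ ^ 2) (fun _ _ => sq_nonneg _) hi

theorem tendsto_integral_error (h : IsProblem G Leg X f μ η g xstar)
    (ht : IsTrust P G Leg α EL EM) (hf : ∀ i ∈ Leg, Continuous (gradient (f i)))
    (hb : ∀ i ∈ Leg, ∀ j ∉ Leg, G.Adj i j → ∀ t, Measurable (b i j t))
    (hum : ∀ i ∈ Leg, ∀ j ∉ Leg, G.Adj i j → ∀ t, Measurable (u i j t))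
    (hu : ∀ i ∈ Leg, ∀ j ∉ Leg, G.Adj i j → ∀ t ω, u i j t ω ∈ X)
    (hx₀ : ∀ i ∈ Leg, x₀ i ∈ X) (hγ0 : ∀ t, 0 ≤ γ t)
    (hγ : Tendsto (fun n => ∑ t ∈ Finset.range n, γ t) atTop atTop)
    (hγ2 : Summable fun t => γ t ^ 2) {i : V} (hi : i ∈ Leg) :
    Tendsto (fun t => ∫ ω, ‖iterate G Leg X f α b u γ T₀ x₀ t ω i - xstar‖ ^ 2 ∂P) atTop
      (𝓝 0) := by
  have := tendsto_integral_of_dominated_convergence (fun _ => 4 * η ^ 2)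
    (fun t => (h.integrable_error (γ := γ) (T₀ := T₀) ht hf hb hum hx₀ hi t).aestronglyMeasurable)
    (integrable_const _)
    (fun t => ae_of_all _ fun ω => by
      rw [Real.norm_of_nonneg (sq_nonneg _)]
      exact h.norm_sub_star_sq_le (h.iterate_mem hx₀ t ω i hi))
    (h.ae_tendsto_error ht hu hx₀ hγ0 hγ hγ2 hi)
  simpa using this

theorem integral_error_le (h : IsProblem G Leg X f μ η g xstar)
    (ht : IsTrust P G Leg α EL EM) (hf : ∀ i ∈ Leg, Continuous (gradient (f i)))
    (hb : ∀ i ∈ Leg, ∀ j ∉ Leg, G.Adj i j → ∀ t, Measurable (b i j t))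
    (hum : ∀ i ∈ Leg, ∀ j ∉ Leg, G.Adj i j → ∀ t, Measurable (u i j t))
    (hx₀ : ∀ i ∈ Leg, x₀ i ∈ X) (t : ℕ) :
    (1 / (Leg.card : ℝ)) * ∑ i ∈ Leg, ∫ ω,
      ‖iterate G Leg X f α b u γ T₀ x₀ t ω i - xstar‖ ^ 2 ∂P ≤ 4 * η ^ 2 := by
  have hn := h.card_pos
  have h1 : ∀ i ∈ Leg, ∫ ω, ‖iterate G Leg X f α b u γ T₀ x₀ t ω i - xstar‖ ^ 2 ∂P ≤
      4 * η ^ 2 := by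
    intro i hi
    refine (integral_mono (h.integrable_error ht hf hb hum hx₀ hi t) (integrable_const _)
      fun ω => h.norm_sub_star_sq_le (h.iterate_mem hx₀ t ω i hi)).trans ?_
    simp
  refine (mul_le_mul_of_nonneg_left (Finset.sum_le_sum h1) (by positivity)).trans (le_of_eq ?_)
  rw [Finset.sum_const, nsmul_eq_mul]
  field_simp

/-- The pathwise bound is linear in `m` and `√m`, whose expectations split into a legitimate and a
malicious part; each part is absorbed by its own pair of constants. -/
theorem mul_integral_error_le (h : IsProblem G Leg X f μ η g xstar)
    (ht : IsTrust P G Leg α EL EM) (hf : ∀ i ∈ Leg, Continuous (gradient (f i)))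
    (hb : ∀ i ∈ Leg, ∀ j ∉ Leg, G.Adj i j → ∀ t, Measurable (b i j t))
    (hum : ∀ i ∈ Leg, ∀ j ∉ Leg, G.Adj i j → ∀ t, Measurable (u i j t))
    (hu : ∀ i ∈ Leg, ∀ j ∉ Leg, G.Adj i j → ∀ t ω, u i j t ω ∈ X)
    (hx₀ : ∀ i ∈ Leg, x₀ i ∈ X) {L : ℝ} (hL : 0 ≤ L) (T : ℕ) :
    (T : ℝ) * (T + 1) * (1 / (Leg.card : ℝ) * ∑ i ∈ Leg, ∫ ω, ‖iterate G Leg X f α b u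
      (fun t => 2 / (μ * ((t : ℝ) + 2))) T₀ x₀ (T₀ + T) ω i - xstar‖ ^ 2 ∂P) ≤
    (4 * hBar μ L η g (rhoLeg G Leg) T +
      cMal μ L η g (rhoLeg G Leg) EL EM (numLeg G Leg) (numMal G Leg) T₀) / μ := by
  have hμ := h.mu_pos
  have hη := h.eta_nonneg
  have hg := h.g_nonneg
  have hρ := h.rhoLeg_lt_one
  have hr : 0 < 1 - rhoLeg G Leg := by linarith
  have hI : ∀ i ∈ Leg, Integrable (fun ω => ‖iterate G Leg X f α b u
      (fun t => 2 / (μ * ((t : ℝ) + 2))) T₀ x₀ (T₀ + T) ω i - xstar‖ ^ 2) P :=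
    fun i hi => h.integrable_error ht hf hb hum hx₀ hi _
  have hJ : ∀ τ ∈ Finset.range T, Integrable (fun ω => 8 * η ^ 2 * ((τ : ℝ) * (τ + 1)) *
      numMisclass G Leg α (T₀ + τ) ω + 12 * g * η / μ *
      (((τ : ℝ) + 1) / (1 - rhoLeg G Leg) + 1 / (1 - rhoLeg G Leg) ^ 2) *
        √(numMisclass G Leg α (T₀ + τ) ω)) P := fun τ _ =>
    ((ht.integrable_numMisclass _).const_mul _).add ((ht.integrable_sqrt_numMisclass _).const_mul _)
  have h1 := integral_mono (((integrable_finsetSum _ hI).const_mul (1 / (Leg.card : ℝ))).const_mul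
    ((T : ℝ) * (T + 1))) ((integrable_const _).add (integrable_finsetSum _ hJ))
    fun ω => h.mul_error_le (α := α) (b := b) (T₀ := T₀) hu hx₀ ω T
  simp only [Pi.add_apply] at h1
  rw [integral_const_mul, integral_const_mul, integral_finsetSum _ hI,
    integral_add (integrable_const _) (integrable_finsetSum _ hJ), integral_finsetSum _ hJ,
    integral_const, probReal_univ, one_smul] at h1
  refine h1.trans ?_
  have h2 := nominal_contribution_le hμ hL hη hg h.rhoLeg_nonneg hρ (Nat.cast_nonneg (α := ℝ) T)
  have h3 := misclass_contribution_le hμ hL hη hg hρ ht.pos.ne' (numLeg_nonneg G Leg) T₀ T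
  have h4 := misclass_contribution_le hμ hL hη hg hρ ht.neg.ne (numMal_nonneg G Leg) T₀ T
  have h6 := add_le_add h3 h4
  rw [← Finset.sum_add_distrib] at h6
  refine (add_le_add h2 ((Finset.sum_le_sum fun τ _ => ?_).trans h6)).trans (le_of_eq ?_)
  · rw [integral_add ((ht.integrable_numMisclass _).const_mul _)
      ((ht.integrable_sqrt_numMisclass _).const_mul _), integral_const_mul, integral_const_mul]
    refine (add_le_add
      (mul_le_mul_of_nonneg_left (ht.integral_numMisclass_le (T₀ + τ)) (by positivity))
      (mul_le_mul_of_nonneg_left (ht.integral_sqrt_numMisclass_le (T₀ + τ))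
        (by positivity))).trans (le_of_eq ?_)
    rw [mul_add (8 * η ^ 2 * _), mul_add (12 * g * η / μ * _), add_add_add_comm]
  · unfold cMal
    field_simp
    ring

end IsProblem

/-- A quantity with the error bound of the algorithm is of order `1 / T`. -/
theorem isBigO_of_le {e : ℕ → ℝ} {h : ℝ → ℝ} {C K μ : ℝ} {T₀ : ℕ} (hμ : 0 < μ) (hC : 0 ≤ C)
    (hK : 0 ≤ K) (he0 : ∀ T, 0 ≤ e T) (hh : ∀ T, 1 ≤ T → h T ≤ K * T)
    (he : ∀ T : ℕ, T₀ < T → e T ≤ (4 * h ((T : ℝ) - T₀) + C) /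
      (μ * ((T : ℝ) - T₀) * ((T : ℝ) - T₀ + 1))) :
    e =O[atTop] (fun T : ℕ => 1 / (T : ℝ)) := by
  refine IsBigO.of_bound (2 * (4 * K + C) / μ) ?_
  -- Beyond this time `T - T₀` is at least 1 and at least `T / 2`.
  filter_upwards [eventually_ge_atTop (2 * T₀ + 1)] with T hT
  have hT1 : (2 * T₀ + 1 : ℝ) ≤ T := by exact_mod_cast hT
  have hT00 : (0 : ℝ) ≤ T₀ := Nat.cast_nonneg _
  have hTp : (0 : ℝ) < T := by linarith
  set τ : ℝ := (T : ℝ) - T₀ with hτ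
  have hτ1 : 1 ≤ τ := by linarith
  have hτ2 : (T : ℝ) ≤ 2 * τ := by linarith
  rw [Real.norm_of_nonneg (he0 T), Real.norm_of_nonneg (by positivity)]
  refine (he T (by omega)).trans ?_
  rw [mul_one_div, div_div, div_le_div_iff₀ (by positivity) (by positivity)]
  have h1 : 4 * h τ + C ≤ (4 * K + C) * τ := by
    have := hh τ hτ1
    have := le_mul_of_one_le_right hC hτ1
    linarith
  have hKC : 0 ≤ 4 * K + C := by positivity
  calc (4 * h τ + C) * (μ * T) ≤ ((4 * K + C) * τ) * (μ * (2 * τ)) := by gcongr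
    _ = 2 * (4 * K + C) * (μ * τ * τ) := by ring
    _ ≤ 2 * (4 * K + C) * (μ * τ * (τ + 1)) := by gcongr; linarith

end Main

end ResilientOpt

theorem mainTheorem3
    {V : Type*} [Fintype V] [DecidableEq V]
    {Ω : Type*} [MeasurableSpace Ω] (P : Measure Ω) [IsProbabilityMeasure P] {d : ℕ}
    -- the communication graph, and the legitimate agents, which induce a connected subgraph
    (G : SimpleGraph V) [DecidableRel G.Adj] (Leg : Finset V)
    (hconn : (G.induce (Leg : Set V)).Connected)
    -- the trust observations
    (α : V → V → ℕ → Ω → ℝ)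
    (hα_meas : ∀ i ∈ Leg, ∀ j, G.Adj i j → ∀ t, Measurable (α i j t))
    (hα_mem : ∀ i ∈ Leg, ∀ j, G.Adj i j → ∀ t, ∀ᵐ ω ∂P, α i j t ω ∈ Set.Icc (0 : ℝ) 1)
    (EL EM : ℝ) (hEL : 0 < EL) (hEM : EM < 0)
    (hα_leg : ∀ i ∈ Leg, ∀ j ∈ Leg, G.Adj i j → ∀ t, (∫ ω, α i j t ω ∂P) - 1 / 2 = EL)
    (hα_mal : ∀ i ∈ Leg, ∀ j ∉ Leg, G.Adj i j → ∀ t, (∫ ω, α i j t ω ∂P) - 1 / 2 = EM)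
    (hα_indep : iIndepFun
      (fun (p : {p : V × V × ℕ // p.1 ∈ Leg ∧ G.Adj p.1 p.2.1}) =>
        α p.1.1 p.1.2.1 p.1.2.2) P)
    (hα_ident : ∀ i ∈ Leg, ∀ j, G.Adj i j → ∀ t, IdentDistrib (α i j t) (α i j 0) P P)
    -- the constraint set
    (X : Set (ResilientOpt.Vec d)) (hX_compact : IsCompact X) (hX_convex : Convex ℝ X)
    (η : ℝ) (hη : 0 < η) (hXη : ∀ x ∈ X, ‖x‖ ≤ η)
    -- the objective functions
    (f : V → ResilientOpt.Vec d → ℝ) (μ L : ℝ) (hμ : 0 < μ) (hL : 0 ≤ L)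
    (hf_diff : ∀ i ∈ Leg, Differentiable ℝ (f i))
    (hf_convex : ∀ i ∈ Leg, StrongConvexOn Set.univ μ (f i))
    (hf_lip : ∀ i ∈ Leg, ∀ x y, ‖gradient (f i) x - gradient (f i) y‖ ≤ L * ‖x - y‖)
    (g : ℝ) (hg : ∀ i ∈ Leg, ∀ x ∈ X, ‖gradient (f i) x‖ ≤ g)
    -- the optimal point
    (xstar : ResilientOpt.Vec d) (hxstar_mem : xstar ∈ X)
    (hxstar_min : IsMinOn (ResilientOpt.legObjective Leg f) X xstar) :
    let C : ℕ → ℝ := ResilientOpt.cMal μ L η g (ResilientOpt.rhoLeg G Leg) EL EM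
      (ResilientOpt.numLeg G Leg) (ResilientOpt.numMal G Leg)
    -- the constant decreases exponentially
    (Antitone C ∧ ∃ K > 0, ∃ c > 0, ∀ T₀ : ℕ, 0 ≤ C T₀ ∧ C T₀ ≤ K * Real.exp (-(c * T₀))) ∧
    -- for every delay, initial points, and behavior of the malicious agents:
    ∀ (T₀ : ℕ) (x₀ : V → ResilientOpt.Vec d) (_ : ∀ i ∈ Leg, x₀ i ∈ X)
      (b : V → V → ℕ → Ω → ℝ)
      (_ : ∀ i ∈ Leg, ∀ j ∉ Leg, G.Adj i j → ∀ t, Measurable (b i j t))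
      (u : V → V → ℕ → Ω → ResilientOpt.Vec d)
      (_ : ∀ i ∈ Leg, ∀ j ∉ Leg, G.Adj i j → ∀ t, Measurable (u i j t))
      (_ : ∀ i ∈ Leg, ∀ j ∉ Leg, G.Adj i j → ∀ t ω, u i j t ω ∈ X),
      -- convergence in mean square
      (∀ γ : ℕ → ℝ, (∀ t, 0 ≤ γ t) →
        Tendsto (fun n => ∑ t ∈ Finset.range n, γ t) atTop atTop →
        Summable (fun t => γ t ^ 2) →
        ∀ i ∈ Leg,
          (∀ t, Integrable (fun ω =>
            ‖ResilientOpt.iterate G Leg X f α b u γ T₀ x₀ t ω i - xstar‖ ^ 2) P) ∧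
          Tendsto (fun t => ∫ ω,
            ‖ResilientOpt.iterate G Leg X f α b u γ T₀ x₀ t ω i - xstar‖ ^ 2 ∂P)
            atTop (𝓝 0)) ∧
      -- the rate for the step sizes `2 / (μ (t + 2))`
      (let γ : ℕ → ℝ := fun t => 2 / (μ * ((t : ℝ) + 2))
       let err : ℕ → ℝ := fun T => (1 / (Leg.card : ℝ)) * ∑ i ∈ Leg, ∫ ω,
          ‖ResilientOpt.iterate G Leg X f α b u γ T₀ x₀ T ω i - xstar‖ ^ 2 ∂P
       (∀ T, T₀ ≤ T → err T ≤ 4 * η ^ 2) ∧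
       (∀ T, T₀ < T → err T ≤ min (4 * η ^ 2)
          ((4 * ResilientOpt.hBar μ L η g (ResilientOpt.rhoLeg G Leg) ((T : ℝ) - T₀) + C T₀) /
            (μ * ((T : ℝ) - T₀) * ((T : ℝ) - T₀ + 1)))) ∧
       err =O[atTop] (fun T : ℕ => 1 / (T : ℝ))) := by
  have hp : ResilientOpt.IsProblem G Leg X f μ η g xstar :=
    ⟨hconn, hX_compact.isClosed, hX_convex, hXη, hμ, hf_diff, hf_convex, hg, hxstar_mem,
      hxstar_min⟩
  have ht : ResilientOpt.IsTrust P G Leg α EL EM :=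
    ⟨hα_meas, hα_mem, hEL, hEM, hα_leg, hα_mal, hα_indep⟩
  have hg0 := hp.g_nonneg
  have hρ := hp.rhoLeg_lt_one
  have hDL := ResilientOpt.numLeg_nonneg G Leg
  have hDM := ResilientOpt.numMal_nonneg G Leg
  -- Continuity of the gradients makes the iterates measurable.
  have hgrad : ∀ i ∈ Leg, Continuous (gradient (f i)) := fun i hi =>
    (LipschitzWith.of_dist_le_mul (K := ⟨L, hL⟩) fun x y => by
      rw [dist_eq_norm, dist_eq_norm]; exact hf_lip i hi x y).continuous
  intro C
  have hC0 : ∀ T₀, 0 ≤ C T₀ :=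
    ResilientOpt.cMal_nonneg hμ hL hη.le hg0 hρ hEL.ne' hEM.ne hDL hDM
  refine ⟨⟨ResilientOpt.cMal_antitone hμ hL hη.le hg0 hρ hEL.ne' hEM.ne hDL hDM,
    -- The added 1 keeps the factor strictly positive even when `C 0 = 0`.
    C 0 + 1, by linarith [hC0 0], min (EL ^ 2) (EM ^ 2),
    lt_min (sq_pos_of_pos hEL) (sq_pos_of_neg hEM), fun T₀ => ⟨hC0 T₀, ?_⟩⟩, ?_⟩
  · refine (ResilientOpt.cMal_le_mul_exp hμ hL hη.le hg0 hρ hEL.ne' hEM.ne hDL hDM T₀).trans ?_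
    exact mul_le_mul_of_nonneg_right (le_add_of_nonneg_right zero_le_one) (Real.exp_pos _).le
  intro T₀ x₀ hx₀ b hb u hum hu
  refine ⟨fun γ hγ0 hγ hγ2 i hi => ⟨hp.integrable_error ht hgrad hb hum hx₀ hi,
    hp.tendsto_integral_error ht hgrad hb hum hu hx₀ hγ0 hγ hγ2 hi⟩, ?_⟩
  intro γ err
  have herr : ∀ T, err T ≤ 4 * η ^ 2 := hp.integral_error_le ht hgrad hb hum hx₀
  have hrate : ∀ T : ℕ, T₀ < T → err T ≤
      (4 * ResilientOpt.hBar μ L η g (ResilientOpt.rhoLeg G Leg) ((T : ℝ) - T₀) + C T₀) /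
        (μ * ((T : ℝ) - T₀) * ((T : ℝ) - T₀ + 1)) := by
    intro T hT
    obtain ⟨τ, rfl⟩ := Nat.exists_eq_add_of_lt hT
    have h1 := hp.mul_integral_error_le (T₀ := T₀) ht hgrad hb hum hu hx₀ hL (τ + 1)
    have h2 : ((T₀ + τ + 1 : ℕ) : ℝ) - T₀ = ((τ + 1 : ℕ) : ℝ) := by push_cast; ring
    have h3 : (0 : ℝ) < ((τ + 1 : ℕ) : ℝ) := by positivity
    rw [h2, mul_assoc μ, ← div_div, le_div_iff₀ (by positivity), mul_comm (err _)]
    exact h1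
  refine ⟨fun T _ => herr T, fun T hT => le_min (herr T) (hrate T hT), ?_⟩
  obtain ⟨K, hK, hKh⟩ := ResilientOpt.exists_hBar_le hμ hL hη.le hg0 hρ
  exact ResilientOpt.isBigO_of_le hμ (hC0 T₀) hK (fun T => by positivity) hKh hrate
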